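/- Let $k$ be a field and let $S=\bigoplus_{\mathbf n\in\mathbb N^r}S_{\mathbf n}$ be a Noetherian $\mathbb N^r$-graded $k$-algebra with $S_0=k$ that is Cohen--Macaulay of Krull dimension $d$; let $\mathcal M=\bigoplus_{\mathbf n\neq 0}S_{\mathbf n}$ be its homogeneous maximal ideal. Let $M$ be a finitely generated $\mathbb Z^r$-graded $S$-module of dimension $m$ and depth $\rho$ (the supremum of the lengths of $M$-regular sequences in $\mathcal M$) that has a finite minimal $\mathbb Z^r$-graded free resolution $$0\to D_l\to\cdots\to D_1\to D_0\to M\to 0,\qquad D_p=\bigoplus_q S(\mathbf a_{pq}),\quad \mathbf a_{pq}=(a^1_{pq},\dots,a^r_{pq})\in\mathbb Z^r,$$ with finite direct sums, where $S(\mathbf a)_{\mathbf n}=S_{\mathbf a+\mathbf n}$, the maps preserve degrees, and minimality means that the image of $D_{p+1}$ lies in $\mathcal M D_p$ for all $p\ge 0$; put $D_p=0$ for $p>l$. Let $H^i_{\mathcal M}$ be the $i$-th right derived functor of $\Gamma_{\mathcal M}(N)=\{x\in N:\mathcal M^t x=0\text{ for some }t\ge 0\}$ on the category of $\mathbb Z^r$-graded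 $S$-modules. For a finitely generated graded module $N$ and $1\le j\le r$ let $$a_i^j(N)=\max\{n^j:\ \mathbf n\in\mathbb Z^r,\ [H^i_{\mathcal M}(N)]_{\mathbf n}\neq 0\}$$ (and $-\infty$ if $H^i_{\mathcal M}(N)=0$), $a^j(S)=a^j_d(S)$ and $a_*^j(M)=\max_{0\le i\le m}a_i^j(M)$. Let $t_p^j(M)=\max_q\{-a^j_{pq}\}$ and $t_*^j(M)=\max_{0\le p\le l}t_p^j(M)$. For a permutation $\sigma$ of $\{1,\dots,r\}$ write $\mathbf u\le_\sigma\mathbf v$ if $(u_{\sigma(1)},\dots,u_{\sigma(r)})\le_{\mathrm{lex}}(v_{\sigma(1)},\dots,v_{\sigma(r)})$, and let $\mathbf M_p^\sigma=\max_{\le_\sigma}\{-\mathbf a_{pq}\}_q$. The maximum of the empty set is $-\infty$. Then for every $j=1,\dots,r$ the maxima defining $a^j_i(M)$ and $a^j(S)$ exist, $a^j(S)$ is an integer, and: 1. $a_{d-p}^j(M)\le t_p^j(M)+a^j(S)$ for $d-m\le p\le d-\rho$. 2. If for some $p\ge 0$ there is a permutation $\sigma$ with $\sigma(1)=j$ and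 $\mathbf M_p^\sigma>_\sigma\mathbf M_{p+1}^\sigma$, then $p\le d$ and $a_{d-p}^j(M)=t_p^j(M)+a^j(S)$. 3. $a_*^j(M)=t_*^j(M)+a^j(S)$; that is, $\mathbf a_*(M)=\mathbf t_*(M)+\mathbf a(S)$, where $\mathbf a_*(M)=(a_*^j(M))_j$, $\mathbf t_*(M)=(t_*^j(M))_j$ and $\mathbf a(S)=(a^j(S))_j$. -/

import Mathlib

universe u v

open scoped DirectSum

/-- A `ℤ^r`-graded module over a `ℤ^r`-graded ring `S = ⨁ 𝒜 n`: an `S`-module with a direct sum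
decomposition into additive subgroups `gr n` such that `𝒜 m • gr n ⊆ gr (m + n)`. -/
structure GrMod {r : ℕ} {S : Type u} [CommRing S] (𝒜 : (Fin r → ℤ) → AddSubgroup S) where
  carrier : Type u
  [addCommGroup : AddCommGroup carrier]
  [module : Module S carrier]
  gr : (Fin r → ℤ) → AddSubgroup carrier
  isInternal : DirectSum.IsInternal gr
  smul_mem : ∀ (m n : Fin r → ℤ) (a : S) (x : carrier),
    a ∈ 𝒜 m → x ∈ gr n → a • x ∈ gr (m + n)

attribute [instance] GrMod.addCommGroup GrMod.module

/-- The submodule `Γ_I(X)` of the elements killed by a power of the ideal `I`. -/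
def gammaTorsion {S : Type u} [CommRing S] (I : Ideal S) (X : Type u) [AddCommGroup X]
    [Module S X] : Submodule S X where
  carrier := {x | ∃ t : ℕ, ∀ a ∈ I ^ t, a • x = 0}
  zero_mem' := ⟨0, fun a _ => smul_zero a⟩
  add_mem' := by
    rintro x y ⟨s, hs⟩ ⟨t, ht⟩
    refine ⟨s + t, fun a ha => ?_⟩
    rw [smul_add, hs a (Ideal.pow_le_pow_right (Nat.le_add_right s t) ha),
      ht a (Ideal.pow_le_pow_right (Nat.le_add_left t s) ha), add_zero]
  smul_mem' := by
    rintro c x ⟨t, ht⟩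
    exact ⟨t, fun a ha => by rw [smul_comm, ht a ha, smul_zero]⟩

/-- A Noetherian local ring is Cohen–Macaulay if its maximal ideal contains a regular sequence
whose length is the Krull dimension of the ring. -/
def IsCohenMacaulayLocal (R : Type u) [CommRing R] [IsLocalRing R] : Prop :=
  ∃ rs : List R, (∀ x ∈ rs, x ∈ IsLocalRing.maximalIdeal R) ∧
    RingTheory.Sequence.IsRegular R rs ∧ (rs.length : WithBot ℕ∞) = ringKrullDim R

/-- A Noetherian ring is Cohen–Macaulay if all its localizations at primes are. -/
def IsCohenMacaulay (S : Type u) [CommRing S] : Prop :=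
  IsNoetherianRing S ∧
    ∀ (P : Ideal S) [P.IsPrime], IsCohenMacaulayLocal (Localization.AtPrime P)

/-- The integers with `-∞` and `+∞` added. -/
abbrev ExtInt : Type := WithBot (WithTop ℤ)

/-- The inclusion of the integers in the extended integers. -/
def ExtInt.ofInt (z : ℤ) : ExtInt := ((z : WithTop ℤ) : WithBot (WithTop ℤ))

namespace GrMod

section

variable {r : ℕ} {S : Type u} [CommRing S] {𝒜 : (Fin r → ℤ) → AddSubgroup S}

/-- An `S`-linear map is a morphism of graded modules if it preserves degrees. -/
def IsHom {M N : GrMod 𝒜} (f : M.carrier →ₗ[S] N.carrier) : Prop :=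
  ∀ (n : Fin r → ℤ) (x : M.carrier), x ∈ M.gr n → f x ∈ N.gr n

/-- Injective objects of the category of graded `S`-modules. -/
def IsInjective (E : GrMod 𝒜) : Prop :=
  ∀ (A B : GrMod 𝒜) (i : A.carrier →ₗ[S] B.carrier) (f : A.carrier →ₗ[S] E.carrier),
    IsHom i → Function.Injective i → IsHom f →
      ∃ g : B.carrier →ₗ[S] E.carrier, IsHom g ∧ g ∘ₗ i = f

/-- The ideal generated by the homogeneous elements of nonzero degree. When `S` is `ℕ^r`-graded
and `S_0` is a field, it is the homogeneous maximal ideal of `S`. -/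
def maxIdeal (𝒜 : (Fin r → ℤ) → AddSubgroup S) : Ideal S :=
  Ideal.span {x | ∃ n : Fin r → ℤ, n ≠ 0 ∧ x ∈ 𝒜 n}

/-- An injective resolution `0 → M → I 0 → I 1 → ⋯` in the category of graded `S`-modules. -/
structure InjRes (M : GrMod 𝒜) where
  I : ℕ → GrMod 𝒜
  inj : ∀ p, (I p).IsInjective
  ε : M.carrier →ₗ[S] (I 0).carrier
  δ : ∀ p, (I p).carrier →ₗ[S] (I (p + 1)).carrier
  ε_hom : IsHom ε
  δ_hom : ∀ p, IsHom (δ p)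
  ε_injective : Function.Injective ε
  exact_zero : Function.Exact ε (δ 0)
  exact_succ : ∀ p, Function.Exact (δ p) (δ (p + 1))

namespace InjRes

variable {M : GrMod 𝒜} (R : InjRes M)

/-- The degree `n` component of the module of `i`-cochains of the complex `Γ_𝓜(I)`. -/
def cochains (i : ℕ) (n : Fin r → ℤ) : AddSubgroup (R.I i).carrier :=
  (R.I i).gr n ⊓ (gammaTorsion (maxIdeal 𝒜) (R.I i).carrier).toAddSubgroup

/-- The degree `n` component of the module of `i`-cocycles of the complex `Γ_𝓜(I)`. -/
def cocycles (i : ℕ) (n : Fin r → ℤ) : AddSubgroup (R.I i).carrier :=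
  R.cochains i n ⊓ (LinearMap.ker (R.δ i)).toAddSubgroup

/-- The degree `n` component of the module of `i`-coboundaries of the complex `Γ_𝓜(I)`. -/
def coboundaries : (i : ℕ) → (n : Fin r → ℤ) → AddSubgroup (R.I i).carrier
  | 0, _ => ⊥
  | i + 1, n => (R.cochains i n).map (R.δ i).toAddMonoidHom

/-- The degree `n` component of the `i`-th cohomology of the complex `Γ_𝓜(I)`. -/
abbrev cohomology (i : ℕ) (n : Fin r → ℤ) : Type u :=
  R.cocycles i n ⧸ (R.coboundaries i n).addSubgroupOf (R.cocycles i n)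

end InjRes

/-- The support of the local cohomology module `H^i_𝓜(M)`, the `i`-th right derived functor of
`Γ_𝓜` on graded `S`-modules: the degrees `n` with `[H^i_𝓜(M)]_n ≠ 0`. Up to isomorphism the
cohomology of `Γ_𝓜(I)` does not depend on the injective resolution `I`. -/
def localCohomologySupport (M : GrMod 𝒜) (i : ℕ) : Set (Fin r → ℤ) :=
  {n | ∃ R : InjRes M, Nontrivial (R.cohomology i n)}

/-- The invariant `a_i^j(M)`: the largest `j`-th component of a degree in which `H^i_𝓜(M)` is
nonzero; it is `-∞` if `H^i_𝓜(M) = 0`, and `+∞` if these components are unbounded above. -/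
noncomputable def aInv (M : GrMod 𝒜) (i : ℕ) (j : Fin r) : ExtInt :=
  ⨆ n ∈ M.localCohomologySupport i, ExtInt.ofInt (n j)

/-- The invariant `a_*^j(M)`: the maximum of `a_i^j(M)` for `0 ≤ i ≤ dim M`. -/
noncomputable def aStar (M : GrMod 𝒜) (j : Fin r) : ExtInt :=
  ⨆ i ∈ {i : ℕ | (i : WithBot ℕ∞) ≤ Module.supportDim S M.carrier}, M.aInv i j

/-- The depth of `M`: the supremum of the lengths of the `M`-regular sequences in the
homogeneous maximal ideal. -/
noncomputable def depth (M : GrMod 𝒜) : ℕ∞ :=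
  ⨆ rs ∈ {rs : List S | (∀ x ∈ rs, x ∈ maxIdeal 𝒜) ∧
    RingTheory.Sequence.IsRegular M.carrier rs}, (rs.length : ℕ∞)

end

section

variable {r : ℕ} {S : Type u} [CommRing S] (𝒜 : (Fin r → ℤ) → AddSubgroup S) [GradedRing 𝒜]

/-- The graded ring as a graded module over itself. -/
def self : GrMod 𝒜 where
  carrier := S
  gr := 𝒜
  isInternal := DirectSum.Decomposition.isInternal 𝒜
  smul_mem _ _ _ _ ha hx := SetLike.GradedMul.mul_mem ha hx

/-- The degree `n` component of `⨁_q S(a_q)`, where `S(a)_n = S_{a + n}`. -/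
def freeGr {b : ℕ} (a : Fin b → Fin r → ℤ) (n : Fin r → ℤ) : AddSubgroup (Fin b → S) where
  carrier := {x | ∀ q, x q ∈ 𝒜 (a q + n)}
  zero_mem' q := (𝒜 (a q + n)).zero_mem
  add_mem' hx hy q := (𝒜 (a q + n)).add_mem (hx q) (hy q)
  neg_mem' hx q := (𝒜 (a q + n)).neg_mem (hx q)

theorem freeGr_decompose {b : ℕ} (a : Fin b → Fin r → ℤ) (x : ⨁ n, freeGr 𝒜 a n)
    (q : Fin b) (n : Fin r → ℤ) :
    (DirectSum.decompose 𝒜 (DirectSum.coeAddMonoidHom (freeGr 𝒜 a) x q) (a q + n) : S) =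
      (x n : Fin b → S) q := by
  induction x using DirectSum.induction_on with
  | zero => simp
  | of i y =>
    rw [DirectSum.coeAddMonoidHom_of]
    by_cases h : i = n
    · subst h
      rw [DirectSum.decompose_of_mem_same 𝒜 (y.2 q), DirectSum.of_eq_same]
    · rw [DirectSum.decompose_of_mem_ne 𝒜 (y.2 q) (fun h' => h (add_left_cancel h')),
        DirectSum.of_eq_of_ne _ _ _ (Ne.symm h)]
      rfl
  | add x y hx hy =>
    rw [map_add, Pi.add_apply, DirectSum.decompose_add, DirectSum.add_apply, DirectSum.add_apply]
    simp [hx, hy]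

theorem freeGr_isInternal {b : ℕ} (a : Fin b → Fin r → ℤ) :
    DirectSum.IsInternal (freeGr 𝒜 a) := by
  classical
  refine ⟨(injective_iff_map_eq_zero _).2 fun x hx => ?_, fun v => ?_⟩
  · refine DFinsupp.ext fun n => Subtype.ext (funext fun q => ?_)
    have h := freeGr_decompose 𝒜 a x q n
    rw [hx, Pi.zero_apply, DirectSum.decompose_zero] at h
    exact h.symm
  · change v ∈ (DirectSum.coeAddMonoidHom (freeGr 𝒜 a)).range
    rw [← Finset.univ_sum_single v]
    refine AddSubgroup.sum_mem _ fun q _ => ?_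
    rw [← DirectSum.sum_support_decompose 𝒜 (v q)]
    change AddMonoidHom.single (fun _ : Fin b => S) q _ ∈ _
    rw [map_sum]
    refine AddSubgroup.sum_mem _ fun n _ => ?_
    refine ⟨DirectSum.of (fun i => freeGr 𝒜 a i) (n - a q)
      ⟨Pi.single q (DirectSum.decompose 𝒜 (v q) n : S), fun q' => ?_⟩, ?_⟩
    · by_cases h : q' = q
      · subst h
        rw [Pi.single_eq_same, add_sub_cancel]
        exact (DirectSum.decompose 𝒜 (v q') n).2
      · rw [Pi.single_eq_of_ne h]
        exact AddSubgroup.zero_mem _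
    · rw [DirectSum.coeAddMonoidHom_of]
      rfl

/-- The graded free module `⨁_q S(a_q)`. -/
def free {b : ℕ} (a : Fin b → Fin r → ℤ) : GrMod 𝒜 where
  carrier := Fin b → S
  gr := freeGr 𝒜 a
  isInternal := freeGr_isInternal 𝒜 a
  smul_mem m n c x hc hx q := by
    have h : c * x q ∈ 𝒜 (m + (a q + n)) := SetLike.GradedMul.mul_mem hc (hx q)
    rw [add_left_comm] at h
    exact h

end

/-- A finite minimal graded free resolution `0 → D_l → ⋯ → D_0 → M → 0` with
`D_p = ⨁_q S(a_{pq})`, where `a_{pq} = shift p q` and `1 ≤ q ≤ rank p`. -/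
structure MinFreeRes {r : ℕ} {S : Type u} [CommRing S] {𝒜 : (Fin r → ℤ) → AddSubgroup S}
    [GradedRing 𝒜] (M : GrMod 𝒜) where
  rank : ℕ → ℕ
  shift : ∀ p, Fin (rank p) → Fin r → ℤ
  ε : (free 𝒜 (shift 0)).carrier →ₗ[S] M.carrier
  δ : ∀ p, (free 𝒜 (shift (p + 1))).carrier →ₗ[S] (free 𝒜 (shift p)).carrier
  ε_hom : IsHom ε
  δ_hom : ∀ p, IsHom (δ p)
  ε_surjective : Function.Surjective ε
  exact_zero : Function.Exact (δ 0) ε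
  exact_succ : ∀ p, Function.Exact (δ (p + 1)) (δ p)
  minimal : ∀ p, LinearMap.range (δ p) ≤
    maxIdeal 𝒜 • (⊤ : Submodule S (free 𝒜 (shift p)).carrier)
  l : ℕ
  finite : ∀ p, l < p → rank p = 0

namespace MinFreeRes

variable {r : ℕ} {S : Type u} [CommRing S] {𝒜 : (Fin r → ℤ) → AddSubgroup S} [GradedRing 𝒜]
  {M : GrMod 𝒜} (D : MinFreeRes M)

/-- `t_p^j(M) = max_q (-a_{pq}^j)`, which is `-∞` if `D_p = 0`. -/
noncomputable def t (p : ℕ) (j : Fin r) : ExtInt :=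
  Finset.univ.sup fun q : Fin (D.rank p) => ExtInt.ofInt (-D.shift p q j)

/-- `t_*^j(M) = max_p t_p^j(M)` for `0 ≤ p ≤ l`. -/
noncomputable def tStar (j : Fin r) : ExtInt :=
  (Finset.range (D.l + 1)).sup fun p => D.t p j

/-- The maximum, for the order `≤_σ`, of the vectors `-a_{pq}` (it is `-∞` if `D_p = 0`). Here
`u ≤_σ v` if and only if `(u_{σ(1)}, …, u_{σ(r)})` is lexicographically at most
`(v_{σ(1)}, …, v_{σ(r)})`, so a vector `u` is recorded as `(u_{σ(1)}, …, u_{σ(r)})`. -/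
noncomputable def lexMax (σ : Equiv.Perm (Fin r)) (p : ℕ) : WithBot (Lex (Fin r → ℤ)) :=
  Finset.univ.sup fun q : Fin (D.rank p) =>
    ((toLex fun i => -D.shift p q (σ i) : Lex (Fin r → ℤ)) : WithBot (Lex (Fin r → ℤ)))

end MinFreeRes

end GrMod

namespace GrMod

/-! Write H^i for graded local cohomology. The proof rests on H^i(S) = 0 for i ≠ d. Cut the
resolution into short exact sequences 0 → Z_{p+1} → D_p → Z_p → 0 with Z_0 = M. Dimension shifting
then makes H^{d-p}(M) the homology of the complex H^d(D_•) at the place p. Two consequences are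
used. A degree of H^{d-p}(M) is a degree of H^d(D_p) (`FreeRes.nontrivial_H_term_of_nontrivial`).
Conversely, a degree of H^d(D_p) in which H^d(D_{p+1}) vanishes and H^d(D_p) → H^d(D_{p-1}) is zero
is a degree of H^{d-p}(M), and then p ≤ d (`FreeRes.nontrivial_H_of_nontrivial_term`).

H^d(D_p) is the sum of the H^d(S)(a_{pq}), so the first consequence gives the upper bound. For
equality let m be the σ-largest degree of H^d(S), let -a_{pq₀} = M_p^σ, and look at the degree m -
a_{pq₀}. There H^d(D_{p+1}) vanishes because M_{p+1}^σ is smaller. By minimality a nonzero entry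
S(a_{pq}) → S(a_{p-1,q'}) of the differential has positive degree, so a_{p-1,q'} is σ-larger than
a_{pq₀} and H^d of its target vanishes too. The class therefore survives
(`MinFreeRes.nontrivial_H_of_lexMax_lt`). For the last claim take the last p at which M_p^σ is
largest overall.

Vanishing above d, and boundedness of the degrees, come from Noetherian induction over graded
quotients (`isTame_of_finite`). Vanishing below d comes from a regular sequence in the localization
at the homogeneous maximal ideal: Rees' argument kills Ext^i(L, S) for torsion L, and dimension
shifting along an injective resolution turns this into local cohomology
(`subsingleton_H_self_of_lt`). The sequence has length d because the homogeneous maximal ideal has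
height dim S (`height_maxIdeal`). Finally H^d(S) ≠ 0, since otherwise the residue field would have
no torsion (`exists_nontrivial_H_self`). -/

theorem isInternal_of_separating {ι X Y : Type*} [DecidableEq ι] [AddCommGroup X] [AddCommGroup Y]
    (gr : ι → AddSubgroup X)
    (hsep : ∀ n x, x ∈ gr n → x ≠ 0 →
      ∃ q : X →+ Y, q x ≠ 0 ∧ ∀ m, m ≠ n → ∀ y ∈ gr m, q y = 0)
    (htop : ∀ x, x ∈ ⨆ n, gr n) : DirectSum.IsInternal gr := by
  refine ⟨(injective_iff_map_eq_zero _).2 fun x hx => ?_, fun x => ?_⟩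
  · refine DFinsupp.ext fun n => Subtype.ext ?_
    by_contra hne
    obtain ⟨q, hq, hq'⟩ := hsep n (x n) (x n).2 hne
    apply hq
    -- As `q` kills all other degrees, it reads off the component of degree `n` of a sum.
    have key : ∀ y : ⨁ n, gr n, q (DirectSum.coeAddMonoidHom gr y) = q (y n) := by
      intro y
      induction y using DirectSum.induction_on with
      | zero => simp
      | of i y =>
        rw [DirectSum.coeAddMonoidHom_of]
        by_cases h : i = n
        · subst h; rw [DirectSum.of_eq_same]
        · rw [DirectSum.of_eq_of_ne _ _ _ (Ne.symm h), hq' i h _ y.2]; simp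
      | add x y hx hy => simp only [map_add, hx, hy, DirectSum.add_apply, AddSubgroup.coe_add]
    rw [← key x, hx, map_zero]
  · change x ∈ (DirectSum.coeAddMonoidHom gr).range
    refine (iSup_le fun n y hy => ?_ : ⨆ n, gr n ≤ _) (htop x)
    exact ⟨DirectSum.of (fun i => gr i) n ⟨y, hy⟩,
      DirectSum.coeAddMonoidHom_of gr n ⟨y, hy⟩⟩

/-! ### Graded modules: components, morphisms, submodules, quotients, products, shifts. -/

section Basic

variable {r : ℕ} {S : Type u} [CommRing S] {𝒜 : (Fin r → ℤ) → AddSubgroup S}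

/-- The equivalence of a graded module with the direct sum of its components. -/
noncomputable def decomp (M : GrMod 𝒜) : (⨁ n, M.gr n) ≃+ M.carrier :=
  AddEquiv.ofBijective (DirectSum.coeAddMonoidHom M.gr) M.isInternal

/-- The projection of a graded module to its component of degree `n`. -/
noncomputable def proj (M : GrMod 𝒜) (n : Fin r → ℤ) : M.carrier →+ M.carrier where
  toFun x := (M.decomp.symm x n : M.carrier)
  map_zero' := by simp
  map_add' x y := by simp

variable (M : GrMod 𝒜)

theorem proj_mem (n : Fin r → ℤ) (x : M.carrier) : M.proj n x ∈ M.gr n := (M.decomp.symm x n).2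

theorem decomp_symm_of_mem {n : Fin r → ℤ} {x : M.carrier} (hx : x ∈ M.gr n) :
    M.decomp.symm x = DirectSum.of (fun i => M.gr i) n ⟨x, hx⟩ := by
  rw [AddEquiv.symm_apply_eq]
  exact (DirectSum.coeAddMonoidHom_of M.gr n ⟨x, hx⟩).symm

theorem proj_of_mem {n : Fin r → ℤ} {x : M.carrier} (hx : x ∈ M.gr n) : M.proj n x = x := by
  change (M.decomp.symm x n : M.carrier) = x
  rw [M.decomp_symm_of_mem hx, DirectSum.of_eq_same]

theorem proj_of_mem_ne {m n : Fin r → ℤ} {x : M.carrier} (hx : x ∈ M.gr m) (h : m ≠ n) :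
    M.proj n x = 0 := by
  change (M.decomp.symm x n : M.carrier) = 0
  rw [M.decomp_symm_of_mem hx, DirectSum.of_eq_of_ne _ _ _ h.symm]; rfl

theorem exists_sum_proj (x : M.carrier) :
    ∃ s : Finset (Fin r → ℤ), x = ∑ n ∈ s, M.proj n x ∧ ∀ n ∉ s, M.proj n x = 0 := by
  classical
  refine ⟨(M.decomp.symm x).support, ?_, fun n hn => ?_⟩
  · conv_lhs => rw [← M.decomp.apply_symm_apply x]
    change DirectSum.coeAddMonoidHom M.gr _ = _
    rw [DirectSum.coeAddMonoidHom_eq_dfinsuppSum, DFinsupp.sum]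
    rfl
  · have h : M.decomp.symm x n = 0 := by simpa using hn
    change (M.decomp.symm x n : M.carrier) = 0
    rw [h]; rfl

theorem ext_proj {x y : M.carrier} (h : ∀ n, M.proj n x = M.proj n y) : x = y := by
  apply M.decomp.symm.injective
  exact DFinsupp.ext fun n => Subtype.ext (h n)

theorem gr_induction {p : M.carrier → Prop} (zero : p 0)
    (homog : ∀ n x, x ∈ M.gr n → p x) (add : ∀ x y, p x → p y → p (x + y)) (x : M.carrier) :
    p x := by
  obtain ⟨s, hs, -⟩ := M.exists_sum_proj x
  rw [hs]
  exact Finset.sum_induction _ p add zero fun n _ => homog n _ (M.proj_mem n x)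

theorem disjoint_gr {m n : Fin r → ℤ} (h : m ≠ n) {x : M.carrier} (hm : x ∈ M.gr m)
    (hn : x ∈ M.gr n) : x = 0 := by
  rw [← M.proj_of_mem hm]; exact M.proj_of_mem_ne hn h.symm

theorem smul_proj {m : Fin r → ℤ} {a : S} (ha : a ∈ 𝒜 m) (n : Fin r → ℤ) (x : M.carrier) :
    M.proj (m + n) (a • x) = a • M.proj n x := by
  induction x using M.gr_induction with
  | zero => simp
  | homog l x hx =>
    by_cases h : l = n
    · subst h
      rw [M.proj_of_mem hx, M.proj_of_mem (M.smul_mem _ _ _ _ ha hx)]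
    · rw [M.proj_of_mem_ne hx h, smul_zero, M.proj_of_mem_ne (M.smul_mem _ _ _ _ ha hx)]
      exact fun h' => h (add_left_cancel h')
  | add x y hx hy => rw [smul_add, map_add, map_add, hx, hy, smul_add]

variable {M} in
theorem IsHom.map_proj {N : GrMod 𝒜} {f : M.carrier →ₗ[S] N.carrier} (hf : IsHom f)
    (n : Fin r → ℤ) (x : M.carrier) : f (M.proj n x) = N.proj n (f x) := by
  induction x using M.gr_induction with
  | zero => simp
  | homog l x hx =>
    by_cases h : l = n
    · subst h
      rw [M.proj_of_mem hx, N.proj_of_mem (hf _ _ hx)]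
    · rw [M.proj_of_mem_ne hx h, map_zero, N.proj_of_mem_ne (hf _ _ hx) h]
  | add x y hx hy => simp only [map_add, hx, hy]

/-- The group of degree preserving linear maps. -/
def homs (M N : GrMod 𝒜) : AddSubgroup (M.carrier →ₗ[S] N.carrier) where
  carrier := {f | IsHom f}
  zero_mem' n _ _ := (N.gr n).zero_mem
  add_mem' hf hg n x hx := (N.gr n).add_mem (hf n x hx) (hg n x hx)
  neg_mem' hf n x hx := (N.gr n).neg_mem (hf n x hx)

/-- The type of morphisms of graded modules. -/
abbrev Hom (M N : GrMod 𝒜) : Type u := homs M N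

namespace Hom

variable {M} {N P Q : GrMod 𝒜}

theorem mem (f : Hom M N) {n : Fin r → ℤ} {x : M.carrier} (hx : x ∈ M.gr n) : f.1 x ∈ N.gr n :=
  f.2 n x hx

theorem map_proj (f : Hom M N) (n : Fin r → ℤ) (x : M.carrier) :
    f.1 (M.proj n x) = N.proj n (f.1 x) :=
  IsHom.map_proj f.2 n x

/-- The composition of morphisms. -/
def comp (g : Hom N P) (f : Hom M N) : Hom M P :=
  ⟨g.1 ∘ₗ f.1, fun n x hx => g.2 n _ (f.2 n x hx)⟩

@[simp] theorem comp_apply (g : Hom N P) (f : Hom M N) (x : M.carrier) :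
    (g.comp f).1 x = g.1 (f.1 x) := rfl

/-- The identity morphism. -/
def id (M : GrMod 𝒜) : Hom M M := ⟨LinearMap.id, fun _ _ hx => hx⟩

theorem ext {f g : Hom M N} (h : ∀ x, f.1 x = g.1 x) : f = g :=
  Subtype.ext (LinearMap.ext h)

@[simp] theorem neg_apply (f : Hom M N) (x : M.carrier) : (-f).1 x = -f.1 x := rfl
@[simp] theorem sub_apply (f g : Hom M N) (x : M.carrier) : (f - g).1 x = f.1 x - g.1 x := rfl
@[simp] theorem zero_apply (x : M.carrier) : (0 : Hom M N).1 x = 0 := rfl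

end Hom

/-- Graded submodules. -/
def IsGrSub (N : Submodule S M.carrier) : Prop := ∀ n x, x ∈ N → M.proj n x ∈ N

variable {M}

/-- A graded submodule as a graded module. -/
noncomputable def sub (N : Submodule S M.carrier) (hN : M.IsGrSub N) : GrMod 𝒜 where
  carrier := N
  gr n := (M.gr n).comap N.subtype.toAddMonoidHom
  isInternal := by
    refine isInternal_of_separating (Y := M.carrier) _ (fun n x hx hx0 => ?_) fun x => ?_
    · refine ⟨(M.proj n).comp N.subtype.toAddMonoidHom, ?_, fun m hm y hy => ?_⟩
      · change M.proj n x.1 ≠ 0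
        rw [M.proj_of_mem (x := x.1) hx]
        exact fun h => hx0 (Subtype.ext h)
      · exact M.proj_of_mem_ne hy hm
    · obtain ⟨s, hs, -⟩ := M.exists_sum_proj x.1
      have : x = ∑ n ∈ s, (⟨M.proj n x.1, hN n _ x.2⟩ : N) := by
        apply Subtype.ext; rw [Submodule.coe_sum]; exact hs
      rw [this]
      exact sum_mem fun n _ => AddSubgroup.mem_iSup_of_mem n (M.proj_mem n x.1)
  smul_mem m n a x ha hx := M.smul_mem m n a x.1 ha hx

/-- The inclusion of a graded submodule. -/
noncomputable def subι (N : Submodule S M.carrier) (hN : M.IsGrSub N) : Hom (sub N hN) M :=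
  ⟨N.subtype, fun _ _ hx => hx⟩

/-- The quotient of a graded module by a graded submodule. -/
noncomputable def quot (N : Submodule S M.carrier) (hN : M.IsGrSub N) : GrMod 𝒜 where
  carrier := M.carrier ⧸ N
  gr n := (M.gr n).map N.mkQ.toAddMonoidHom
  isInternal := by
    refine isInternal_of_separating (Y := M.carrier ⧸ N) _ (fun n x hx hx0 => ?_) fun x => ?_
    · obtain ⟨x, hx, rfl⟩ := hx
      refine ⟨QuotientAddGroup.lift N.toAddSubgroup (N.mkQ.toAddMonoidHom.comp (M.proj n))
        fun y hy => ?_, ?_, fun m hm y hy => ?_⟩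
      · exact (Submodule.Quotient.mk_eq_zero N).2 (hN n y hy)
      · change N.mkQ (M.proj n x) ≠ 0
        rw [M.proj_of_mem hx]; exact hx0
      · obtain ⟨y, hy, rfl⟩ := hy
        change N.mkQ (M.proj n y) = 0
        rw [M.proj_of_mem_ne hy hm, map_zero]
    · obtain ⟨x, rfl⟩ := N.mkQ_surjective x
      obtain ⟨s, hs, -⟩ := M.exists_sum_proj x
      rw [hs, map_sum]
      exact sum_mem fun n _ => AddSubgroup.mem_iSup_of_mem n ⟨_, M.proj_mem n x, rfl⟩
  smul_mem := by
    rintro m n a _ ha ⟨x, hx, rfl⟩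
    exact ⟨a • x, M.smul_mem m n a x ha hx, map_smul N.mkQ a x⟩

/-- The projection to a graded quotient. -/
noncomputable def quotπ (N : Submodule S M.carrier) (hN : M.IsGrSub N) : Hom M (quot N hN) :=
  ⟨N.mkQ, fun _ x hx => ⟨x, hx, rfl⟩⟩

theorem quotπ_surjective (N : Submodule S M.carrier) (hN : M.IsGrSub N) :
    Function.Surjective (quotπ N hN).1 := N.mkQ_surjective

theorem quotπ_eq_zero_iff (N : Submodule S M.carrier) (hN : M.IsGrSub N) (x : M.carrier) :
    (quotπ N hN).1 x = 0 ↔ x ∈ N := Submodule.Quotient.mk_eq_zero N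

theorem subι_injective (N : Submodule S M.carrier) (hN : M.IsGrSub N) :
    Function.Injective (subι N hN).1 := N.subtype_injective

variable {N P : GrMod 𝒜}

/-- The morphism out of a quotient induced by a morphism that kills the submodule. -/
noncomputable def quotLift (K : Submodule S M.carrier) (hK : M.IsGrSub K) (f : Hom M N)
    (h : ∀ x ∈ K, f.1 x = 0) : Hom (quot K hK) N :=
  ⟨K.liftQ f.1 h, by rintro n _ ⟨x, hx, rfl⟩; exact f.mem hx⟩

/-- The morphism into a graded submodule that contains the range. -/
noncomputable def subLift (K : Submodule S N.carrier) (hK : N.IsGrSub K) (f : Hom M N)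
    (h : ∀ x, f.1 x ∈ K) : Hom M (sub K hK) :=
  ⟨f.1.codRestrict K h, fun _ _ hx => f.mem hx⟩

theorem isGrSub_ker (f : Hom M N) : M.IsGrSub (LinearMap.ker f.1) := fun n x hx => by
  rw [LinearMap.mem_ker] at hx ⊢
  rw [f.map_proj, hx, map_zero]

theorem isGrSub_range (f : Hom M N) : N.IsGrSub (LinearMap.range f.1) := by
  rintro n _ ⟨x, rfl⟩
  exact ⟨M.proj n x, f.map_proj n x⟩

/-- The product of two graded modules. -/
def prod (M N : GrMod 𝒜) : GrMod 𝒜 where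
  carrier := M.carrier × N.carrier
  gr n := (M.gr n).prod (N.gr n)
  isInternal := by
    refine isInternal_of_separating (Y := M.carrier × N.carrier) _ (fun n x hx hx0 => ?_)
      fun x => ?_
    · refine ⟨(M.proj n).prodMap (N.proj n), ?_, fun m hm y hy => ?_⟩
      · have : (M.proj n).prodMap (N.proj n) x = x :=
          Prod.ext (M.proj_of_mem hx.1) (N.proj_of_mem hx.2)
        rw [this]; exact hx0
      · exact Prod.ext (M.proj_of_mem_ne hy.1 hm) (N.proj_of_mem_ne hy.2 hm)
    · have hx : x = (x.1, 0) + (0, x.2) := by simp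
      rw [hx]
      refine add_mem ?_ ?_
      · refine M.gr_induction (p := fun y => (y, (0 : N.carrier)) ∈ ⨆ n, (M.gr n).prod (N.gr n)) (zero_mem _)
          (fun n y hy => AddSubgroup.mem_iSup_of_mem n ⟨hy, zero_mem _⟩)
          (fun y z hy hz => ?_) x.1
        have := add_mem hy hz
        simpa using this
      · refine N.gr_induction (p := fun y => ((0 : M.carrier), y) ∈ ⨆ n, (M.gr n).prod (N.gr n)) (zero_mem _)
          (fun n y hy => AddSubgroup.mem_iSup_of_mem n ⟨zero_mem _, hy⟩)
          (fun y z hy hz => ?_) x.2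
        have := add_mem hy hz
        simpa using this
  smul_mem m n a x ha hx := ⟨M.smul_mem m n a _ ha hx.1, N.smul_mem m n a _ ha hx.2⟩

/-- The shifted module `M(a)`, with `M(a)_n = M_{a + n}`. -/
def shift (M : GrMod 𝒜) (a : Fin r → ℤ) : GrMod 𝒜 where
  carrier := M.carrier
  gr n := M.gr (a + n)
  isInternal := by
    refine isInternal_of_separating (Y := M.carrier) _ (fun n x hx hx0 => ?_) fun x => ?_
    · refine ⟨M.proj (a + n), ?_, fun m hm y hy => ?_⟩
      · rw [M.proj_of_mem hx]; exact hx0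
      · exact M.proj_of_mem_ne hy fun h => hm (add_left_cancel h)
    · refine M.gr_induction (zero_mem _) (fun n y hy => ?_) (fun y z hy hz => add_mem hy hz) x
      refine AddSubgroup.mem_iSup_of_mem (n - a) ?_
      rwa [add_sub_cancel]
  smul_mem m n c x hc hx := by
    have h := M.smul_mem m (a + n) c x hc hx
    rwa [add_left_comm] at h

/-- A morphism seen as a morphism of shifted modules. -/
def Hom.shift (f : Hom M N) (a : Fin r → ℤ) : Hom (M.shift a) (N.shift a) :=
  ⟨f.1, fun _ _ hx => f.mem hx⟩

/-- Both maps factor through the quotient by the kernel of `u`, where `u` becomes injective. This is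
the form in which injectivity is applied to complexes. -/
theorem IsInjective.exists_extension {E X Y : GrMod 𝒜} (hE : E.IsInjective) (u : Hom X Y)
    (v : Hom X E) (h : ∀ x, u.1 x = 0 → v.1 x = 0) : ∃ w : Hom Y E, ∀ x, w.1 (u.1 x) = v.1 x := by
  obtain ⟨g, hg, hgu⟩ := hE (quot _ (isGrSub_ker u)) Y
    (quotLift _ (isGrSub_ker u) u fun x hx => hx).1
    (quotLift _ (isGrSub_ker u) v fun x hx => h x hx).1
    (quotLift _ (isGrSub_ker u) u fun x hx => hx).2
    (by
      rw [← LinearMap.ker_eq_bot]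
      exact Submodule.ker_liftQ_eq_bot _ _ _ le_rfl)
    (quotLift _ (isGrSub_ker u) v fun x hx => h x hx).2
  exact ⟨⟨g, hg⟩, fun x => LinearMap.congr_fun hgu (Submodule.Quotient.mk x)⟩

end Basic

end GrMod

namespace GrMod

/-! ### Coinduced modules and enough graded injectives. -/

section OfFamily

variable {r : ℕ} {S : Type u} [CommRing S] {𝒜 : (Fin r → ℤ) → AddSubgroup S} [GradedRing 𝒜]

/-- The submodule spanned by the members of a family of subgroups on which `S` acts compatibly
with the degrees. -/
def familySpan {X : Type u} [AddCommGroup X] [Module S X] (gr : (Fin r → ℤ) → AddSubgroup X)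
    (smul_mem : ∀ (m n : Fin r → ℤ) (a : S) (x : X), a ∈ 𝒜 m → x ∈ gr n → a • x ∈ gr (m + n)) :
    Submodule S X :=
  { (⨆ n, gr n : AddSubgroup X) with
    smul_mem' := by
      intro a x hx
      change a • x ∈ (⨆ n, gr n : AddSubgroup X)
      induction a using DirectSum.Decomposition.inductionOn 𝒜 with
      | zero => rw [zero_smul]; exact zero_mem _
      | @homogeneous m a =>
        refine AddSubgroup.iSup_induction gr (C := fun x => (a : S) • x ∈ ⨆ n, gr n) hx
          (fun n y hy => AddSubgroup.mem_iSup_of_mem (m + n) (smul_mem m n _ y a.2 hy)) ?_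
          fun y z hy hz => ?_
        · rw [smul_zero]; exact zero_mem _
        · rw [smul_add]; exact add_mem hy hz
      | add a b ha hb => rw [add_smul]; exact add_mem ha hb }

theorem mem_familySpan {X : Type u} [AddCommGroup X] [Module S X]
    (gr : (Fin r → ℤ) → AddSubgroup X)
    (smul_mem : ∀ (m n : Fin r → ℤ) (a : S) (x : X), a ∈ 𝒜 m → x ∈ gr n → a • x ∈ gr (m + n))
    {n : Fin r → ℤ} {x : X} (hx : x ∈ gr n) : x ∈ familySpan gr smul_mem :=
  AddSubgroup.mem_iSup_of_mem n hx

/-- The graded module spanned by a family of subgroups of a module. -/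
def ofFamily {X Y : Type u} [AddCommGroup X] [Module S X] [AddCommGroup Y]
    (gr : (Fin r → ℤ) → AddSubgroup X)
    (smul_mem : ∀ (m n : Fin r → ℤ) (a : S) (x : X), a ∈ 𝒜 m → x ∈ gr n → a • x ∈ gr (m + n))
    (hsep : ∀ n x, x ∈ gr n → x ≠ 0 →
      ∃ q : X →+ Y, q x ≠ 0 ∧ ∀ m, m ≠ n → ∀ y ∈ gr m, q y = 0) : GrMod 𝒜 where
  carrier := familySpan gr smul_mem
  gr n := (gr n).comap (familySpan gr smul_mem).subtype.toAddMonoidHom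
  isInternal := by
    refine isInternal_of_separating (Y := Y) _ (fun n x hx hx0 => ?_) fun x => ?_
    · obtain ⟨q, hq, hq'⟩ := hsep n x.1 hx fun h => hx0 (Subtype.ext h)
      exact ⟨q.comp (familySpan gr smul_mem).subtype.toAddMonoidHom, hq,
        fun m hm y hy => hq' m hm _ hy⟩
    · obtain ⟨x, hx⟩ := x
      refine AddSubgroup.iSup_induction' gr
        (C := fun x hx => (⟨x, hx⟩ : familySpan gr smul_mem) ∈
          ⨆ n, (gr n).comap (familySpan gr smul_mem).subtype.toAddMonoidHom) ?_ ?_ ?_ hx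
      · exact fun n y hy => AddSubgroup.mem_iSup_of_mem n hy
      · exact zero_mem _
      · exact fun y z _ _ hy hz => add_mem hy hz
  smul_mem m n a x ha hx := smul_mem m n a x.1 ha hx

end OfFamily

section Coinduced

variable (k : Type v) [Field k] {S : Type u} [CommRing S] [Algebra k S] {r : ℕ}
  {𝒜 : (Fin r → ℤ) → AddSubgroup S}

/-- The `k`-linear maps from `S` to a graded module. -/
def linFuns (N : GrMod 𝒜) : AddSubgroup (S →+ N.carrier) where
  carrier := {f | ∀ (c : k) (s : S), f (algebraMap k S c * s) = algebraMap k S c • f s}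
  zero_mem' c s := by simp
  add_mem' hf hg c s := by simp [hf c s, hg c s]
  neg_mem' hf c s := by simp [hf c s]

/-- The group of `k`-linear maps from `S` to a graded module, on which `S` acts through its
action on the source. -/
def CoindFun (N : GrMod 𝒜) : Type u := linFuns k N

instance (N : GrMod 𝒜) : AddCommGroup (CoindFun k N) :=
  inferInstanceAs (AddCommGroup (linFuns k N))

instance (N : GrMod 𝒜) : Module S (CoindFun k N) where
  smul a f := ⟨f.1.comp (AddMonoidHom.mulLeft a), fun c s => by
    change f.1 (a * (algebraMap k S c * s)) = _ • f.1 (a * s)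
    rw [mul_left_comm, f.2]⟩
  one_smul f := Subtype.ext <| AddMonoidHom.ext fun s => congrArg f.1 (one_mul s)
  mul_smul a b f := Subtype.ext <| AddMonoidHom.ext fun s =>
    congrArg f.1 (by change a * b * s = b * (a * s); ring)
  smul_zero a := Subtype.ext <| AddMonoidHom.ext fun s => rfl
  smul_add a f g := Subtype.ext <| AddMonoidHom.ext fun s => rfl
  add_smul a b f := Subtype.ext <| AddMonoidHom.ext fun s =>
    (congrArg f.1 (add_mul a b s)).trans (map_add f.1 _ _)
  zero_smul f := Subtype.ext <| AddMonoidHom.ext fun s =>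
    (congrArg f.1 (zero_mul s)).trans (map_zero f.1)

variable {k}

variable (k) in
/-- The `k`-linear maps from `S` to `N` that raise degrees by `n`. -/
def coindGr (N : GrMod 𝒜) (n : Fin r → ℤ) : AddSubgroup (CoindFun k N) where
  carrier := {f | ∀ m, ∀ s ∈ 𝒜 m, f.1 s ∈ N.gr (m + n)}
  zero_mem' m _ _ := zero_mem (N.gr (m + n))
  add_mem' hf hg m s hs := add_mem (hf m s hs) (hg m s hs)
  neg_mem' hf m s hs := neg_mem (hf m s hs)

/-- Over the field `k` the injection splits linearly; the degree preserving part of a splitting is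
still a splitting. -/
theorem exists_retraction (hk : ∀ c : k, algebraMap k S c ∈ 𝒜 0) {A B : GrMod 𝒜} (i : Hom A B)
    (hi : Function.Injective i.1) :
    ∃ ρ : B.carrier →+ A.carrier, (∀ a, ρ (i.1 a) = a) ∧
      (∀ (c : k) b, ρ (algebraMap k S c • b) = algebraMap k S c • ρ b) ∧
      ∀ n, ∀ b ∈ B.gr n, ρ b ∈ A.gr n := by
  let _ : Module k A.carrier := Module.compHom _ (algebraMap k S)
  let _ : Module k B.carrier := Module.compHom _ (algebraMap k S)
  let i' : A.carrier →ₗ[k] B.carrier :=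
    { toFun := i.1, map_add' := map_add i.1, map_smul' := fun c x => map_smul i.1 _ x }
  obtain ⟨σ, hσ⟩ := i'.exists_leftInverse_of_injective (LinearMap.ker_eq_bot.2 hi)
  let ρ : B.carrier →+ A.carrier :=
    (DirectSum.toAddMonoid fun n => (A.proj n).comp
      (σ.toAddMonoidHom.comp (B.gr n).subtype)).comp B.decomp.symm.toAddMonoidHom
  have hρ : ∀ n, ∀ b ∈ B.gr n, ρ b = A.proj n (σ b) := by
    intro n b hb
    change DirectSum.toAddMonoid _ (B.decomp.symm b) = _
    rw [B.decomp_symm_of_mem hb, DirectSum.toAddMonoid_of]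
    rfl
  refine ⟨ρ, fun a => ?_, fun c b => ?_, fun n b hb => ?_⟩
  · induction a using A.gr_induction with
    | zero => simp
    | homog n a ha =>
      rw [hρ n _ (i.mem ha), show σ (i.1 a) = a from LinearMap.congr_fun hσ a, A.proj_of_mem ha]
    | add x y hx hy => rw [map_add, map_add, hx, hy]
  · induction b using B.gr_induction with
    | zero => simp
    | homog n b hb =>
      have h := B.smul_mem 0 n _ b (hk c) hb
      have h' := A.smul_proj (hk c) n (σ b)
      rw [zero_add] at h h'
      rw [hρ n _ h, hρ n _ hb, ← h']
      exact congrArg _ (map_smul σ c b)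
    | add x y hx hy => rw [smul_add, map_add, map_add, hx, hy, smul_add]
  · rw [hρ n b hb]; exact A.proj_mem _ _

/-- The total degrees of the nonzero homogeneous elements are at most `b`. -/
def WeightLE (N : GrMod 𝒜) (b : ℤ) : Prop := ∀ n, ∀ x ∈ N.gr n, x ≠ 0 → ∑ i, n i ≤ b

theorem WeightLE.quot {N : GrMod 𝒜} {b : ℤ} (h : N.WeightLE b) (K : Submodule S N.carrier)
    (hK : N.IsGrSub K) : (quot K hK).WeightLE b := by
  rintro n _ ⟨x, hx, rfl⟩ hx0
  exact h n x hx fun h0 => hx0 ((congrArg K.mkQ h0).trans (map_zero K.mkQ))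

variable [GradedRing 𝒜]

theorem coindGr_smul_mem (N : GrMod 𝒜) (m n : Fin r → ℤ) (a : S) (f : CoindFun k N)
    (ha : a ∈ 𝒜 m) (hf : f ∈ coindGr k N n) : a • f ∈ coindGr k N (m + n) := by
  intro l s hs
  have := hf (m + l) (a * s) (SetLike.GradedMul.mul_mem ha hs)
  rwa [add_assoc, add_left_comm] at this

theorem exists_homogeneous_apply_ne_zero {N : GrMod 𝒜} {f : CoindFun k N} (hf : f ≠ 0) :
    ∃ m, ∃ s ∈ 𝒜 m, f.1 s ≠ 0 := by
  by_contra! h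
  refine hf (Subtype.ext (AddMonoidHom.ext fun s => ?_))
  change f.1 s = 0
  induction s using DirectSum.Decomposition.inductionOn 𝒜 with
  | zero => exact map_zero _
  | homogeneous s => exact h _ _ s.2
  | add a b ha hb => rw [map_add, ha, hb, add_zero]

variable (k) in
/-- The graded module coinduced from the graded vector space underlying `N`. -/
def coind (N : GrMod 𝒜) : GrMod 𝒜 :=
  ofFamily (Y := N.carrier) (coindGr k N) (coindGr_smul_mem N) fun n f hf hf0 => by
    obtain ⟨m, s, hs, hfs⟩ := exists_homogeneous_apply_ne_zero hf0
    refine ⟨(N.proj (m + n)).comp ((AddMonoidHom.eval s).comp (linFuns k N).subtype), ?_, ?_⟩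
    · change N.proj (m + n) (f.1 s) ≠ 0
      rwa [N.proj_of_mem (hf m s hs)]
    · intro l hl g hg
      exact N.proj_of_mem_ne (hg m s hs) fun h => hl (add_left_cancel h)

/-- The map to a coinduced module induced by a `k`-linear degree preserving map. -/
def coindLift {B N : GrMod 𝒜} (φ : B.carrier →+ N.carrier)
    (hk : ∀ (c : k) b, φ (algebraMap k S c • b) = algebraMap k S c • φ b)
    (hφ : ∀ n, ∀ b ∈ B.gr n, φ b ∈ N.gr n) : Hom B (coind k N) :=
  let F (b : B.carrier) : CoindFun k N :=
    ⟨φ.comp (AddMonoidHom.flip (AddMonoidHom.smul : S →+ B.carrier →+ B.carrier) b),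
      fun c s => by
        change φ ((algebraMap k S c * s) • b) = _ • φ (s • b)
        rw [mul_smul, hk]⟩
  have hF (n) (b) (hb : b ∈ B.gr n) : F b ∈ coindGr k N n := fun m s hs =>
    hφ _ _ (B.smul_mem m n s b hs hb)
  let F' : B.carrier →ₗ[S] CoindFun k N :=
    { toFun := F
      map_add' := fun b b' => Subtype.ext <| AddMonoidHom.ext fun s =>
        (congrArg φ (smul_add s b b')).trans (map_add φ _ _)
      map_smul' := fun a b => Subtype.ext <| AddMonoidHom.ext fun s =>
        congrArg φ (by change s • a • b = (a * s) • b; rw [mul_comm, mul_smul]) }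
  ⟨F'.codRestrict (familySpan (coindGr k N) (coindGr_smul_mem N)) fun b => by
      induction b using B.gr_induction with
      | zero => rw [map_zero]; exact zero_mem _
      | homog n b hb => exact mem_familySpan _ _ (hF n b hb)
      | add x y hx hy => rw [map_add]; exact add_mem hx hy,
    fun n b hb => hF n b hb⟩

theorem coindLift_apply {B N : GrMod 𝒜} (φ : B.carrier →+ N.carrier)
    (hk : ∀ (c : k) b, φ (algebraMap k S c • b) = algebraMap k S c • φ b)
    (hφ : ∀ n, ∀ b ∈ B.gr n, φ b ∈ N.gr n) (b : B.carrier) (s : S) :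
    ((coindLift φ hk hφ).1 b).1.1 s = φ (s • b) := rfl

variable (k) in
/-- Evaluation at `1`. -/
def coindEval (N : GrMod 𝒜) : (coind k N).carrier →+ N.carrier where
  toFun f := f.1.1 1
  map_zero' := rfl
  map_add' _ _ := rfl

theorem coindEval_smul {N : GrMod 𝒜} (a : S) (f : (coind k N).carrier) :
    coindEval k N (a • f) = f.1.1 a :=
  congrArg f.1.1 (mul_one a)

/-- Coinduction is right adjoint to forgetting the `S`-action: morphisms `B → coind k N` are the
`k`-linear degree preserving maps `B → N`. These extend along an injection by composition with a
`k`-linear retraction. -/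
theorem coind_isInjective (hk : ∀ c : k, algebraMap k S c ∈ 𝒜 0) (N : GrMod 𝒜) :
    (coind k N).IsInjective := by
  intro A B i f hi hi' hf
  obtain ⟨ρ, h1, h2, h3⟩ := exists_retraction hk ⟨i, hi⟩ hi'
  let φ : B.carrier →+ N.carrier := (coindEval k N).comp (f.toAddMonoidHom.comp ρ)
  have hφ1 : ∀ (c : k) b, φ (algebraMap k S c • b) = algebraMap k S c • φ b := by
    intro c b
    change coindEval k N (f (ρ _)) = _ • coindEval k N (f (ρ b))
    rw [h2, map_smul, coindEval_smul]
    have := (f (ρ b)).1.2 c 1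
    rwa [mul_one] at this
  have hφ2 : ∀ n, ∀ b ∈ B.gr n, φ b ∈ N.gr n := by
    intro n b hb
    have := hf n _ (h3 n b hb) 0 1 SetLike.GradedOne.one_mem
    rwa [zero_add] at this
  refine ⟨(coindLift φ hφ1 hφ2).1, (coindLift φ hφ1 hφ2).2, LinearMap.ext fun a => ?_⟩
  refine Subtype.ext (Subtype.ext (AddMonoidHom.ext fun s => ?_))
  change coindEval k N (f (ρ (s • i a))) = (f a).1.1 s
  rw [← map_smul, show ρ (i (s • a)) = s • a from h1 _, map_smul, coindEval_smul]

/-- The embedding is `x ↦ (s ↦ s • x)`. The weight bound survives because `S` has no negative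
degrees: a functional of degree `n` that is nonzero on some `s` of degree `m ≥ 0` yields a nonzero
element of `N` of degree `m + n`, so `|n| ≤ |m + n| ≤ b`. -/
theorem exists_injective_embedding (hN : ∀ n : Fin r → ℤ, ¬ 0 ≤ n → 𝒜 n = ⊥)
    (hk : ∀ c : k, algebraMap k S c ∈ 𝒜 0) (N : GrMod 𝒜) :
    ∃ (E : GrMod 𝒜) (ι : Hom N E), E.IsInjective ∧ Function.Injective ι.1 ∧
      ∀ b, N.WeightLE b → E.WeightLE b := by
  refine ⟨coind k N, coindLift (AddMonoidHom.id _) (fun _ _ => rfl) (fun _ _ h => h),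
    coind_isInjective hk N, ?_, ?_⟩
  · intro x y hxy
    have h : ∀ z : N.carrier, ((coindLift (k := k) (AddMonoidHom.id N.carrier) (fun _ _ => rfl)
        (fun _ _ h => h)).1 z).1.1 1 = z := fun z => by
      rw [coindLift_apply, one_smul]; rfl
    rw [← h x, hxy, h y]
  · intro b hb n f hf hf0
    obtain ⟨m, s, hs, hfs⟩ := exists_homogeneous_apply_ne_zero
      (f := f.1) fun h => hf0 (Subtype.ext h)
    have h1 := hb _ _ (hf m s hs) hfs
    have hm : 0 ≤ m := by
      by_contra hm
      rw [hN m hm, AddSubgroup.mem_bot] at hs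
      exact hfs (hs ▸ map_zero _)
    have h2 : 0 ≤ ∑ i, m i := Finset.sum_nonneg fun i _ => hm i
    simp only [Pi.add_apply, Finset.sum_add_distrib] at h1
    linarith

/-- A common weight bound on all terms is kept because modules with such a bound are torsion; it
makes the higher local cohomology of a bounded module computable. -/
theorem exists_injRes (hN : ∀ n : Fin r → ℤ, ¬ 0 ≤ n → 𝒜 n = ⊥)
    (hk : ∀ c : k, algebraMap k S c ∈ 𝒜 0) (N : GrMod 𝒜) :
    ∃ R : InjRes N, ∀ b, N.WeightLE b → ∀ p, (R.I p).WeightLE b := by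
  choose E ι hE hι hb using exists_injective_embedding (k := k) hN hk
  -- `C (p + 1)` is the cokernel of `C p → E (C p)`.
  let C : ℕ → GrMod 𝒜 := fun p => Nat.rec N
    (fun _ X => GrMod.quot (LinearMap.range (ι X).1) (isGrSub_range (ι X))) p
  let π (p : ℕ) : Hom (E (C p)) (C (p + 1)) := quotπ _ (isGrSub_range (ι (C p)))
  have hπ : ∀ p, Function.Surjective (π p).1 := fun p =>
    quotπ_surjective _ (isGrSub_range (ι (C p)))
  let δ (p : ℕ) : Hom (E (C p)) (E (C (p + 1))) := (ι (C (p + 1))).comp (π p)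
  have hδ (p : ℕ) (x : (E (C p)).carrier) : (δ p).1 x = 0 ↔ ∃ y, (ι (C p)).1 y = x :=
    (map_eq_zero_iff (ι (C (p + 1))).1 (hι _)).trans
      (quotπ_eq_zero_iff _ (isGrSub_range (ι (C p))) x)
  refine ⟨⟨fun p => E (C p), fun p => hE _, (ι N).1, fun p => (δ p).1, (ι N).2,
    fun p => (δ p).2, hι N, fun x => hδ 0 x, fun p x => ?_⟩, fun b hNb p => hb _ _ ?_⟩
  · rw [hδ (p + 1) x]
    constructor
    · rintro ⟨y, rfl⟩
      obtain ⟨z, rfl⟩ := hπ p y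
      exact ⟨z, rfl⟩
    · rintro ⟨z, rfl⟩
      exact ⟨(π p).1 z, rfl⟩
  · induction p with
    | zero => exact hNb
    | succ p ih => exact (hb _ _ ih).quot _ _

end Coinduced

end GrMod

/-! ### Comparison of injective resolutions and functoriality of local cohomology. -/

namespace GrMod

variable {r : ℕ} {S : Type u} [CommRing S] {𝒜 : (Fin r → ℤ) → AddSubgroup S}

section Lifting

/-- Only exactness of the source and injectivity of the target enter, so the lemma serves both for
comparing resolutions and for the twisting maps of the horseshoe. The condition propagated at each
stage is that `dY ∘ f` vanishes on the kernel of `dX`. -/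
theorem exists_lift (X Y : ℕ → GrMod 𝒜) (dX : ∀ p, Hom (X p) (X (p + 1)))
    (dY : ∀ p, Hom (Y p) (Y (p + 1))) (hX : ∀ p, Function.Exact (dX p).1 (dX (p + 1)).1)
    (hY : ∀ p x, (dY (p + 1)).1 ((dY p).1 x) = 0) (hI : ∀ p, (Y (p + 1)).IsInjective)
    (f₀ : Hom (X 0) (Y 0)) (h₀ : ∀ x, (dX 0).1 x = 0 → (dY 0).1 (f₀.1 x) = 0) :
    ∃ f : ∀ p, Hom (X p) (Y p), f 0 = f₀ ∧
      ∀ p x, (f (p + 1)).1 ((dX p).1 x) = (dY p).1 ((f p).1 x) := by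
  have step : ∀ (p : ℕ) (f : {f : Hom (X p) (Y p) // ∀ x, (dX p).1 x = 0 →
      (dY p).1 (f.1 x) = 0}), ∃ g : {g : Hom (X (p + 1)) (Y (p + 1)) // ∀ x,
      (dX (p + 1)).1 x = 0 → (dY (p + 1)).1 (g.1 x) = 0},
      ∀ x, g.1.1 ((dX p).1 x) = (dY p).1 (f.1.1 x) := by
    intro p f
    obtain ⟨g, hg⟩ := (hI p).exists_extension (dX p) ((dY p).comp f.1) f.2
    refine ⟨⟨g, fun x hx => ?_⟩, hg⟩
    obtain ⟨y, rfl⟩ := (hX p x).1 hx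
    rw [hg, Hom.comp_apply, hY]
  choose next hnext using step
  let F : ∀ p, {f : Hom (X p) (Y p) // ∀ x, (dX p).1 x = 0 → (dY p).1 (f.1 x) = 0} :=
    fun p => Nat.rec ⟨f₀, h₀⟩ (fun p f => next p f) p
  exact ⟨fun p => (F p).1, rfl, fun p x => hnext p (F p) x⟩

end Lifting

theorem Hom.map_gammaTorsion {M N : GrMod 𝒜} (f : Hom M N) (I : Ideal S) {x : M.carrier}
    (hx : x ∈ gammaTorsion I M.carrier) : f.1 x ∈ gammaTorsion I N.carrier := by
  obtain ⟨t, ht⟩ := hx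
  exact ⟨t, fun a ha => by rw [← map_smul, ht a ha, map_zero]⟩

namespace InjRes

variable {M N P : GrMod 𝒜}

/-- The augmentation as a morphism. -/
def εh (R : InjRes M) : Hom M (R.I 0) := ⟨R.ε, R.ε_hom⟩

/-- The differential as a morphism. -/
def δh (R : InjRes M) (p : ℕ) : Hom (R.I p) (R.I (p + 1)) := ⟨R.δ p, R.δ_hom p⟩

theorem δ_ε (R : InjRes M) (x : M.carrier) : R.δ 0 (R.ε x) = 0 :=
  (R.exact_zero _).2 ⟨x, rfl⟩

theorem δ_δ (R : InjRes M) (p : ℕ) (x : (R.I p).carrier) : R.δ (p + 1) (R.δ p x) = 0 :=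
  (R.exact_succ p _).2 ⟨x, rfl⟩

section Classes

variable (R : InjRes M) {i : ℕ} {n : Fin r → ℤ}

theorem mem_coboundaries_zero {x : (R.I 0).carrier} : x ∈ R.coboundaries 0 n ↔ x = 0 := Iff.rfl

theorem mem_coboundaries_succ {x : (R.I (i + 1)).carrier} :
    x ∈ R.coboundaries (i + 1) n ↔ ∃ y ∈ R.cochains i n, R.δ i y = x := Iff.rfl

theorem map_mem_cochains {R' : InjRes N} {i' : ℕ} (g : Hom (R.I i) (R'.I i'))
    {x : (R.I i).carrier} (hx : x ∈ R.cochains i n) : g.1 x ∈ R'.cochains i' n :=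
  ⟨g.mem hx.1, g.map_gammaTorsion _ hx.2⟩

/-- The cohomology class of a cocycle. -/
def cls (x : (R.I i).carrier) (hx : x ∈ R.cocycles i n) : R.cohomology i n :=
  QuotientAddGroup.mk (⟨x, hx⟩ : R.cocycles i n)

theorem cls_surjective (c : R.cohomology i n) : ∃ x hx, R.cls x hx = c := by
  obtain ⟨⟨x, hx⟩, rfl⟩ := QuotientAddGroup.mk_surjective c
  exact ⟨x, hx, rfl⟩

theorem cls_eq_zero_iff {x : (R.I i).carrier} (hx : x ∈ R.cocycles i n) :
    R.cls x hx = 0 ↔ x ∈ R.coboundaries i n := by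
  rw [cls, QuotientAddGroup.eq_zero_iff, AddSubgroup.mem_addSubgroupOf]

theorem cls_eq_iff {x y : (R.I i).carrier} (hx : x ∈ R.cocycles i n) (hy : y ∈ R.cocycles i n) :
    R.cls x hx = R.cls y hy ↔ x - y ∈ R.coboundaries i n := by
  rw [← R.cls_eq_zero_iff (sub_mem hx hy), ← sub_eq_zero]
  rfl

theorem nontrivial_iff_exists :
    Nontrivial (R.cohomology i n) ↔ ∃ x ∈ R.cocycles i n, x ∉ R.coboundaries i n := by
  constructor
  · intro h
    obtain ⟨c, hc⟩ := exists_ne (0 : R.cohomology i n)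
    obtain ⟨x, hx, rfl⟩ := R.cls_surjective c
    exact ⟨x, hx, fun h => hc ((R.cls_eq_zero_iff hx).2 h)⟩
  · rintro ⟨x, hx, hx'⟩
    exact ⟨R.cls x hx, 0, fun h => hx' ((R.cls_eq_zero_iff hx).1 h)⟩

/-- The map on cohomology induced by a morphism that respects cocycles and coboundaries. -/
def cohInd {R' : InjRes N} {i' : ℕ} (g : Hom (R.I i) (R'.I i'))
    (hz : ∀ x ∈ R.cocycles i n, g.1 x ∈ R'.cocycles i' n)
    (hb : ∀ x ∈ R.coboundaries i n, g.1 x ∈ R'.coboundaries i' n) :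
    R.cohomology i n →+ R'.cohomology i' n :=
  QuotientAddGroup.map _ _
    ((g.1.toAddMonoidHom.comp (R.cocycles i n).subtype).codRestrict (R'.cocycles i' n)
      fun x => hz x.1 x.2)
    fun x hx => hb x.1 hx

theorem cohInd_cls {R' : InjRes N} {i' : ℕ} (g : Hom (R.I i) (R'.I i'))
    (hz : ∀ x ∈ R.cocycles i n, g.1 x ∈ R'.cocycles i' n)
    (hb : ∀ x ∈ R.coboundaries i n, g.1 x ∈ R'.coboundaries i' n)
    (x : (R.I i).carrier) (hx : x ∈ R.cocycles i n) :
    R.cohInd g hz hb (R.cls x hx) = R'.cls (g.1 x) (hz x hx) := rfl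

end Classes

/-- A morphism of injective resolutions that covers a morphism of modules. -/
structure ResMap (R : InjRes M) (R' : InjRes N) (f : Hom M N) where
  φ : ∀ p, Hom (R.I p) (R'.I p)
  ε_comm : ∀ x, (φ 0).1 (R.ε x) = R'.ε (f.1 x)
  δ_comm : ∀ p x, (φ (p + 1)).1 (R.δ p x) = R'.δ p ((φ p).1 x)

theorem exists_resMap (R : InjRes M) (R' : InjRes N) (f : Hom M N) :
    Nonempty (ResMap R R' f) := by
  obtain ⟨φ₀, h₀⟩ := (R'.inj 0).exists_extension R.εh (R'.εh.comp f) fun x hx => by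
    rw [R.ε_injective (a₁ := x) (a₂ := 0) (hx.trans (map_zero _).symm), map_zero]
  obtain ⟨φ, rfl, hφ⟩ := exists_lift R.I R'.I R.δh R'.δh R.exact_succ R'.δ_δ
    (fun p => R'.inj (p + 1)) φ₀ fun x hx => by
      obtain ⟨y, rfl⟩ := (R.exact_zero x).1 hx
      exact (congrArg (R'.δ 0) (h₀ y)).trans (R'.δ_ε _)
  exact ⟨⟨φ, h₀, hφ⟩⟩

namespace ResMap

variable {R : InjRes M} {R' : InjRes N} {R'' : InjRes P} {f : Hom M N} {g : Hom N P}

/-- At each stage `F.φ` minus the part already accounted for vanishes on the kernel of the next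
differential, so it extends over that differential. -/
theorem exists_homotopy (F : ResMap R R' 0) :
    ∃ h : ∀ p, Hom (R.I (p + 1)) (R'.I p), (∀ x, (F.φ 0).1 x = (h 0).1 (R.δ 0 x)) ∧
      ∀ p x, (F.φ (p + 1)).1 x = R'.δ p ((h p).1 x) + (h (p + 1)).1 (R.δ (p + 1) x) := by
  obtain ⟨h₀, hh₀⟩ := (R'.inj 0).exists_extension (R.δh 0) (F.φ 0) fun x hx => by
    obtain ⟨y, rfl⟩ := (R.exact_zero x).1 hx
    rw [F.ε_comm, Hom.zero_apply, map_zero]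
  have step : ∀ (p : ℕ) (h : {h : Hom (R.I (p + 1)) (R'.I p) // ∀ x,
      (F.φ (p + 1)).1 (R.δ p x) = R'.δ p (h.1 (R.δ p x))}),
      ∃ h' : {h' : Hom (R.I (p + 1 + 1)) (R'.I (p + 1)) // ∀ x,
        (F.φ (p + 1 + 1)).1 (R.δ (p + 1) x) = R'.δ (p + 1) (h'.1 (R.δ (p + 1) x))},
        ∀ x, (F.φ (p + 1)).1 x = R'.δ p (h.1.1 x) + h'.1.1 (R.δ (p + 1) x) := by
    intro p h
    obtain ⟨h', hh'⟩ := (R'.inj (p + 1)).exists_extension (R.δh (p + 1))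
      (F.φ (p + 1) - (R'.δh p).comp h.1) fun x hx => by
        obtain ⟨y, rfl⟩ := (R.exact_succ p x).1 hx
        rw [Hom.sub_apply, Hom.comp_apply, h.2]
        exact sub_self _
    have key : ∀ x, (F.φ (p + 1)).1 x = R'.δ p (h.1.1 x) + h'.1 (R.δ (p + 1) x) := fun x => by
      rw [show h'.1 (R.δ (p + 1) x) = (F.φ (p + 1)).1 x - R'.δ p (h.1.1 x) from hh' x]
      abel
    refine ⟨⟨h', fun x => ?_⟩, key⟩
    rw [F.δ_comm, key, map_add, R'.δ_δ, zero_add]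
  choose next hnext using step
  let H : ∀ p, {h : Hom (R.I (p + 1)) (R'.I p) // ∀ x,
      (F.φ (p + 1)).1 (R.δ p x) = R'.δ p (h.1 (R.δ p x))} :=
    fun p => Nat.rec ⟨h₀, fun x => by
      rw [show h₀.1 (R.δ 0 x) = (F.φ 0).1 x from hh₀ x]; exact F.δ_comm 0 x⟩
      (fun p h => next p h) p
  exact ⟨fun p => (H p).1, fun x => (hh₀ x).symm, fun p x => hnext p (H p) x⟩

theorem map_cocycles (F : ResMap R R' f) (i : ℕ) (n : Fin r → ℤ) :
    ∀ x ∈ R.cocycles i n, (F.φ i).1 x ∈ R'.cocycles i n := fun x hx =>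
  ⟨R.map_mem_cochains _ hx.1, by
    change R'.δ i ((F.φ i).1 x) = 0
    rw [← F.δ_comm, show R.δ i x = 0 from hx.2, map_zero]⟩

theorem map_coboundaries (F : ResMap R R' f) (i : ℕ) (n : Fin r → ℤ) :
    ∀ x ∈ R.coboundaries i n, (F.φ i).1 x ∈ R'.coboundaries i n := fun x hx => by
  cases i with
  | zero => rw [R.mem_coboundaries_zero.1 hx, map_zero]; exact zero_mem _
  | succ i =>
    obtain ⟨y, hy, rfl⟩ := R.mem_coboundaries_succ.1 hx
    exact R'.mem_coboundaries_succ.2 ⟨_, R.map_mem_cochains _ hy, (F.δ_comm i y).symm⟩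

/-- The map on cohomology induced by a morphism of resolutions. -/
def coh (F : ResMap R R' f) (i : ℕ) (n : Fin r → ℤ) : R.cohomology i n →+ R'.cohomology i n :=
  R.cohInd (F.φ i) (F.map_cocycles i n) (F.map_coboundaries i n)

theorem coh_cls (F : ResMap R R' f) {i : ℕ} {n : Fin r → ℤ} (x : (R.I i).carrier)
    (hx : x ∈ R.cocycles i n) :
    F.coh i n (R.cls x hx) = R'.cls ((F.φ i).1 x) (F.map_cocycles i n x hx) := rfl

/-- The difference of two morphisms of resolutions that cover the same morphism. -/
def sub (F G : ResMap R R' f) : ResMap R R' 0 where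
  φ p := F.φ p - G.φ p
  ε_comm x := by simp [F.ε_comm, G.ε_comm]
  δ_comm p x := by simp [F.δ_comm, G.δ_comm]

/-- The difference of two lifts is null-homotopic, and linear homotopies preserve torsion, so the
homotopy stays inside `Γ_𝓜`. -/
theorem coh_unique (F G : ResMap R R' f) (i : ℕ) (n : Fin r → ℤ) : F.coh i n = G.coh i n := by
  obtain ⟨h, h0, h1⟩ := (F.sub G).exists_homotopy
  refine AddMonoidHom.ext fun c => ?_
  obtain ⟨x, hx, rfl⟩ := R.cls_surjective c
  rw [coh_cls, coh_cls, cls_eq_iff]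
  change ((F.sub G).φ i).1 x ∈ _
  cases i with
  | zero =>
    rw [h0, show R.δ 0 x = 0 from hx.2, map_zero]; exact zero_mem _
  | succ i =>
    rw [h1, show R.δ (i + 1) x = 0 from hx.2, map_zero, add_zero]
    exact ⟨_, R.map_mem_cochains _ hx.1, rfl⟩

/-- The composition of morphisms of resolutions. -/
def comp (G : ResMap R' R'' g) (F : ResMap R R' f) : ResMap R R'' (g.comp f) where
  φ p := (G.φ p).comp (F.φ p)
  ε_comm x := by simp [F.ε_comm, G.ε_comm]
  δ_comm p x := by simp [F.δ_comm, G.δ_comm]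

/-- The identity morphism of a resolution. -/
def id (R : InjRes M) : ResMap R R (Hom.id M) where
  φ _ := Hom.id _
  ε_comm _ := rfl
  δ_comm _ _ := rfl

/-- The sum of morphisms of resolutions. -/
def add {f' : Hom M N} (F : ResMap R R' f) (G : ResMap R R' f') : ResMap R R' (f + f') where
  φ p := F.φ p + G.φ p
  ε_comm x := by simp [F.ε_comm, G.ε_comm]
  δ_comm p x := by simp [F.δ_comm, G.δ_comm]

theorem coh_comp (G : ResMap R' R'' g) (F : ResMap R R' f) (i : ℕ) (n : Fin r → ℤ) :
    (G.comp F).coh i n = (G.coh i n).comp (F.coh i n) := by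
  refine AddMonoidHom.ext fun c => ?_
  obtain ⟨x, hx, rfl⟩ := R.cls_surjective c
  rfl

theorem coh_id (R : InjRes M) (i : ℕ) (n : Fin r → ℤ) :
    (ResMap.id R).coh i n = AddMonoidHom.id _ := by
  refine AddMonoidHom.ext fun c => ?_
  obtain ⟨x, hx, rfl⟩ := R.cls_surjective c
  rfl

theorem coh_add {f' : Hom M N} (F : ResMap R R' f) (G : ResMap R R' f') (i : ℕ)
    (n : Fin r → ℤ) : (F.add G).coh i n = F.coh i n + G.coh i n := by
  refine AddMonoidHom.ext fun c => ?_
  obtain ⟨x, hx, rfl⟩ := R.cls_surjective c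
  rfl

theorem coh_left_inverse (F : ResMap R R' f) (g : Hom N M) (G : ResMap R' R g)
    (h : g.comp f = Hom.id M) (i : ℕ) (n : Fin r → ℤ) (c : R.cohomology i n) :
    G.coh i n (F.coh i n c) = c := by
  have h1 : (G.comp F).coh i n = (ResMap.id R).coh i n := by
    -- The composite covers `g.comp f`, which is the identity only up to a proved equality; the
    -- covered map is generalized so that this equality can be substituted.
    have key : ∀ (e : Hom M M) (E : ResMap R R e), e = Hom.id M →
        E.coh i n = (ResMap.id R).coh i n := by
      rintro e E rfl
      exact coh_unique _ _ _ _
    exact key _ _ h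
  rw [coh_comp, coh_id] at h1
  exact DFunLike.congr_fun h1 c

end ResMap

end InjRes

open InjRes

section Functor

variable (ρ : ∀ N : GrMod 𝒜, InjRes N) {M N P : GrMod 𝒜}

/-- The degree `n` component of the `i`-th local cohomology module of `M`, computed by the
resolutions `ρ`. -/
abbrev H (M : GrMod 𝒜) (i : ℕ) (n : Fin r → ℤ) : Type u := (ρ M).cohomology i n

/-- The map on local cohomology induced by a morphism. -/
noncomputable def Hmap (f : Hom M N) (i : ℕ) (n : Fin r → ℤ) : H ρ M i n →+ H ρ N i n :=
  (exists_resMap (ρ M) (ρ N) f).some.coh i n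

theorem Hmap_eq {f : Hom M N} (F : ResMap (ρ M) (ρ N) f) (i : ℕ) (n : Fin r → ℤ) :
    Hmap ρ f i n = F.coh i n := ResMap.coh_unique _ _ _ _

theorem Hmap_id (i : ℕ) (n : Fin r → ℤ) : Hmap ρ (Hom.id M) i n = AddMonoidHom.id _ := by
  rw [Hmap_eq ρ (ResMap.id (ρ M)), ResMap.coh_id]

theorem Hmap_comp (g : Hom N P) (f : Hom M N) (i : ℕ) (n : Fin r → ℤ) :
    Hmap ρ (g.comp f) i n = (Hmap ρ g i n).comp (Hmap ρ f i n) := by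
  rw [Hmap_eq ρ ((exists_resMap (ρ N) (ρ P) g).some.comp (exists_resMap (ρ M) (ρ N) f).some),
    ResMap.coh_comp]
  rfl

theorem Hmap_add (f g : Hom M N) (i : ℕ) (n : Fin r → ℤ) :
    Hmap ρ (f + g) i n = Hmap ρ f i n + Hmap ρ g i n := by
  rw [Hmap_eq ρ ((exists_resMap (ρ M) (ρ N) f).some.add (exists_resMap (ρ M) (ρ N) g).some),
    ResMap.coh_add]
  rfl

/-- The map on local cohomology as a function of the morphism. -/
noncomputable def HmapHom (M N : GrMod 𝒜) (i : ℕ) (n : Fin r → ℤ) :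
    Hom M N →+ (H ρ M i n →+ H ρ N i n) :=
  AddMonoidHom.mk' (fun f => Hmap ρ f i n) fun f g => Hmap_add ρ f g i n

theorem Hmap_zero (i : ℕ) (n : Fin r → ℤ) : Hmap ρ (0 : Hom M N) i n = 0 :=
  map_zero (HmapHom ρ M N i n)

theorem Hmap_sum {ι : Type*} (s : Finset ι) (f : ι → Hom M N) (i : ℕ) (n : Fin r → ℤ) :
    Hmap ρ (∑ j ∈ s, f j) i n = ∑ j ∈ s, Hmap ρ (f j) i n :=
  map_sum (HmapHom ρ M N i n) f s

theorem nontrivial_cohomology_iff (R R' : InjRes M) (i : ℕ) (n : Fin r → ℤ) :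
    Nontrivial (R.cohomology i n) ↔ Nontrivial (R'.cohomology i n) := by
  suffices h : ∀ R R' : InjRes M, Nontrivial (R.cohomology i n) →
      Nontrivial (R'.cohomology i n) from ⟨h R R', h R' R⟩
  intro R R' h
  obtain ⟨F⟩ := exists_resMap R R' (Hom.id M)
  obtain ⟨G⟩ := exists_resMap R' R (Hom.id M)
  exact (Function.LeftInverse.injective (F.coh_left_inverse _ G rfl i n)).nontrivial

theorem mem_localCohomologySupport_iff {i : ℕ} {n : Fin r → ℤ} :
    n ∈ M.localCohomologySupport i ↔ Nontrivial (H ρ M i n) :=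
  ⟨fun ⟨R, hR⟩ => (nontrivial_cohomology_iff R (ρ M) i n).1 hR, fun h => ⟨ρ M, h⟩⟩

end Functor

theorem prod_isInjective {E E' : GrMod 𝒜} (hE : E.IsInjective) (hE' : E'.IsInjective) :
    (prod E E').IsInjective := by
  intro A B i f hi hi' hf
  obtain ⟨g, hg, hgi⟩ := hE A B i ((LinearMap.fst S E.carrier E'.carrier).comp f) hi hi'
    fun n x hx => (hf n x hx).1
  obtain ⟨g', hg', hgi'⟩ := hE' A B i ((LinearMap.snd S E.carrier E'.carrier).comp f) hi hi'
    fun n x hx => (hf n x hx).2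
  exact ⟨g.prod g', fun n x hx => ⟨hg n x hx, hg' n x hx⟩, LinearMap.ext fun x =>
    Prod.ext (LinearMap.congr_fun hgi x) (LinearMap.congr_fun hgi' x)⟩

theorem mem_gammaTorsion_prod {I : Ideal S} {X Y : Type u} [AddCommGroup X] [AddCommGroup Y]
    [Module S X] [Module S Y] {z : X × Y} :
    z ∈ gammaTorsion I (X × Y) ↔ z.1 ∈ gammaTorsion I X ∧ z.2 ∈ gammaTorsion I Y := by
  constructor
  · rintro ⟨t, ht⟩
    exact ⟨⟨t, fun a ha => congrArg Prod.fst (ht a ha)⟩,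
      ⟨t, fun a ha => congrArg Prod.snd (ht a ha)⟩⟩
  · rintro ⟨⟨s, hs⟩, ⟨t, ht⟩⟩
    refine ⟨s + t, fun a ha => Prod.ext ?_ ?_⟩
    · exact hs a (Ideal.pow_le_pow_right (Nat.le_add_right s t) ha)
    · exact ht a (Ideal.pow_le_pow_right (Nat.le_add_left t s) ha)

/-! ### The horseshoe construction and the long exact sequence. -/

section LongExact

variable {A B C : GrMod 𝒜}

/-- Short exact sequences of graded modules. -/
structure IsShortExact (f : Hom A B) (g : Hom B C) : Prop where
  injective : Function.Injective f.1
  surjective : Function.Surjective g.1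
  exact : Function.Exact f.1 g.1

/-- The middle resolution will be `R.I p ⊕ R'.I p` with differential `(a, c) ↦ (δ a + θ c, δ c)`.
The identities are those that make this a complex with augmentation `(α, ε ∘ g)`: `θ` starts from
`-δ ∘ α` and anticommutes with the differentials. -/
theorem IsShortExact.exists_twist {f : Hom A B} {g : Hom B C} (h : IsShortExact f g)
    (R : InjRes A) (R' : InjRes C) :
    ∃ (α : Hom B (R.I 0)) (θ : ∀ p, Hom (R'.I p) (R.I (p + 1))),
      (∀ x, α.1 (f.1 x) = R.ε x) ∧
      (∀ x, R.δ 0 (α.1 x) + (θ 0).1 (R'.ε (g.1 x)) = 0) ∧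
      ∀ p x, (θ (p + 1)).1 (R'.δ p x) = -R.δ (p + 1) ((θ p).1 x) := by
  obtain ⟨α, hα⟩ := (R.inj 0).exists_extension f R.εh fun x hx => by
    rw [h.injective (a₁ := x) (a₂ := 0) (hx.trans (map_zero _).symm), map_zero]
  obtain ⟨θ₀, hθ₀⟩ := (R.inj 1).exists_extension (R'.εh.comp g) (-((R.δh 0).comp α))
    fun x hx => by
      have hx' : g.1 x = 0 := R'.ε_injective (hx.trans (map_zero _).symm)
      obtain ⟨y, rfl⟩ := (h.exact x).1 hx'
      rw [Hom.neg_apply, Hom.comp_apply, hα, neg_eq_zero]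
      exact R.δ_ε y
  obtain ⟨θ, rfl, hθ⟩ := exists_lift R'.I (fun p => R.I (p + 1)) R'.δh
    (fun p => -R.δh (p + 1)) R'.exact_succ
    (fun p x => by
      rw [Hom.neg_apply, Hom.neg_apply, map_neg, neg_neg]; exact R.δ_δ _ x)
    (fun p => R.inj _) θ₀ fun x hx => by
      obtain ⟨y, rfl⟩ := (R'.exact_zero x).1 hx
      obtain ⟨z, rfl⟩ := h.surjective y
      rw [show θ₀.1 (R'.ε (g.1 z)) = _ from hθ₀ z]
      simp only [Hom.neg_apply, Hom.comp_apply, map_neg, neg_neg]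
      exact R.δ_δ 0 _
  refine ⟨α, θ, hα, fun x => ?_, hθ⟩
  rw [show (θ 0).1 (R'.ε (g.1 x)) = -(R.δ 0 (α.1 x)) from hθ₀ x, add_neg_cancel]

/-- The resolution of the middle term of a short exact sequence built from resolutions of the
outer terms. -/
def horseshoe {f : Hom A B} {g : Hom B C} (h : IsShortExact f g) (R : InjRes A) (R' : InjRes C)
    (α : Hom B (R.I 0)) (θ : ∀ p, Hom (R'.I p) (R.I (p + 1))) (hα : ∀ x, α.1 (f.1 x) = R.ε x)
    (hα' : ∀ x, R.δ 0 (α.1 x) + (θ 0).1 (R'.ε (g.1 x)) = 0)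
    (hθ : ∀ p x, (θ (p + 1)).1 (R'.δ p x) = -R.δ (p + 1) ((θ p).1 x)) : InjRes B where
  I p := prod (R.I p) (R'.I p)
  inj p := prod_isInjective (R.inj p) (R'.inj p)
  ε := α.1.prod (R'.ε ∘ₗ g.1)
  δ p := (R.δ p ∘ₗ LinearMap.fst S _ _ + (θ p).1 ∘ₗ LinearMap.snd S _ _).prod
    (R'.δ p ∘ₗ LinearMap.snd S _ _)
  ε_hom n x hx := ⟨α.mem hx, R'.ε_hom _ _ (g.mem hx)⟩
  δ_hom p n x hx := ⟨add_mem (R.δ_hom _ _ _ hx.1) ((θ p).mem hx.2), R'.δ_hom _ _ _ hx.2⟩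
  ε_injective := by
    refine (injective_iff_map_eq_zero _).2 fun x hx => ?_
    obtain ⟨h1, h2⟩ := Prod.ext_iff.1 hx
    have h3 : g.1 x = 0 := R'.ε_injective (h2.trans (map_zero _).symm)
    obtain ⟨y, rfl⟩ := (h.exact x).1 h3
    rw [R.ε_injective (((hα y).symm.trans h1).trans (map_zero _).symm), map_zero]
  exact_zero := by
    rintro ⟨a, c⟩
    constructor
    · intro hx
      obtain ⟨h1, h2⟩ := Prod.ext_iff.1 hx
      change R.δ 0 a + (θ 0).1 c = 0 at h1
      change R'.δ 0 c = 0 at h2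
      obtain ⟨y, rfl⟩ := (R'.exact_zero c).1 h2
      obtain ⟨z, rfl⟩ := h.surjective y
      have h4 : R.δ 0 (a - α.1 z) = 0 := by
        rw [map_sub, eq_neg_of_add_eq_zero_left h1, eq_neg_of_add_eq_zero_left (hα' z), sub_self]
      obtain ⟨w, hw⟩ := (R.exact_zero _).1 h4
      refine ⟨f.1 w + z, Prod.ext ?_ ?_⟩
      · change α.1 (f.1 w + z) = a
        rw [map_add, hα, hw, sub_add_cancel]
      · change R'.ε (g.1 (f.1 w + z)) = R'.ε (g.1 z)
        rw [map_add, (h.exact _).2 ⟨w, rfl⟩, zero_add]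
    · rintro ⟨y, hy⟩
      obtain ⟨h1, h2⟩ := Prod.ext_iff.1 hy
      change α.1 y = a at h1
      change R'.ε (g.1 y) = c at h2
      subst h1 h2
      exact Prod.ext (hα' y) (R'.δ_ε _)
  exact_succ p := by
    rintro ⟨a, c⟩
    constructor
    · intro hx
      obtain ⟨h1, h2⟩ := Prod.ext_iff.1 hx
      change R.δ (p + 1) a + (θ (p + 1)).1 c = 0 at h1
      change R'.δ (p + 1) c = 0 at h2
      obtain ⟨y, rfl⟩ := (R'.exact_succ p c).1 h2
      rw [hθ, ← sub_eq_add_neg, ← map_sub] at h1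
      obtain ⟨w, hw⟩ := (R.exact_succ p _).1 h1
      refine ⟨(w, y), Prod.ext ?_ rfl⟩
      change R.δ p w + (θ p).1 y = a
      rw [hw, sub_add_cancel]
    · rintro ⟨⟨y, z⟩, hy⟩
      obtain ⟨h1, h2⟩ := Prod.ext_iff.1 hy
      change R.δ p y + (θ p).1 z = a at h1
      change R'.δ p z = c at h2
      subst h1 h2
      refine Prod.ext ?_ (R'.δ_δ p z)
      change R.δ (p + 1) (R.δ p y + (θ p).1 z) + (θ (p + 1)).1 (R'.δ p z) = 0
      rw [map_add, R.δ_δ, zero_add, hθ, add_neg_cancel]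

/-- The horseshoe splits in every cohomological degree, so `Γ_𝓜` keeps the sequences of cochains
exact, and the connecting map is simply the one induced by `θ`. -/
theorem IsShortExact.exists_resolution {f : Hom A B} {g : Hom B C} (h : IsShortExact f g)
    (R : InjRes A) (R' : InjRes C) :
    ∃ (Q : InjRes B) (F : ResMap R Q f) (G : ResMap Q R' g), ∀ (i : ℕ) (n : Fin r → ℤ),
      Function.Exact (F.coh i n) (G.coh i n) ∧
      (∃ d : R'.cohomology i n →+ R.cohomology (i + 1) n,
        Function.Exact (G.coh i n) d ∧ Function.Exact d (F.coh (i + 1) n)) ∧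
      Function.Injective (F.coh 0 n) := by
  obtain ⟨α, θ, hα, hα', hθ⟩ := h.exists_twist R R'
  let Q := horseshoe h R R' α θ hα hα' hθ
  let F : ResMap R Q f :=
    { φ := fun p => ⟨LinearMap.inl S _ _, fun n x hx => ⟨hx, zero_mem _⟩⟩
      ε_comm := fun x => Prod.ext (hα x).symm (by
        change 0 = R'.ε (g.1 (f.1 x))
        rw [(h.exact _).2 ⟨x, rfl⟩, map_zero])
      δ_comm := fun p x => Prod.ext (by
          change R.δ p x = R.δ p x + (θ p).1 0
          rw [map_zero, add_zero]) (by
          change 0 = R'.δ p 0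
          rw [map_zero]) }
  let G : ResMap Q R' g :=
    { φ := fun p => ⟨LinearMap.snd S _ _, fun n x hx => hx.2⟩
      ε_comm := fun x => rfl
      δ_comm := fun p x => rfl }
  have hQ {i : ℕ} {n : Fin r → ℤ} {a : (R.I i).carrier} {c : (R'.I i).carrier} :
      ((a, c) : (Q.I i).carrier) ∈ Q.cochains i n ↔
        a ∈ R.cochains i n ∧ c ∈ R'.cochains i n := by
    constructor
    · rintro ⟨⟨h1, h2⟩, h3⟩
      obtain ⟨h4, h5⟩ := mem_gammaTorsion_prod.1 h3
      exact ⟨⟨h1, h4⟩, ⟨h2, h5⟩⟩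
    · rintro ⟨⟨h1, h4⟩, ⟨h2, h5⟩⟩
      exact ⟨⟨h1, h2⟩, mem_gammaTorsion_prod.2 ⟨h4, h5⟩⟩
  have hd {i : ℕ} {a : (R.I i).carrier} {c : (R'.I i).carrier} :
      Q.δ i ((a, c) : (Q.I i).carrier) =
        ((R.δ i a + (θ i).1 c, R'.δ i c) : (Q.I (i + 1)).carrier) := rfl
  have hθz : ∀ i n, ∀ x ∈ R'.cocycles i n, (θ i).1 x ∈ R.cocycles (i + 1) n := fun i n x hx =>
    ⟨R'.map_mem_cochains _ hx.1, by
      change R.δ (i + 1) ((θ i).1 x) = 0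
      rw [← neg_eq_zero, ← hθ, show R'.δ i x = 0 from hx.2, map_zero]⟩
  have hθb : ∀ i n, ∀ x ∈ R'.coboundaries i n, (θ i).1 x ∈ R.coboundaries (i + 1) n := by
    intro i n x hx
    cases i with
    | zero => rw [R'.mem_coboundaries_zero.1 hx, map_zero]; exact zero_mem _
    | succ i =>
      obtain ⟨y, hy, rfl⟩ := R'.mem_coboundaries_succ.1 hx
      rw [hθ]
      exact neg_mem ⟨_, R'.map_mem_cochains (θ i) hy, rfl⟩
  refine ⟨Q, F, G, fun i n => ⟨fun c => ⟨fun hc => ?_, ?_⟩, ⟨R'.cohInd (θ i) (hθz i n) (hθb i n),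
    fun c => ⟨fun hc => ?_, ?_⟩, fun c => ⟨fun hc => ?_, ?_⟩⟩, ?_⟩⟩
  · obtain ⟨⟨a, c⟩, hx, rfl⟩ := Q.cls_surjective c
    replace hc : c ∈ R'.coboundaries i n :=
      (R'.cls_eq_zero_iff (G.map_cocycles i n _ hx)).1 hc
    obtain ⟨hxc, hxd⟩ := hx
    have hxa := (hQ.1 hxc).1
    obtain ⟨h1, -⟩ := Prod.ext_iff.1 (show Q.δ i ((a, c) : (Q.I i).carrier) = 0 from hxd)
    change R.δ i a + (θ i).1 c = 0 at h1
    cases i with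
    | zero =>
      obtain rfl : c = 0 := hc
      rw [map_zero, add_zero] at h1
      exact ⟨R.cls a ⟨hxa, h1⟩, rfl⟩
    | succ i =>
      obtain ⟨y, hy, rfl⟩ := R'.mem_coboundaries_succ.1 hc
      rw [hθ, ← sub_eq_add_neg, ← map_sub] at h1
      have hz : a - (θ i).1 y ∈ R.cocycles (i + 1) n :=
        ⟨(R.cochains (i + 1) n).sub_mem hxa (R'.map_mem_cochains _ hy), h1⟩
      refine ⟨R.cls _ hz, (Q.cls_eq_iff (F.map_cocycles _ _ _ hz) ⟨hxc, hxd⟩).2 ?_⟩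
      refine ⟨((0, -y) : (Q.I i).carrier), hQ.2 ⟨zero_mem _, neg_mem hy⟩, ?_⟩
      change Q.δ i _ = _
      rw [hd]
      refine Prod.ext ?_ ?_
      · change R.δ i 0 + (θ i).1 (-y) = a - (θ i).1 y - a
        rw [map_zero, map_neg]; abel
      · change R'.δ i (-y) = 0 - R'.δ i y
        rw [map_neg, zero_sub]
  · rintro ⟨c, rfl⟩
    obtain ⟨a, ha, rfl⟩ := R.cls_surjective c
    rw [ResMap.coh_cls, ResMap.coh_cls, cls_eq_zero_iff]
    exact zero_mem _
  · obtain ⟨c, hx, rfl⟩ := R'.cls_surjective c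
    rw [cohInd_cls, cls_eq_zero_iff] at hc
    obtain ⟨a, ha, hac⟩ := R.mem_coboundaries_succ.1 hc
    refine ⟨Q.cls ((-a, c) : (Q.I i).carrier) ⟨hQ.2 ⟨neg_mem ha, hx.1⟩, ?_⟩, rfl⟩
    change Q.δ i _ = 0
    rw [hd]
    refine Prod.ext ?_ hx.2
    change R.δ i (-a) + (θ i).1 c = 0
    rw [map_neg, hac, neg_add_cancel]
  · rintro ⟨c, rfl⟩
    obtain ⟨⟨a, c⟩, hx, rfl⟩ := Q.cls_surjective c
    refine (R.cls_eq_zero_iff (hθz i n _ (G.map_cocycles i n _ hx))).2 ?_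
    obtain ⟨h1, -⟩ := Prod.ext_iff.1 (show Q.δ i ((a, c) : (Q.I i).carrier) = 0 from hx.2)
    change R.δ i a + (θ i).1 c = 0 at h1
    refine ⟨-a, neg_mem (hQ.1 hx.1).1, ?_⟩
    change R.δ i (-a) = (θ i).1 c
    rw [map_neg, neg_eq_of_add_eq_zero_right h1]
  · obtain ⟨a, hx, rfl⟩ := R.cls_surjective c
    rw [ResMap.coh_cls, cls_eq_zero_iff] at hc
    obtain ⟨⟨a', c'⟩, hy, hyd⟩ := Q.mem_coboundaries_succ.1 hc
    rw [hd] at hyd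
    obtain ⟨h1, h2⟩ := Prod.ext_iff.1 hyd
    change R.δ i a' + (θ i).1 c' = a at h1
    change R'.δ i c' = 0 at h2
    refine ⟨R'.cls c' ⟨(hQ.1 hy).2, h2⟩, ?_⟩
    refine (R.cls_eq_iff (hθz _ _ _ ⟨(hQ.1 hy).2, h2⟩) hx).2 ?_
    rw [← h1]
    refine ⟨-a', neg_mem (hQ.1 hy).1, ?_⟩
    change R.δ i (-a') = _
    rw [map_neg]; abel
  · rintro ⟨c, rfl⟩
    obtain ⟨c, hx, rfl⟩ := R'.cls_surjective c
    rw [cohInd_cls, ResMap.coh_cls, cls_eq_zero_iff]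
    refine ⟨((0, c) : (Q.I i).carrier), hQ.2 ⟨zero_mem _, hx.1⟩, ?_⟩
    change Q.δ i _ = _
    rw [hd]
    refine Prod.ext ?_ hx.2
    change R.δ i 0 + (θ i).1 c = (θ i).1 c
    rw [map_zero, zero_add]
  · refine (injective_iff_map_eq_zero _).2 fun c hc => ?_
    obtain ⟨a, hx, rfl⟩ := R.cls_surjective c
    rw [ResMap.coh_cls, cls_eq_zero_iff] at hc
    rw [cls_eq_zero_iff]
    exact (Prod.ext_iff.1 (Q.mem_coboundaries_zero.1 hc)).1

variable (ρ : ∀ N : GrMod 𝒜, InjRes N) {f : Hom A B} {g : Hom B C}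

/-- The sequence is known for the horseshoe resolution of the middle term; comparison maps, mutually
inverse on cohomology, carry it to the chosen resolution `ρ B`. -/
theorem IsShortExact.long_exact (h : IsShortExact f g) (i : ℕ) (n : Fin r → ℤ) :
    Function.Exact (Hmap ρ f i n) (Hmap ρ g i n) ∧
      (∃ d : H ρ C i n →+ H ρ A (i + 1) n,
        Function.Exact (Hmap ρ g i n) d ∧ Function.Exact d (Hmap ρ f (i + 1) n)) ∧
      Function.Injective (Hmap ρ f 0 n) := by
  obtain ⟨Q, F, G, hFG⟩ := h.exists_resolution (ρ A) (ρ C)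
  obtain ⟨U⟩ := exists_resMap Q (ρ B) (Hom.id B)
  obtain ⟨V⟩ := exists_resMap (ρ B) Q (Hom.id B)
  have hUV : ∀ i, Function.LeftInverse (U.coh i n) (V.coh i n) := fun i =>
    V.coh_left_inverse _ U rfl i n
  have hVU : ∀ i, Function.LeftInverse (V.coh i n) (U.coh i n) := fun i =>
    U.coh_left_inverse _ V rfl i n
  have hf : ∀ i c, Hmap ρ f i n c = U.coh i n (F.coh i n c) := fun i c => by
    have : Hmap ρ f i n = (U.comp F).coh i n := Hmap_eq ρ (f := f) (U.comp F) i n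
    rw [this, ResMap.coh_comp]; rfl
  have hg : ∀ i c, Hmap ρ g i n c = G.coh i n (V.coh i n c) := fun i c => by
    have : Hmap ρ g i n = (G.comp V).coh i n := Hmap_eq ρ (f := g) (G.comp V) i n
    rw [this, ResMap.coh_comp]; rfl
  obtain ⟨h1, ⟨d, h2, h3⟩, h4⟩ := hFG i n
  refine ⟨fun c => ?_, ⟨d, fun c => ?_, fun c => ?_⟩, fun x y hxy => ?_⟩
  · rw [hg, h1]
    constructor
    · rintro ⟨a, ha⟩
      exact ⟨a, by rw [hf, ha, hUV]⟩
    · rintro ⟨a, rfl⟩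
      exact ⟨a, by rw [hf, hVU]⟩
  · rw [h2]
    constructor
    · rintro ⟨a, rfl⟩
      exact ⟨U.coh i n a, by rw [hg, hVU]⟩
    · rintro ⟨a, rfl⟩
      exact ⟨V.coh i n a, by rw [hg]⟩
  · rw [hf, ← h3]
    exact map_eq_zero_iff _ (hVU (i + 1)).injective
  · rw [hf, hf] at hxy
    exact h4 ((hVU 0).injective hxy)

end LongExact

end GrMod

namespace GrMod

open InjRes

variable {r : ℕ} {S : Type u} [CommRing S] {𝒜 : (Fin r → ℤ) → AddSubgroup S}

theorem Hom.sum_apply {M N : GrMod 𝒜} {ι : Type*} (s : Finset ι) (f : ι → Hom M N)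
    (x : M.carrier) : (∑ j ∈ s, f j).1 x = ∑ j ∈ s, (f j).1 x := by
  have : (∑ j ∈ s, f j).1 = ∑ j ∈ s, (f j).1 := map_sum (homs M N).subtype f s
  rw [this, LinearMap.sum_apply]

/-! ### Vanishing criteria; shifts, multiplication maps, torsion modules, free modules. -/

section Vanishing

variable (ρ : ∀ N : GrMod 𝒜, InjRes N) {A B C : GrMod 𝒜} {f : Hom A B} {g : Hom B C}

variable {ρ}

theorem IsShortExact.subsingleton_middle (h : IsShortExact f g) {i : ℕ} {n : Fin r → ℤ}
    (hA : Subsingleton (H ρ A i n)) (hC : Subsingleton (H ρ C i n)) :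
    Subsingleton (H ρ B i n) := by
  refine subsingleton_of_forall_eq 0 fun b => ?_
  obtain ⟨a, rfl⟩ := ((h.long_exact ρ i n).1 b).1 (Subsingleton.elim _ _)
  rw [Subsingleton.elim a 0, map_zero]

theorem IsShortExact.injective_succ (h : IsShortExact f g) {i : ℕ} {n : Fin r → ℤ}
    (hC : Subsingleton (H ρ C i n)) : Function.Injective (Hmap ρ f (i + 1) n) := by
  obtain ⟨-, ⟨d, -, h2⟩, -⟩ := h.long_exact ρ i n
  refine (injective_iff_map_eq_zero _).2 fun a ha => ?_
  obtain ⟨c, rfl⟩ := (h2 a).1 ha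
  rw [Subsingleton.elim c 0, map_zero]

theorem IsShortExact.subsingleton_left (h : IsShortExact f g) {i : ℕ} {n : Fin r → ℤ}
    (hC : Subsingleton (H ρ C i n)) (hB : Subsingleton (H ρ B (i + 1) n)) :
    Subsingleton (H ρ A (i + 1) n) :=
  (h.injective_succ hC).subsingleton

theorem IsShortExact.subsingleton_left_zero (h : IsShortExact f g) {n : Fin r → ℤ}
    (hB : Subsingleton (H ρ B 0 n)) : Subsingleton (H ρ A 0 n) :=
  (h.long_exact ρ 0 n).2.2.subsingleton

theorem IsShortExact.surjective_Hmap (h : IsShortExact f g) {i : ℕ} {n : Fin r → ℤ}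
    (hA : Subsingleton (H ρ A (i + 1) n)) : Function.Surjective (Hmap ρ g i n) := by
  obtain ⟨-, ⟨d, h1, -⟩, -⟩ := h.long_exact ρ i n
  exact fun c => (h1 c).1 (Subsingleton.elim _ _)

theorem IsShortExact.injective_Hmap (h : IsShortExact f g) {i : ℕ} {n : Fin r → ℤ}
    (hA : Subsingleton (H ρ A i n)) : Function.Injective (Hmap ρ g i n) := by
  refine (injective_iff_map_eq_zero _).2 fun b hb => ?_
  obtain ⟨a, rfl⟩ := ((h.long_exact ρ i n).1 b).1 hb
  rw [Subsingleton.elim a 0, map_zero]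

theorem IsShortExact.subsingleton_right (h : IsShortExact f g) {i : ℕ} {n : Fin r → ℤ}
    (hB : Subsingleton (H ρ B i n)) (hA : Subsingleton (H ρ A (i + 1) n)) :
    Subsingleton (H ρ C i n) :=
  (h.surjective_Hmap hA).subsingleton

theorem subsingleton_H_of_retract {M N : GrMod 𝒜} (i' : Hom M N) (p : Hom N M)
    (hp : p.comp i' = Hom.id M) {i : ℕ} {n : Fin r → ℤ} (hN : Subsingleton (H ρ N i n)) :
    Subsingleton (H ρ M i n) := by
  have h1 : (Hmap ρ p i n).comp (Hmap ρ i' i n) = AddMonoidHom.id _ := by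
    rw [← Hmap_comp, hp, Hmap_id]
  exact (show Function.LeftInverse (Hmap ρ p i n) (Hmap ρ i' i n) from
    fun c => DFunLike.congr_fun h1 c).injective.subsingleton

theorem subsingleton_H_of_subsingleton {M : GrMod 𝒜} (hM : Subsingleton M.carrier) (i : ℕ)
    (n : Fin r → ℤ) : Subsingleton (H ρ M i n) := by
  have h1 : AddMonoidHom.id (H ρ M i n) = 0 := by
    rw [← Hmap_id, ← Hmap_zero ρ (M := M) (N := M)]
    exact congrArg (fun f => Hmap ρ f i n) (Hom.ext fun x => Subsingleton.elim _ _)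
  exact subsingleton_of_forall_eq 0 fun c => DFunLike.congr_fun h1 c

theorem isShortExact_prod (A B : GrMod 𝒜) :
    IsShortExact (A := A) (B := prod A B) (C := B)
      ⟨LinearMap.inl S _ _, fun _ _ hx => ⟨hx, zero_mem _⟩⟩
      ⟨LinearMap.snd S _ _, fun _ _ hx => hx.2⟩ where
  injective := LinearMap.inl_injective
  surjective := LinearMap.snd_surjective
  exact := Function.Exact.inl_snd

theorem isShortExact_quot {M : GrMod 𝒜} (K : Submodule S M.carrier) (hK : M.IsGrSub K) :
    IsShortExact (subι K hK) (quotπ K hK) where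
  injective := subι_injective K hK
  surjective := quotπ_surjective K hK
  exact x := by
    rw [quotπ_eq_zero_iff]
    exact ⟨fun hx => ⟨⟨x, hx⟩, rfl⟩, by rintro ⟨y, rfl⟩; exact y.2⟩

end Vanishing

section Zero

theorem nontrivial_cohomology_zero_iff {M : GrMod 𝒜} (R : InjRes M) {n : Fin r → ℤ} :
    Nontrivial (R.cohomology 0 n) ↔
      ∃ x ∈ M.gr n, x ≠ 0 ∧ x ∈ gammaTorsion (maxIdeal 𝒜) M.carrier := by
  rw [nontrivial_iff_exists]
  constructor
  · rintro ⟨x, hx, hx0⟩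
    obtain ⟨y, rfl⟩ := (R.exact_zero x).1 hx.2
    have hx0 : R.ε y ≠ 0 := hx0
    refine ⟨y, ?_, fun h => hx0 (by rw [h, map_zero]), ?_⟩
    · have : M.proj n y = y := R.ε_injective <| by
        rw [IsHom.map_proj R.ε_hom]
        exact (R.I 0).proj_of_mem hx.1.1
      rw [← this]
      exact M.proj_mem n y
    · obtain ⟨t, ht⟩ := hx.1.2
      exact ⟨t, fun a ha => R.ε_injective (by rw [map_smul, ht a ha, map_zero])⟩
  · rintro ⟨x, hx, hx0, hxt⟩
    refine ⟨R.ε x, ⟨⟨R.ε_hom _ _ hx, R.εh.map_gammaTorsion _ hxt⟩, R.δ_ε x⟩, fun h => hx0 ?_⟩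
    exact R.ε_injective ((R.mem_coboundaries_zero.1 h).trans (map_zero _).symm)

end Zero

section Shift

theorem IsInjective.shift {E : GrMod 𝒜} (hE : E.IsInjective) (a : Fin r → ℤ) :
    (E.shift a).IsInjective := by
  intro A B i f hi hi' hf
  obtain ⟨g, hg, hgi⟩ := hE (A.shift (-a)) (B.shift (-a)) i f (fun n x hx => hi _ x hx) hi'
    fun n x hx => by
      have := hf _ x hx
      change f x ∈ E.gr (a + (-a + n)) at this
      rwa [add_neg_cancel_left] at this
  refine ⟨g, fun n x hx => hg (a + n) x ?_, hgi⟩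
  change x ∈ B.gr (-a + (a + n))
  rwa [neg_add_cancel_left]

/-- The shift of an injective resolution. -/
def InjRes.shift {M : GrMod 𝒜} (R : InjRes M) (a : Fin r → ℤ) : InjRes (M.shift a) where
  I p := (R.I p).shift a
  inj p := (R.inj p).shift a
  ε := R.ε
  δ := R.δ
  ε_hom _ _ hx := R.ε_hom _ _ hx
  δ_hom _ _ _ hx := R.δ_hom _ _ _ hx
  ε_injective := R.ε_injective
  exact_zero := R.exact_zero
  exact_succ := R.exact_succ

theorem InjRes.mem_coboundaries_shift {M : GrMod 𝒜} (R : InjRes M) (a : Fin r → ℤ) {i : ℕ}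
    {n : Fin r → ℤ} {x : (R.I i).carrier} :
    x ∈ (R.shift a).coboundaries i n ↔ x ∈ R.coboundaries i (a + n) := by
  cases i <;> exact Iff.rfl

theorem nontrivial_H_shift_iff (ρ : ∀ N : GrMod 𝒜, InjRes N) (M : GrMod 𝒜) (a : Fin r → ℤ)
    (i : ℕ) (n : Fin r → ℤ) :
    Nontrivial (H ρ (M.shift a) i n) ↔ Nontrivial (H ρ M i (a + n)) := by
  rw [nontrivial_cohomology_iff (ρ (M.shift a)) ((ρ M).shift a), nontrivial_iff_exists, nontrivial_iff_exists]
  constructor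
  · rintro ⟨x, hx, hx'⟩
    exact ⟨x, hx, fun h => hx' (((ρ M).mem_coboundaries_shift a).2 h)⟩
  · rintro ⟨x, hx, hx'⟩
    exact ⟨x, hx, fun h => hx' (((ρ M).mem_coboundaries_shift a).1 h)⟩

theorem subsingleton_H_shift_iff (ρ : ∀ N : GrMod 𝒜, InjRes N) (M : GrMod 𝒜) (a : Fin r → ℤ)
    (i : ℕ) (n : Fin r → ℤ) :
    Subsingleton (H ρ (M.shift a) i n) ↔ Subsingleton (H ρ M i (a + n)) := by
  rw [← not_nontrivial_iff_subsingleton, nontrivial_H_shift_iff, not_nontrivial_iff_subsingleton]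

end Shift

section Mul

variable {M : GrMod 𝒜} {m : Fin r → ℤ} {x : S}

/-- Multiplication by a homogeneous element. -/
def mulHom (M : GrMod 𝒜) (hx : x ∈ 𝒜 m) : Hom M (M.shift m) :=
  ⟨LinearMap.lsmul S M.carrier x, fun n y hy => M.smul_mem m n x y hx hy⟩

open Pointwise in
theorem isGrSub_smul_top (hx : x ∈ 𝒜 m) : M.IsGrSub (x • (⊤ : Submodule S M.carrier)) := by
  intro n y hy
  obtain ⟨z, -, rfl⟩ := (Submodule.mem_smul_pointwise_iff_exists _ _ _).1 hy
  refine (Submodule.mem_smul_pointwise_iff_exists _ _ _).2 ⟨M.proj (-m + n) z, trivial, ?_⟩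
  rw [← M.smul_proj hx, add_neg_cancel_left]

open Pointwise in
theorem isShortExact_mul (hx : x ∈ 𝒜 m) (hinj : ∀ y : M.carrier, x • y = 0 → y = 0) :
    IsShortExact (mulHom M hx) ((quotπ _ (isGrSub_smul_top (M := M) hx)).shift m) where
  injective := (injective_iff_map_eq_zero _).2 hinj
  surjective := quotπ_surjective _ (isGrSub_smul_top (M := M) hx)
  exact y := by
    refine (quotπ_eq_zero_iff _ (isGrSub_smul_top (M := M) hx) y).trans ?_
    refine (Submodule.mem_smul_pointwise_iff_exists _ _ _).trans ?_
    exact ⟨fun ⟨z, _, hz⟩ => ⟨z, hz⟩, fun ⟨z, hz⟩ => ⟨z, trivial, hz⟩⟩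

/-- Multiplication by a homogeneous element on an injective resolution. -/
def mulResMap (R : InjRes M) (hx : x ∈ 𝒜 m) : ResMap R (R.shift m) (mulHom M hx) where
  φ p := mulHom (R.I p) hx
  ε_comm y := (map_smul R.ε x y).symm
  δ_comm p y := (map_smul (R.δ p) x y).symm

theorem smul_mem_cocycles (R : InjRes M) (hx : x ∈ 𝒜 m) {i : ℕ} {n : Fin r → ℤ}
    {z : (R.I i).carrier} (hz : z ∈ R.cocycles i n) : x • z ∈ R.cocycles i (m + n) :=
  (mulResMap R hx).map_cocycles i n z hz

variable (ρ : ∀ N : GrMod 𝒜, InjRes N)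

open Pointwise in
-- In the long exact sequence of `0 → M → M(m) → (M/xM)(m) → 0` the kernel of multiplication by `x`
-- on `H^i(M)_n` comes from `H^{i-1}(M/xM)_{m+n}`. For `i = 0` left exactness suffices.
theorem mem_coboundaries_of_smul_mem (hx : x ∈ 𝒜 m)
    (hinj : ∀ y : M.carrier, x • y = 0 → y = 0) {i : ℕ} {n : Fin r → ℤ}
    (hQ : ∀ i', i = i' + 1 → Subsingleton
      (H ρ (quot _ (isGrSub_smul_top (M := M) hx)) i' (m + n)))
    {z : ((ρ M).I i).carrier} (hz : z ∈ (ρ M).cocycles i n)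
    (hxz : x • z ∈ (ρ M).coboundaries i (m + n)) : z ∈ (ρ M).coboundaries i n := by
  have h := isShortExact_mul (M := M) hx hinj
  have hi : Function.Injective (Hmap ρ (mulHom M hx) i n) := by
    cases i with
    | zero => exact (h.long_exact ρ 0 n).2.2
    | succ i => exact h.injective_succ ((subsingleton_H_shift_iff ρ _ m i n).2 (hQ i rfl))
  rw [← cls_eq_zero_iff _ hz]
  apply hi
  obtain ⟨U⟩ := exists_resMap ((ρ M).shift m) (ρ (M.shift m)) (Hom.id _)
  -- The induced map is computed by multiplying cochains by `x`.
  have h1 : Hmap ρ (mulHom M hx) i n = (U.comp (mulResMap (ρ M) hx)).coh i n :=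
    Hmap_eq ρ (f := mulHom M hx) (U.comp (mulResMap (ρ M) hx)) i n
  rw [h1, ResMap.coh_comp, map_zero]
  have h2 : (mulResMap (ρ M) hx).coh i n ((ρ M).cls z hz) = 0 :=
    (((ρ M).shift m).cls_eq_zero_iff (smul_mem_cocycles (ρ M) hx hz)).2 (((ρ M).mem_coboundaries_shift m).2 hxz)
  exact (congrArg (U.coh i n) h2).trans (map_zero _)

theorem mem_maxIdeal (hx : x ∈ 𝒜 m) (hm : m ≠ 0) : x ∈ maxIdeal 𝒜 :=
  Ideal.subset_span ⟨m, hm, hx⟩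

open Pointwise in
-- A cocycle is torsion, hence killed by a power of `x`. If `x` acts injectively on `H^i(M)` in the
-- degrees `n`, `m + n`, `2m + n`, …, no nonzero class can be killed in this way.
theorem subsingleton_H_of_mul (hx : x ∈ 𝒜 m) (hm : m ≠ 0)
    (hinj : ∀ y : M.carrier, x • y = 0 → y = 0) {i : ℕ} {n : Fin r → ℤ}
    (hQ : ∀ i', i = i' + 1 → ∀ t : ℕ, Subsingleton
      (H ρ (quot _ (isGrSub_smul_top (M := M) hx)) i' (m + (t • m + n)))) :
    Subsingleton (H ρ M i n) := by
  have key : ∀ (t : ℕ) (s : ℕ) (z : ((ρ M).I i).carrier),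
      z ∈ (ρ M).cocycles i (s • m + n) → x ^ t • z = 0 →
      z ∈ (ρ M).coboundaries i (s • m + n) := by
    intro t
    induction t with
    | zero =>
      intro s z _ h0
      rw [pow_zero, one_smul] at h0
      rw [h0]; exact zero_mem _
    | succ t ih =>
      intro s z hz h0
      refine mem_coboundaries_of_smul_mem ρ hx hinj (fun i' hi' => hQ i' hi' s) hz ?_
      have h1 := smul_mem_cocycles _ hx hz
      rw [← add_assoc, ← succ_nsmul'] at h1 ⊢
      exact ih (s + 1) _ h1 (by rw [smul_smul, ← pow_succ, h0])
  rw [← not_nontrivial_iff_subsingleton, nontrivial_iff_exists]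
  rintro ⟨z, hz, hz'⟩
  obtain ⟨t, ht⟩ := hz.1.2
  refine hz' ?_
  have := key t 0 z (by rwa [zero_smul, zero_add])
    (ht _ (Ideal.pow_mem_pow (mem_maxIdeal hx hm) t))
  rwa [zero_smul, zero_add] at this

end Mul

section Torsion

/-- The total degree. -/
def weight (n : Fin r → ℤ) : ℤ := ∑ i, n i

theorem weight_pos {n : Fin r → ℤ} (h : 0 ≤ n) (h0 : n ≠ 0) : 1 ≤ weight n := by
  have h1 : 0 ≤ weight n := Finset.sum_nonneg fun i _ => h i
  by_contra h2
  have h3 : weight n = 0 := by omega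
  exact h0 (funext fun i =>
    (Finset.sum_eq_zero_iff_of_nonneg fun i _ => h i).1 h3 i (Finset.mem_univ i))

theorem weight_add (m n : Fin r → ℤ) : weight (m + n) = weight m + weight n := by
  simp [weight, Finset.sum_add_distrib]

/-- An element of `𝓜^t` raises weights by at least `t`, which eventually exceeds the bound. -/
theorem mem_gammaTorsion_of_weightLE (hN : ∀ n : Fin r → ℤ, ¬ 0 ≤ n → 𝒜 n = ⊥) {M : GrMod 𝒜}
    {b : ℤ} (hM : M.WeightLE b) (y : M.carrier) : y ∈ gammaTorsion (maxIdeal 𝒜) M.carrier := by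
  have key : ∀ (t : ℕ), ∀ a ∈ maxIdeal 𝒜 ^ t, ∀ n, ∀ y ∈ M.gr n, b < t + weight n →
      a • y = 0 := by
    intro t
    induction t with
    | zero =>
      intro a _ n y hy hb
      have : y = 0 := by
        by_contra h0
        have := hM n y hy h0
        change weight n ≤ b at this
        push_cast at hb
        omega
      rw [this, smul_zero]
    | succ t ih =>
      intro a ha n y hy hb
      rw [pow_succ] at ha
      refine Submodule.mul_induction_on ha (fun c hc d hd => ?_) fun c d hc hd => ?_
      · rw [mul_smul]
        refine Submodule.span_induction (p := fun d _ => c • d • y = 0) ?_ ?_ ?_ ?_ hd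
        · rintro d ⟨m, hm, hd⟩
          by_cases hm0 : 0 ≤ m
          · refine ih c hc _ _ (M.smul_mem m n d y hd hy) ?_
            have := weight_pos hm0 hm
            rw [weight_add]
            push_cast at hb
            omega
          · rw [hN m hm0, AddSubgroup.mem_bot] at hd
            rw [hd, zero_smul, smul_zero]
        · rw [zero_smul, smul_zero]
        · intro d e _ _ hd he
          rw [add_smul, smul_add, hd, he, add_zero]
        · intro e d _ hd
          rw [smul_eq_mul, mul_smul, smul_comm, hd, smul_zero]
      · rw [add_smul, hc, hd, add_zero]
  induction y using M.gr_induction with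
  | zero => exact zero_mem _
  | homog n y hy =>
    refine ⟨(b - weight n + 1).toNat, fun a ha => key _ a ha n y hy ?_⟩
    have := Int.self_le_toNat (b - weight n + 1)
    omega
  | add x y hx hy => exact add_mem hx hy

/-- With a resolution of bounded weight, `Γ_𝓜` changes nothing and the complex stays exact in
positive degrees. A preimage of a homogeneous cocycle is made homogeneous by projecting to degree
`n`. -/
theorem subsingleton_H_succ_of_weightLE [GradedRing 𝒜] {k : Type v} [Field k] [Algebra k S]
    (hN : ∀ n : Fin r → ℤ, ¬ 0 ≤ n → 𝒜 n = ⊥) (hk : ∀ c : k, algebraMap k S c ∈ 𝒜 0)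
    (ρ : ∀ N : GrMod 𝒜, InjRes N) {M : GrMod 𝒜} {b : ℤ} (hM : M.WeightLE b) (i : ℕ)
    (n : Fin r → ℤ) : Subsingleton (H ρ M (i + 1) n) := by
  obtain ⟨R, hR⟩ := exists_injRes (k := k) hN hk M
  rw [← not_nontrivial_iff_subsingleton, nontrivial_cohomology_iff (ρ M) R, nontrivial_iff_exists]
  rintro ⟨x, hx, hx'⟩
  obtain ⟨y, rfl⟩ := (R.exact_succ i x).1 hx.2
  refine hx' ⟨(R.I i).proj n y, ⟨(R.I i).proj_mem n y,
    mem_gammaTorsion_of_weightLE hN (hR b hM i) _⟩, ?_⟩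
  exact (IsHom.map_proj (R.δ_hom i) n y).trans ((R.I (i + 1)).proj_of_mem hx.1.1)

end Torsion

section Free

variable {b : ℕ} (a : Fin b → Fin r → ℤ)

theorem single_mem_freeGr (q : Fin b) {n : Fin r → ℤ} {x : S} (hx : x ∈ 𝒜 (a q + n)) :
    (Pi.single q x : Fin b → S) ∈ freeGr 𝒜 a n := by
  intro q'
  by_cases h : q' = q
  · subst h
    rw [Pi.single_eq_same]; exact hx
  · rw [Pi.single_eq_of_ne h]; exact zero_mem _

variable [GradedRing 𝒜]

/-- The projection of a graded free module to a summand. -/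
def freeProj (q : Fin b) : Hom (free 𝒜 a) ((self 𝒜).shift (a q)) :=
  ⟨LinearMap.proj q, fun _ _ hx => hx q⟩

/-- The inclusion of a summand in a graded free module. -/
def freeIncl (q : Fin b) : Hom ((self 𝒜).shift (a q)) (free 𝒜 a) :=
  ⟨LinearMap.single S (fun _ => S) q, fun _ _ hx => single_mem_freeGr a q hx⟩

theorem freeProj_comp_freeIncl (q : Fin b) : (freeProj (𝒜 := 𝒜) a q).comp (freeIncl a q) = Hom.id _ :=
  Hom.ext fun x => Pi.single_eq_same (M := fun _ => S) q x

theorem sum_freeIncl_comp_freeProj :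
    ∑ q, (freeIncl a q).comp (freeProj a q) = Hom.id (free 𝒜 a) := by
  refine Subtype.ext (LinearMap.ext fun x => ?_)
  rw [Hom.sum_apply]
  exact Finset.univ_sum_single (M := fun _ => S) x

theorem subsingleton_H_free_iff (ρ : ∀ N : GrMod 𝒜, InjRes N) (i : ℕ) (n : Fin r → ℤ) :
    Subsingleton (H ρ (free 𝒜 a) i n) ↔ ∀ q, Subsingleton (H ρ (self 𝒜) i (a q + n)) := by
  constructor
  · intro h q
    rw [← subsingleton_H_shift_iff]
    exact subsingleton_H_of_retract _ _ (freeProj_comp_freeIncl a q) h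
  · intro h
    have h1 : AddMonoidHom.id (H ρ (free 𝒜 a) i n) = 0 := by
      rw [← Hmap_id, ← sum_freeIncl_comp_freeProj, Hmap_sum]
      refine Finset.sum_eq_zero fun q _ => AddMonoidHom.ext fun c => ?_
      rw [Hmap_comp]
      have := (subsingleton_H_shift_iff ρ _ _ _ _).2 (h q)
      rw [AddMonoidHom.comp_apply, Subsingleton.elim (Hmap ρ (freeProj a q) i n c) 0, map_zero]
      rfl
    exact subsingleton_of_forall_eq 0 fun c => DFunLike.congr_fun h1 c

/-- The map is the sum of its matrix entries, and each entry acts as zero if it vanishes or if its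
source or target summand has no cohomology in the degree considered. -/
theorem Hmap_free_eq_zero (ρ : ∀ N : GrMod 𝒜, InjRes N) {b' : ℕ} (a' : Fin b' → Fin r → ℤ)
    (f : Hom (free 𝒜 a) (free 𝒜 a')) (i : ℕ) (n : Fin r → ℤ)
    (h : ∀ q q', Subsingleton (H ρ (self 𝒜) i (a q + n)) ∨
      Subsingleton (H ρ (self 𝒜) i (a' q' + n)) ∨
      (freeProj a' q').comp (f.comp (freeIncl a q)) = 0) : Hmap ρ f i n = 0 := by
  have h1 : f = ∑ q, ∑ q', (freeIncl a' q').comp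
      (((freeProj a' q').comp (f.comp (freeIncl a q))).comp (freeProj a q)) := by
    refine Subtype.ext (LinearMap.ext fun x => ?_)
    rw [Hom.sum_apply]
    have h2 : ∀ q, (∑ q', (freeIncl a' q').comp
      (((freeProj a' q').comp (f.comp (freeIncl a q))).comp (freeProj a q)) :
        Hom (free 𝒜 a) (free 𝒜 a')).1 x = f.1 ((freeIncl a q).1 ((freeProj a q).1 x)) := by
      intro q
      rw [Hom.sum_apply]
      exact Finset.univ_sum_single (M := fun _ => S) (f.1 ((freeIncl a q).1 ((freeProj a q).1 x)))
    rw [Finset.sum_congr rfl fun q _ => h2 q, ← map_sum]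
    exact congrArg f.1 (Finset.univ_sum_single (M := fun _ => S) x).symm
  rw [h1, Hmap_sum]
  refine Finset.sum_eq_zero fun q _ => ?_
  rw [Hmap_sum]
  refine Finset.sum_eq_zero fun q' _ => ?_
  rw [Hmap_comp, Hmap_comp]
  refine AddMonoidHom.ext fun c => ?_
  simp only [AddMonoidHom.comp_apply, AddMonoidHom.zero_apply]
  obtain h3 | h3 | h3 := h q q'
  · have := (subsingleton_H_shift_iff ρ _ _ _ _).2 h3
    rw [Subsingleton.elim (Hmap ρ (freeProj a q) i n c) 0, map_zero, map_zero]
  · have := (subsingleton_H_shift_iff ρ _ _ _ _).2 h3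
    rw [Subsingleton.elim (Hmap ρ ((freeProj a' q').comp (f.comp (freeIncl a q))) i n _) 0,
      map_zero]
  · rw [h3, Hmap_zero, AddMonoidHom.zero_apply, map_zero]

end Free

end GrMod

/-! ### Vanishing above the dimension and boundedness of degrees. -/

namespace GrMod

open InjRes

variable {r : ℕ} {S : Type u} [CommRing S] {𝒜 : (Fin r → ℤ) → AddSubgroup S}

/-- Every module met is a quotient of `N`; passing to a proper graded quotient enlarges the kernel
of the map from `N`, which cannot go on for ever. -/
theorem noetherian_induction [IsNoetherianRing S] (P : GrMod 𝒜 → Prop)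
    (h : ∀ X : GrMod 𝒜, Module.Finite S X.carrier →
      (∀ (L : Submodule S X.carrier) (hL : X.IsGrSub L), L ≠ ⊥ → P (quot L hL)) → P X)
    (N : GrMod 𝒜) [Module.Finite S N.carrier] : P N := by
  suffices key : ∀ (K : Submodule S N.carrier) (X : GrMod 𝒜) (π : Hom N X),
      Function.Surjective π.1 → LinearMap.ker π.1 = K → P X from
    key _ N (Hom.id N) Function.surjective_id rfl
  intro K
  induction K using WellFoundedGT.induction with
  | ind K ih =>
  intro X π hπ hK
  refine h X (Module.Finite.of_surjective π.1 hπ) fun L hL hL0 => ?_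
  refine ih (LinearMap.ker ((quotπ L hL).comp π).1) ?_ _ ((quotπ L hL).comp π)
    ((quotπ_surjective L hL).comp hπ) rfl
  rw [← hK]
  refine lt_of_le_of_ne (fun x hx => ?_) fun heq => hL0 ?_
  · rw [LinearMap.mem_ker] at hx ⊢
    rw [Hom.comp_apply, hx, map_zero]
  · rw [eq_bot_iff]
    intro x hx
    obtain ⟨y, rfl⟩ := hπ x
    have : y ∈ LinearMap.ker ((quotπ L hL).comp π).1 := (quotπ_eq_zero_iff L hL _).2 hx
    rw [← heq] at this
    exact this

theorem isGrSub_sup {M : GrMod 𝒜} {K L : Submodule S M.carrier} (hK : M.IsGrSub K)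
    (hL : M.IsGrSub L) : M.IsGrSub (K ⊔ L) := by
  intro n x hx
  obtain ⟨y, hy, z, hz, rfl⟩ := Submodule.mem_sup.1 hx
  rw [map_add]
  exact Submodule.add_mem_sup (hK n y hy) (hL n z hz)

/-- The Mayer–Vietoris sequence `0 → M → M/K ⊕ M/L → M/(K + L) → 0`. -/
theorem isShortExact_inf_sup {M : GrMod 𝒜} {K L : Submodule S M.carrier} (hK : M.IsGrSub K)
    (hL : M.IsGrSub L) (h : K ⊓ L = ⊥) :
    ∃ (f : Hom M (prod (quot K hK) (quot L hL)))
      (g : Hom (prod (quot K hK) (quot L hL)) (quot (K ⊔ L) (isGrSub_sup hK hL))),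
      IsShortExact f g := by
  let a : Hom (quot K hK) (quot (K ⊔ L) (isGrSub_sup hK hL)) :=
    quotLift K hK (quotπ _ (isGrSub_sup hK hL)) fun x hx =>
      (quotπ_eq_zero_iff _ _ x).2 (Submodule.mem_sup_left hx)
  let b : Hom (quot L hL) (quot (K ⊔ L) (isGrSub_sup hK hL)) :=
    quotLift L hL (quotπ _ (isGrSub_sup hK hL)) fun x hx =>
      (quotπ_eq_zero_iff _ _ x).2 (Submodule.mem_sup_right hx)
  refine ⟨⟨(quotπ K hK).1.prod (quotπ L hL).1, fun n x hx =>
    ⟨(quotπ K hK).mem hx, (quotπ L hL).mem hx⟩⟩,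
    ⟨a.1.comp (LinearMap.fst S _ _) - b.1.comp (LinearMap.snd S _ _), fun n x hx =>
      sub_mem (a.mem hx.1) (b.mem hx.2)⟩, ?_, ?_, ?_⟩
  · refine (injective_iff_map_eq_zero _).2 fun x hx => ?_
    obtain ⟨h1, h2⟩ := Prod.ext_iff.1 hx
    have : x ∈ K ⊓ L := ⟨(quotπ_eq_zero_iff K hK x).1 h1, (quotπ_eq_zero_iff L hL x).1 h2⟩
    rwa [h] at this
  · intro x
    obtain ⟨y, rfl⟩ := quotπ_surjective _ _ x
    refine ⟨((quotπ K hK).1 y, 0), ?_⟩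
    change a.1 ((quotπ K hK).1 y) - b.1 0 = _
    rw [map_zero, sub_zero]
    rfl
  · rintro ⟨x, y⟩
    obtain ⟨x, rfl⟩ := quotπ_surjective _ _ x
    obtain ⟨y, rfl⟩ := quotπ_surjective _ _ y
    constructor
    · intro hxy
      have h1 : (quotπ _ (isGrSub_sup hK hL)).1 (x - y) = 0 := by
        rw [map_sub]; exact hxy
      rw [quotπ_eq_zero_iff] at h1
      obtain ⟨u, hu, v, hv, huv⟩ := Submodule.mem_sup.1 h1
      refine ⟨x - u, Prod.ext ?_ ?_⟩
      · change (quotπ K hK).1 (x - u) = (quotπ K hK).1 x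
        rw [map_sub, (quotπ_eq_zero_iff K hK u).2 hu, sub_zero]
      · change (quotπ L hL).1 (x - u) = (quotπ L hL).1 y
        have : x - u = y + v := by rw [sub_eq_iff_eq_add, add_assoc, add_comm v u, huv]; abel
        rw [this, map_add, (quotπ_eq_zero_iff L hL v).2 hv, add_zero]
    · rintro ⟨z, hz⟩
      obtain ⟨h1, h2⟩ := Prod.ext_iff.1 hz
      change a.1 ((quotπ K hK).1 x) - b.1 ((quotπ L hL).1 y) = 0
      rw [show (quotπ K hK).1 x = (quotπ K hK).1 z from h1.symm,
        show (quotπ L hL).1 y = (quotπ L hL).1 z from h2.symm]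
      exact sub_self _

/-- Choose a nonzero homogeneous `z` with maximal annihilator. If `x • z ≠ 0` then `x • z` has the
same annihilator, so no power of `x` kills `z`, against nilpotence. -/
theorem exists_socle [IsNoetherianRing S] {X : GrMod 𝒜} [Nontrivial X.carrier]
    (h : ∀ m, m ≠ 0 → ∀ x ∈ 𝒜 m, ∃ c : ℕ, ∀ y : X.carrier, x ^ c • y = 0) :
    ∃ n, ∃ z ∈ X.gr n, z ≠ 0 ∧ ∀ m, m ≠ 0 → ∀ x ∈ 𝒜 m, x • z = 0 := by
  obtain ⟨n, z, hz, hz0⟩ : ∃ n, ∃ z ∈ X.gr n, z ≠ 0 := by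
    by_contra! hc
    obtain ⟨w, hw⟩ := exists_ne (0 : X.carrier)
    exact hw (X.ext_proj fun n => by rw [hc n _ (X.proj_mem n w), map_zero])
  let A : Set (Ideal S) := {I | ∃ n, ∃ z ∈ X.gr n, z ≠ 0 ∧ Ideal.torsionOf S X.carrier z = I}
  obtain ⟨I, ⟨n, z, hz, hz0, rfl⟩, hmax⟩ := WellFounded.has_min
    (wellFounded_gt (α := Ideal S)) A ⟨_, n, z, hz, hz0, rfl⟩
  refine ⟨n, z, hz, hz0, fun m hm x hx => ?_⟩
  by_contra hxz
  have heq : Ideal.torsionOf S X.carrier (x • z) = Ideal.torsionOf S X.carrier z := by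
    by_contra hne
    refine hmax _ ⟨m + n, x • z, X.smul_mem m n x z hx hz, hxz, rfl⟩
      (lt_of_le_of_ne (fun a ha => ?_) (Ne.symm hne))
    rw [Ideal.mem_torsionOf_iff] at ha ⊢
    rw [smul_comm, ha, smul_zero]
  have key : ∀ c : ℕ, x ^ c • z ≠ 0 := by
    intro c
    induction c with
    | zero => rwa [pow_zero, one_smul]
    | succ c ih =>
      intro h0
      apply ih
      rw [pow_succ, mul_smul] at h0
      rw [← Ideal.mem_torsionOf_iff, ← heq, Ideal.mem_torsionOf_iff]
      exact h0
  obtain ⟨c, hc⟩ := h m hm x hx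
  exact key c (hc z)

open Pointwise in
-- If some `x` of nonzero degree acts neither nilpotently nor injectively, a power at which the
-- kernels have stabilized meets its own image trivially, while its kernel and image are both
-- nonzero: the setting of Mayer–Vietoris.
theorem exists_cases [IsNoetherianRing S] (X : GrMod 𝒜) [Module.Finite S X.carrier] :
    (∀ m, m ≠ 0 → ∀ x ∈ 𝒜 m, ∃ c : ℕ, ∀ y : X.carrier, x ^ c • y = 0) ∨
    ∃ m, m ≠ 0 ∧ ∃ x ∈ 𝒜 m, (∀ y : X.carrier, x • y = 0 → y = 0) ∨
      ∃ c : ℕ, (∃ y : X.carrier, x ^ c • y ≠ 0) ∧ (∃ y : X.carrier, y ≠ 0 ∧ x ^ c • y = 0) ∧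
        ∀ y : X.carrier, x ^ c • x ^ c • y = 0 → x ^ c • y = 0 := by
  by_cases h : ∀ m, m ≠ 0 → ∀ x ∈ 𝒜 m, ∃ c : ℕ, ∀ y : X.carrier, x ^ c • y = 0
  · exact Or.inl h
  push Not at h
  obtain ⟨m, hm, x, hx, hxc⟩ := h
  refine Or.inr ⟨m, hm, x, hx, ?_⟩
  by_cases hinj : ∀ y : X.carrier, x • y = 0 → y = 0
  · exact Or.inl hinj
  push Not at hinj
  obtain ⟨y, hy, hy0⟩ := hinj
  let K : ℕ →o Submodule S X.carrier :=
    ⟨fun c => LinearMap.ker (LinearMap.lsmul S X.carrier (x ^ c)),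
      monotone_nat_of_le_succ fun c z hz => by
        change x ^ (c + 1) • z = 0
        rw [pow_succ', mul_smul, show x ^ c • z = 0 from hz, smul_zero]⟩
  obtain ⟨c, hc⟩ := monotone_stabilizes_iff_noetherian.2 (inferInstance : IsNoetherian S X.carrier) K
  -- The exponent must be positive so that `y`, killed by `x`, is killed by the chosen power.
  refine Or.inr ⟨c + 1, hxc _, ⟨y, hy0, by rw [pow_succ, mul_smul, hy, smul_zero]⟩,
    fun z hz => ?_⟩
  have h1 : z ∈ K (c + 1 + (c + 1)) := by
    change x ^ (c + 1 + (c + 1)) • z = 0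
    rw [pow_add, mul_smul, hz]
  have h2 : K (c + 1 + (c + 1)) = K (c + 1) := by
    rw [← hc (c + 1) (by omega), ← hc (c + 1 + (c + 1)) (by omega)]
  rw [h2] at h1
  exact h1

open Pointwise in
theorem supportDim_quot_smul_top_lt {X : Type u} [AddCommGroup X] [Module S X]
    [IsNoetherianRing S] [Module.Finite S X] {x : S} (h : ∀ y : X, x • y = 0 → y = 0) :
    Module.supportDim S (X ⧸ x • (⊤ : Submodule S X)) + 1 ≤ Module.supportDim S X := by
  have hreg : IsSMulRegular X x := (injective_iff_map_eq_zero (LinearMap.lsmul S X x)).2 h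
  exact Module.supportDim_quotSMulTop_succ_le_of_notMem_minimalPrimes
    fun _ => hreg.notMem_of_mem_minimalPrimes

open Pointwise in
-- The element `x` is a nonzerodivisor on `X/K`, and `X/(K + xX)` is a quotient of `(X/K)/x(X/K)`.
theorem supportDim_quot_sup_lt {X : Type u} [AddCommGroup X] [Module S X] [IsNoetherianRing S]
    [Module.Finite S X] {x : S} {K : Submodule S X} (hK : ∀ y, y ∈ K ↔ x • y = 0)
    (hx : ∀ y : X, x • x • y = 0 → x • y = 0) :
    Module.supportDim S (X ⧸ (K ⊔ x • (⊤ : Submodule S X))) + 1 ≤ Module.supportDim S X := by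
  have h1 : Module.supportDim S ((X ⧸ K) ⧸ x • (⊤ : Submodule S (X ⧸ K))) + 1 ≤
      Module.supportDim S (X ⧸ K) :=
    supportDim_quot_smul_top_lt fun y hy => by
      obtain ⟨y, rfl⟩ := K.mkQ_surjective y
      rw [← map_smul, Submodule.mkQ_apply, Submodule.Quotient.mk_eq_zero, hK] at hy
      rw [Submodule.mkQ_apply, Submodule.Quotient.mk_eq_zero, hK]
      exact hx y hy
  have h2 : Module.supportDim S (X ⧸ K) ≤ Module.supportDim S X :=
    Module.supportDim_le_of_surjective K.mkQ K.mkQ_surjective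
  let u : (X ⧸ K) →ₗ[S] (X ⧸ (K ⊔ x • (⊤ : Submodule S X))) :=
    K.liftQ (Submodule.mkQ _) (by rw [Submodule.ker_mkQ]; exact le_sup_left)
  have hu : Function.Surjective u := fun y => by
    obtain ⟨y, rfl⟩ := Submodule.mkQ_surjective _ y
    exact ⟨K.mkQ y, rfl⟩
  let w : ((X ⧸ K) ⧸ x • (⊤ : Submodule S (X ⧸ K))) →ₗ[S]
      (X ⧸ (K ⊔ x • (⊤ : Submodule S X))) :=
    Submodule.liftQ _ u (by
      intro y hy
      obtain ⟨z, -, rfl⟩ := (Submodule.mem_smul_pointwise_iff_exists _ _ _).1 hy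
      obtain ⟨z, rfl⟩ := K.mkQ_surjective z
      rw [LinearMap.mem_ker, ← map_smul]
      exact (Submodule.Quotient.mk_eq_zero _).2 (Submodule.mem_sup_right
        (Submodule.smul_mem_pointwise_smul z x ⊤ trivial)))
  have hw : Function.Surjective w := fun y => by
    obtain ⟨y, rfl⟩ := hu y
    exact ⟨Submodule.mkQ _ y, rfl⟩
  refine le_trans ?_ (h1.trans h2)
  gcongr
  exact Module.supportDim_le_of_surjective w hw

variable [GradedRing 𝒜]

theorem isGrSub_span {X : GrMod 𝒜} {n : Fin r → ℤ} {z : X.carrier} (hz : z ∈ X.gr n) :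
    X.IsGrSub (Submodule.span S {z}) := by
  intro l y hy
  obtain ⟨a, rfl⟩ := Submodule.mem_span_singleton.1 hy
  induction a using DirectSum.Decomposition.inductionOn 𝒜 with
  | zero => rw [zero_smul, map_zero]; exact zero_mem _
  | @homogeneous m a =>
    have h := X.smul_mem m n _ z a.2 hz
    by_cases hl : m + n = l
    · subst hl
      rw [X.proj_of_mem h]; exact hy
    · rw [X.proj_of_mem_ne h hl]; exact zero_mem _
  | add a b ha hb =>
    rw [add_smul, map_add]
    exact add_mem (ha (Submodule.smul_mem _ _ (Submodule.mem_span_singleton_self z)))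
      (hb (Submodule.smul_mem _ _ (Submodule.mem_span_singleton_self z)))

/-- Only the degree zero part of `S` acts nontrivially on `z`, so the span sits in one degree. -/
theorem gr_sub_span_of_socle {X : GrMod 𝒜} {n : Fin r → ℤ} {z : X.carrier} (hz : z ∈ X.gr n)
    (h : ∀ m, m ≠ 0 → ∀ x ∈ 𝒜 m, x • z = 0) {l : Fin r → ℤ}
    {y : (sub _ (isGrSub_span hz)).carrier} (hy : y ∈ (sub _ (isGrSub_span hz)).gr l)
    (hy0 : y ≠ 0) : l = n := by
  by_contra hl
  refine hy0 (Subtype.ext (X.disjoint_gr hl hy ?_))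
  obtain ⟨a, ha⟩ := Submodule.mem_span_singleton.1 y.2
  rw [← ha]
  clear ha
  induction a using DirectSum.Decomposition.inductionOn 𝒜 with
  | zero => rw [zero_smul]; exact zero_mem _
  | @homogeneous m a =>
    by_cases hm : m = 0
    · subst hm
      have := X.smul_mem 0 n _ z a.2 hz
      rwa [zero_add] at this
    · rw [h m hm a a.2]; exact zero_mem _
  | add a b ha hb => rw [add_smul]; exact add_mem ha hb

variable {k : Type v} [Field k] [Algebra k S]

/-- The local cohomology of `X` vanishes above the dimension, and the `j`-th components of its
degrees are bounded above. -/
def IsTame (ρ : ∀ N : GrMod 𝒜, InjRes N) (j : Fin r) (X : GrMod 𝒜) : Prop :=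
  (∀ (i : ℕ) n, Module.supportDim S X.carrier < i → Subsingleton (H ρ X i n)) ∧
    ∃ b : ℤ, ∀ i n, b < n j → Subsingleton (H ρ X i n)

theorem natCast_lt_of_add_one_le {e e' : WithBot ℕ∞} {i : ℕ} (h : e + 1 ≤ e')
    (h' : e' < (i + 1 : ℕ)) : e < i := by
  have h1 : e + 1 < (i : WithBot ℕ∞) + 1 := by
    refine lt_of_le_of_lt h ?_
    exact_mod_cast h'
  exact lt_of_add_lt_add_right h1

open Pointwise in
-- Induction on proper graded quotients along the three cases of `exists_cases`: remove a socle
-- element, divide by a nonzerodivisor, or use Mayer–Vietoris. In the last two cases the relevant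
-- quotient has smaller dimension, which pays for the shift of cohomological index.
theorem isTame_of_finite [IsNoetherianRing S] (hN : ∀ n : Fin r → ℤ, ¬ 0 ≤ n → 𝒜 n = ⊥)
    (hk : ∀ c : k, algebraMap k S c ∈ 𝒜 0) (ρ : ∀ N : GrMod 𝒜, InjRes N) (j : Fin r)
    (X : GrMod 𝒜) [Module.Finite S X.carrier] : IsTame ρ j X := by
  refine noetherian_induction (IsTame ρ j) (fun X _ ih => ?_) X
  by_cases hX : Subsingleton X.carrier
  · exact ⟨fun i n _ => subsingleton_H_of_subsingleton hX i n,
      0, fun i n _ => subsingleton_H_of_subsingleton hX i n⟩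
  have hX : Nontrivial X.carrier := not_subsingleton_iff_nontrivial.1 hX
  have hdim : 0 ≤ Module.supportDim S X.carrier := by
    have := Module.supportDim_ne_bot_of_nontrivial S X.carrier
    obtain ⟨e, he⟩ := WithBot.ne_bot_iff_exists.1 this
    rw [← he]
    exact_mod_cast (zero_le : 0 ≤ e)
  obtain h | ⟨m, hm, x, hx, h | ⟨c, ⟨y₁, hy₁⟩, ⟨y₂, hy₂, hy₂'⟩, hc⟩⟩ := exists_cases X
  -- Nilpotent case: the span of `z` has cohomology only in index `0` and degree `n₀`, so passing to
  -- the quotient costs at most the bound `n₀ j`.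
  · obtain ⟨n₀, z, hz, hz0, hsoc⟩ := exists_socle h
    have hdeg := fun l y => gr_sub_span_of_socle (l := l) (y := y) hz hsoc
    obtain ⟨ih1, b, ih2⟩ := ih _ (isGrSub_span hz) fun h0 => hz0 (by
      rw [Submodule.span_singleton_eq_bot] at h0; exact h0)
    have hw : (sub _ (isGrSub_span hz)).WeightLE (weight n₀) := fun l y hy hy0 => by
      rw [hdeg l y hy hy0]; rfl
    have hS := isShortExact_quot _ (isGrSub_span hz)
    constructor
    · intro i n hi
      have hq : Module.supportDim S (quot _ (isGrSub_span hz)).carrier < i :=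
        lt_of_le_of_lt (Module.supportDim_le_of_surjective _ (quotπ_surjective _ _)) hi
      cases i with
      | zero => exact absurd hi (not_lt.2 (by simpa using hdim))
      | succ i =>
        exact hS.subsingleton_middle (subsingleton_H_succ_of_weightLE hN hk ρ hw i n)
          (ih1 _ n hq)
    · refine ⟨max b (n₀ j), fun i n hn => hS.subsingleton_middle ?_
        (ih2 i n (lt_of_le_of_lt (le_max_left _ _) hn))⟩
      cases i with
      | zero =>
        rw [← not_nontrivial_iff_subsingleton, nontrivial_cohomology_zero_iff]
        rintro ⟨y, hy, hy0, -⟩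
        rw [hdeg n y hy hy0] at hn
        exact absurd hn (not_lt.2 (le_max_right _ _))
      | succ i => exact subsingleton_H_succ_of_weightLE hN hk ρ hw i n
  · obtain ⟨y, hy⟩ := exists_ne (0 : X.carrier)
    have hx0 : x ≠ 0 := fun h0 => hy (h y (by rw [h0, zero_smul]))
    have hm0 : 0 ≤ m := by
      by_contra hm0
      rw [hN m hm0, AddSubgroup.mem_bot] at hx
      exact hx0 hx
    obtain ⟨ih1, b, ih2⟩ := ih _ (isGrSub_smul_top hx) fun h0 => by
      have h1 := Submodule.smul_mem_pointwise_smul y x (⊤ : Submodule S X.carrier) trivial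
      rw [h0] at h1
      exact hy (h y h1)
    constructor
    · intro i n hi
      refine subsingleton_H_of_mul ρ hx hm h fun i' hi' t => ih1 _ _ ?_
      subst hi'
      exact natCast_lt_of_add_one_le (supportDim_quot_smul_top_lt h) hi
    -- The bound of the quotient works unchanged: since `m j ≥ 0`, the degrees `m + (t • m + n)`
    -- stay beyond it.
    · refine ⟨b, fun i n hn => subsingleton_H_of_mul ρ hx hm h fun i' hi' t => ih2 _ _ ?_⟩
      have h1 : 0 ≤ m j := hm0 j
      have h2 : 0 ≤ (t : ℤ) * m j := mul_nonneg (Int.natCast_nonneg t) h1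
      have h3 : (m + (t • m + n)) j = m j + ((t : ℤ) * m j + n j) := by simp
      rw [h3]
      linarith
  -- Mixed case: Mayer–Vietoris for the kernel and the image of `x ^ c`.
  · have hxc : x ^ c ∈ 𝒜 (c • m) := SetLike.pow_mem_graded c hx
    let K : Submodule S X.carrier := LinearMap.ker (mulHom X hxc).1
    have hK : X.IsGrSub K := isGrSub_ker (mulHom X hxc)
    have hKm : ∀ y, y ∈ K ↔ x ^ c • y = 0 := fun y => Iff.rfl
    have hL := isGrSub_smul_top (M := X) hxc
    have hLm := fun y : X.carrier =>
      Submodule.smul_mem_pointwise_smul y (x ^ c) (⊤ : Submodule S X.carrier) trivial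
    have hinf : K ⊓ x ^ c • (⊤ : Submodule S X.carrier) = ⊥ := by
      rw [eq_bot_iff]
      rintro y ⟨hy, hy'⟩
      obtain ⟨z, -, rfl⟩ := (Submodule.mem_smul_pointwise_iff_exists _ _ _).1 hy'
      exact hc z hy
    have hK0 : K ≠ ⊥ := fun h0 => hy₂ (by
      have := (hKm y₂).2 hy₂'
      rwa [h0] at this)
    have hL0 : x ^ c • (⊤ : Submodule S X.carrier) ≠ ⊥ := fun h0 => hy₁ (by
      have := hLm y₁
      rwa [h0] at this)
    obtain ⟨ihK1, bK, ihK2⟩ := ih K hK hK0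
    obtain ⟨ihL1, bL, ihL2⟩ := ih _ hL hL0
    obtain ⟨ihS1, bS, ihS2⟩ := ih _ (isGrSub_sup hK hL) fun h0 => hK0 (by
      rw [eq_bot_iff, ← h0]; exact le_sup_left)
    obtain ⟨f, g, hfg⟩ := isShortExact_inf_sup hK hL hinf
    have hprod : ∀ i n, Subsingleton (H ρ (quot K hK) i n) → Subsingleton (H ρ (quot _ hL) i n) →
        Subsingleton (H ρ (prod (quot K hK) (quot _ hL)) i n) := fun i n h1 h2 =>
      (isShortExact_prod _ _).subsingleton_middle h1 h2
    have hdS := supportDim_quot_sup_lt (K := K) (x := x ^ c) hKm hc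
    constructor
    · intro i n hi
      cases i with
      | zero => exact absurd hi (not_lt.2 (by simpa using hdim))
      | succ i =>
        refine hfg.subsingleton_left (ihS1 _ _ (natCast_lt_of_add_one_le hdS hi))
          (hprod _ _ (ihK1 _ _ ?_) (ihL1 _ _ ?_))
        · exact lt_of_le_of_lt (Module.supportDim_le_of_surjective _ (quotπ_surjective _ hK)) hi
        · exact lt_of_le_of_lt (Module.supportDim_le_of_surjective _ (quotπ_surjective _ hL)) hi
    · refine ⟨max bK (max bL bS), fun i n hn => ?_⟩
      obtain ⟨h1, h2⟩ := max_lt_iff.1 hn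
      obtain ⟨h2, h3⟩ := max_lt_iff.1 h2
      cases i with
      | zero => exact hfg.subsingleton_left_zero (hprod _ _ (ihK2 _ _ h1) (ihL2 _ _ h2))
      | succ i =>
        exact hfg.subsingleton_left (ihS2 _ _ h3) (hprod _ _ (ihK2 _ _ h1) (ihL2 _ _ h2))

end GrMod

/-! ### Graded free resolutions and Rees' vanishing of Ext. -/

namespace GrMod

open InjRes

variable {r : ℕ} {S : Type u} [CommRing S] {𝒜 : (Fin r → ℤ) → AddSubgroup S}

section Homogenize

variable {M N P : GrMod 𝒜}

/-- The degree preserving additive map with the same degree preserving part as `f`. -/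
noncomputable def homogenizeAdd (f : M.carrier →+ N.carrier) : M.carrier →+ N.carrier :=
  (DirectSum.toAddMonoid fun n => (N.proj n).comp (f.comp (M.gr n).subtype)).comp
    M.decomp.symm.toAddMonoidHom

theorem homogenizeAdd_of_mem (f : M.carrier →+ N.carrier) {n : Fin r → ℤ} {x : M.carrier}
    (hx : x ∈ M.gr n) : homogenizeAdd f x = N.proj n (f x) := by
  change DirectSum.toAddMonoid _ (M.decomp.symm x) = _
  rw [M.decomp_symm_of_mem hx, DirectSum.toAddMonoid_of]
  rfl

/-- The degree preserving part of a linear map. -/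
noncomputable def homogenize [GradedRing 𝒜] (f : M.carrier →ₗ[S] N.carrier) : Hom M N :=
  ⟨{ toFun := homogenizeAdd f.toAddMonoidHom
     map_add' := map_add _
     map_smul' := fun a x => by
      change homogenizeAdd f.toAddMonoidHom (a • x) = a • homogenizeAdd f.toAddMonoidHom x
      induction x using M.gr_induction with
      | zero => simp
      | homog n x hx =>
        induction a using DirectSum.Decomposition.inductionOn 𝒜 with
        | zero => simp
        | @homogeneous m a =>
          rw [homogenizeAdd_of_mem _ (M.smul_mem m n _ x a.2 hx), homogenizeAdd_of_mem _ hx,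
            ← N.smul_proj a.2]
          exact congrArg _ (map_smul f _ x)
        | add a b ha hb => rw [add_smul, map_add, ha, hb, add_smul]
      | add x y hx hy => rw [smul_add, map_add, map_add, hx, hy, smul_add] },
    fun n x hx => by
      change homogenizeAdd f.toAddMonoidHom x ∈ _
      rw [homogenizeAdd_of_mem _ hx]
      exact N.proj_mem _ _⟩

theorem Hom.ext_homog {f g : Hom M N} (h : ∀ n, ∀ x ∈ M.gr n, f.1 x = g.1 x) : f = g :=
  Hom.ext fun x => by
    induction x using M.gr_induction with
    | zero => simp
    | homog n x hx => exact h n x hx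
    | add x y hx hy => rw [map_add, map_add, hx, hy]

variable [GradedRing 𝒜]

theorem homogenize_of_mem (f : M.carrier →ₗ[S] N.carrier) {n : Fin r → ℤ} {x : M.carrier}
    (hx : x ∈ M.gr n) : (homogenize f).1 x = N.proj n (f x) :=
  homogenizeAdd_of_mem f.toAddMonoidHom hx

/-- A factorization of a degree preserving map can be made degree preserving. This lets Ext be
killed with ungraded maps, over a localization, and the result be used in the graded category. -/
theorem homogenize_comp_eq (f : N.carrier →ₗ[S] P.carrier) (g : Hom M N) (u : Hom M P)
    (h : ∀ x, u.1 x = f (g.1 x)) (x : M.carrier) : u.1 x = (homogenize f).1 (g.1 x) := by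
  have : u = (homogenize f).comp g := Hom.ext_homog fun n x hx => by
    rw [Hom.comp_apply, homogenize_of_mem f (g.mem hx), ← h, P.proj_of_mem (u.mem hx)]
  rw [this]; rfl

theorem comp_homogenize_eq (f : M.carrier →ₗ[S] N.carrier) (g : Hom N P) (u : Hom M P)
    (h : ∀ x, u.1 x = g.1 (f x)) (x : M.carrier) : u.1 x = g.1 ((homogenize f).1 x) := by
  have : u = g.comp (homogenize f) := Hom.ext_homog fun n x hx => by
    rw [Hom.comp_apply, homogenize_of_mem f hx, g.map_proj, ← h, P.proj_of_mem (u.mem hx)]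
  rw [this]; rfl

end Homogenize

theorem exists_linear_lift {F A B : Type*} [AddCommGroup F] [AddCommGroup A] [AddCommGroup B]
    [Module S F] [Module S A] [Module S B] [Module.Projective S F] (f : A →ₗ[S] B)
    (g : F →ₗ[S] B) (h : ∀ x, ∃ y, f y = g x) : ∃ g' : F →ₗ[S] A, ∀ x, f (g' x) = g x := by
  obtain ⟨g', hg'⟩ := Module.projective_lifting_property f.rangeRestrict
    (g.codRestrict (LinearMap.range f) h) f.surjective_rangeRestrict
  exact ⟨g', fun x => congrArg Subtype.val (LinearMap.congr_fun hg' x)⟩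

section FreeRes

variable [GradedRing 𝒜]

instance projective_free {b : ℕ} (a : Fin b → Fin r → ℤ) :
    Module.Projective S (free 𝒜 a).carrier :=
  inferInstanceAs (Module.Projective S (Fin b → S))

instance finite_free {b : ℕ} (a : Fin b → Fin r → ℤ) : Module.Finite S (free 𝒜 a).carrier :=
  inferInstanceAs (Module.Finite S (Fin b → S))

theorem exists_hom_lift {b : ℕ} {a : Fin b → Fin r → ℤ} {A B : GrMod 𝒜} (f : Hom A B)
    (g : Hom (free 𝒜 a) B) (h : ∀ x, ∃ y, f.1 y = g.1 x) :
    ∃ g' : Hom (free 𝒜 a) A, ∀ x, f.1 (g'.1 x) = g.1 x := by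
  obtain ⟨g', hg'⟩ := exists_linear_lift f.1 g.1 h
  exact ⟨homogenize g', fun x => (comp_homogenize_eq g' f g (fun x => (hg' x).symm) x).symm⟩

theorem exists_free_cover (N : GrMod 𝒜) [Module.Finite S N.carrier] :
    ∃ (b : ℕ) (a : Fin b → Fin r → ℤ) (ε : Hom (free 𝒜 a) N), Function.Surjective ε.1 := by
  classical
  obtain ⟨T, hT⟩ := (Module.Finite.fg_top : (⊤ : Submodule S N.carrier).FG)
  choose s hs _ using N.exists_sum_proj
  let U : Finset ((Fin r → ℤ) × N.carrier) :=
    T.biUnion fun x => (s x).image fun n => (n, N.proj n x)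
  have hU : ∀ u ∈ U, u.2 ∈ N.gr u.1 := by
    intro u hu
    simp only [U, Finset.mem_biUnion, Finset.mem_image] at hu
    obtain ⟨x, -, n, -, rfl⟩ := hu
    exact N.proj_mem n x
  let e := U.equivFin
  -- The basis vector of `S(a)` has degree `-a`, whence the sign.
  let a : Fin U.card → Fin r → ℤ := fun q => -(e.symm q).1.1
  let g : Fin U.card → N.carrier := fun q => (e.symm q).1.2
  have hg : ∀ q, g q ∈ N.gr (-a q) := fun q => by
    rw [neg_neg]; exact hU _ (e.symm q).2
  let ε : (free 𝒜 a).carrier →ₗ[S] N.carrier := Fintype.linearCombination S g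
  refine ⟨U.card, a, ⟨ε, fun n x hx => ?_⟩, ?_⟩
  · change ∑ q, x q • g q ∈ N.gr n
    refine sum_mem fun q _ => ?_
    have := N.smul_mem _ _ _ _ (hx q) (hg q)
    rwa [add_neg_cancel_comm] at this
  · have hr : LinearMap.range (Fintype.linearCombination S g) = ⊤ := by
      rw [Fintype.range_linearCombination, eq_top_iff, ← hT, Submodule.span_le]
      intro x hx
      rw [SetLike.mem_coe, hs x]
      refine sum_mem fun n hn => Submodule.subset_span ?_
      have hmem : (n, N.proj n x) ∈ U := by
        simp only [U, Finset.mem_biUnion, Finset.mem_image]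
        exact ⟨x, hx, n, hn, rfl⟩
      exact ⟨e ⟨_, hmem⟩, by simp [g]⟩
    exact LinearMap.range_eq_top.1 hr

/-- Graded free resolutions with finitely generated terms. -/
structure FreeRes (M : GrMod 𝒜) where
  rank : ℕ → ℕ
  shift : ∀ p, Fin (rank p) → Fin r → ℤ
  ε : Hom (free 𝒜 (shift 0)) M
  δ : ∀ p, Hom (free 𝒜 (shift (p + 1))) (free 𝒜 (shift p))
  ε_surjective : Function.Surjective ε.1
  exact_zero : Function.Exact (δ 0).1 ε.1
  exact_succ : ∀ p, Function.Exact (δ (p + 1)).1 (δ p).1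

theorem exists_freeRes [IsNoetherianRing S] (M : GrMod 𝒜) [Module.Finite S M.carrier] :
    Nonempty (FreeRes M) := by
  choose b a ε hε using fun N : {N : GrMod 𝒜 // Module.Finite S N.carrier} =>
    haveI := N.2; exists_free_cover N.1
  let Z : ℕ → {N : GrMod 𝒜 // Module.Finite S N.carrier} := fun p => Nat.rec ⟨M, inferInstance⟩
    (fun _ N => ⟨sub _ (isGrSub_ker (ε N)),
      inferInstanceAs (Module.Finite S (LinearMap.ker (ε N).1))⟩) p
  let ι (p : ℕ) : Hom (Z (p + 1)).1 (free 𝒜 (a (Z p))) := subι _ (isGrSub_ker (ε (Z p)))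
  have hι (p : ℕ) : Function.Injective (ι p).1 := subι_injective _ (isGrSub_ker (ε (Z p)))
  have hιr (p : ℕ) (x : (free 𝒜 (a (Z p))).carrier) :
      (ε (Z p)).1 x = 0 ↔ ∃ y, (ι p).1 y = x :=
    ⟨fun h => ⟨⟨x, h⟩, rfl⟩, by rintro ⟨y, rfl⟩; exact y.2⟩
  refine ⟨⟨fun p => b (Z p), fun p => a (Z p), ε (Z 0), fun p => (ι p).comp (ε (Z (p + 1))),
    hε (Z 0), fun x => ?_, fun p x => ?_⟩⟩
  · rw [hιr 0]
    constructor
    · rintro ⟨y, rfl⟩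
      obtain ⟨z, rfl⟩ := hε _ y
      exact ⟨z, rfl⟩
    · rintro ⟨z, rfl⟩
      exact ⟨_, rfl⟩
  · rw [Hom.comp_apply, map_eq_zero_iff _ (hι p), hιr (p + 1)]
    constructor
    · rintro ⟨y, rfl⟩
      obtain ⟨z, rfl⟩ := hε _ y
      exact ⟨z, rfl⟩
    · rintro ⟨z, rfl⟩
      exact ⟨_, rfl⟩

namespace FreeRes

variable {L : GrMod 𝒜} (P : FreeRes L)

/-- The terms of a free resolution. -/
abbrev F (p : ℕ) : GrMod 𝒜 := free 𝒜 (P.shift p)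

theorem δ_δ (p : ℕ) (x : (P.F (p + 2)).carrier) : (P.δ p).1 ((P.δ (p + 1)).1 x) = 0 :=
  (P.exact_succ p _).2 ⟨x, rfl⟩

theorem ε_δ (x : (P.F 1).carrier) : P.ε.1 ((P.δ 0).1 x) = 0 :=
  (P.exact_zero _).2 ⟨x, rfl⟩

/-- Coboundaries in the complex of linear maps from a free resolution to a module. -/
def IsCob {X : Type u} [AddCommGroup X] [Module S X] :
    (i : ℕ) → ((P.F i).carrier →ₗ[S] X) → Prop
  | 0, φ => φ = 0
  | i + 1, φ => ∃ ψ : (P.F i).carrier →ₗ[S] X, ∀ x, φ x = ψ ((P.δ i).1 x)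

/-- Multiplication by `c` on the resolution lifts the zero map of `L`. -/
theorem exists_nullhomotopy (c : S) (hc : ∀ y : L.carrier, c • y = 0) :
    ∃ h : ∀ p, (P.F p).carrier →ₗ[S] (P.F (p + 1)).carrier,
      (∀ x, (P.δ 0).1 (h 0 x) = c • x) ∧
      ∀ p x, (P.δ (p + 1)).1 (h (p + 1) x) + h p ((P.δ p).1 x) = c • x := by
  obtain ⟨h₀, hh₀⟩ := exists_linear_lift (P.δ 0).1
    (LinearMap.lsmul S (P.F 0).carrier c) fun x => (P.exact_zero _).1 (by
      rw [LinearMap.lsmul_apply, map_smul, hc])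
  have step : ∀ (p : ℕ) (h : {h : (P.F p).carrier →ₗ[S] (P.F (p + 1)).carrier //
      ∀ x, (P.δ p).1 (h ((P.δ p).1 x)) = c • (P.δ p).1 x}),
      ∃ h' : {h' : (P.F (p + 1)).carrier →ₗ[S] (P.F (p + 1 + 1)).carrier //
        ∀ x, (P.δ (p + 1)).1 (h' ((P.δ (p + 1)).1 x)) = c • (P.δ (p + 1)).1 x},
      ∀ x, (P.δ (p + 1)).1 (h'.1 x) + h.1 ((P.δ p).1 x) = c • x := by
    intro p h
    obtain ⟨h', hh'⟩ := exists_linear_lift (P.δ (p + 1)).1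
      (LinearMap.lsmul S (P.F (p + 1)).carrier c - h.1 ∘ₗ (P.δ p).1) fun x =>
        (P.exact_succ p _).1 (by
          rw [LinearMap.sub_apply, LinearMap.lsmul_apply, LinearMap.comp_apply, map_sub, h.2,
            map_smul, sub_self])
    refine ⟨⟨h', fun x => ?_⟩, fun x => ?_⟩
    · rw [hh', LinearMap.sub_apply, LinearMap.lsmul_apply, LinearMap.comp_apply, P.δ_δ, map_zero,
        sub_zero]
    · rw [hh', LinearMap.sub_apply, LinearMap.lsmul_apply, LinearMap.comp_apply, sub_add_cancel]
  choose next hnext using step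
  let h : ∀ p, {h : (P.F p).carrier →ₗ[S] (P.F (p + 1)).carrier //
      ∀ x, (P.δ p).1 (h ((P.δ p).1 x)) = c • (P.δ p).1 x} :=
    fun p => Nat.rec ⟨h₀, fun x => hh₀ _⟩ (fun p h => next p h) p
  exact ⟨fun p => (h p).1, hh₀, fun p x => hnext p (h p) x⟩

/-- The annihilator of `L` annihilates `Ext^i(L, X)`: compose `φ` with the null-homotopy. -/
theorem isCob_smul_of_annihilates {X : Type u} [AddCommGroup X] [Module S X] {c : S}
    (hc : ∀ y : L.carrier, c • y = 0) {i : ℕ} (φ : (P.F i).carrier →ₗ[S] X)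
    (hφ : ∀ x, φ ((P.δ i).1 x) = 0) : P.IsCob i (c • φ) := by
  obtain ⟨h, h0, h1⟩ := P.exists_nullhomotopy c hc
  cases i with
  | zero =>
    refine LinearMap.ext fun x => ?_
    rw [LinearMap.smul_apply, ← map_smul, ← h0, hφ]; rfl
  | succ i =>
    refine ⟨φ ∘ₗ h i, fun x => ?_⟩
    rw [LinearMap.smul_apply, ← map_smul, ← h1, map_add, hφ, zero_add]; rfl

section Rees

variable {R : Type u} [CommRing R] [Algebra S R]

theorem isCob_smul {X : Type u} [AddCommGroup X] [Module S X] [Module R X] [IsScalarTower S R X]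
    (y : R) {i : ℕ} {φ : (P.F i).carrier →ₗ[S] X} (hφ : P.IsCob i φ) :
    P.IsCob i (((LinearMap.lsmul R X y).restrictScalars S) ∘ₗ φ) := by
  cases i with
  | zero =>
    have : φ = 0 := hφ
    rw [this]
    exact LinearMap.comp_zero _
  | succ i =>
    obtain ⟨ψ, hψ⟩ := hφ
    exact ⟨((LinearMap.lsmul R X y).restrictScalars S) ∘ₗ ψ, fun x => by
      rw [LinearMap.comp_apply, hψ]; rfl⟩

open scoped Pointwise in
theorem exists_quotSMulTop_mk {X : Type u} [AddCommGroup X] [Module S X] [Module R X]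
    [IsScalarTower S R X] (y : R) : ∃ π : X →ₗ[S] QuotSMulTop y X, Function.Surjective π ∧
      ∀ x, π x = 0 ↔ ∃ z, y • z = x := by
  let N : Submodule R X := y • (⊤ : Submodule R X)
  refine ⟨(N.mkQ).restrictScalars S, N.mkQ_surjective, fun x => ?_⟩
  change N.mkQ x = 0 ↔ _
  rw [Submodule.mkQ_apply, Submodule.Quotient.mk_eq_zero]
  constructor
  · rintro ⟨z, -, hz⟩
    exact ⟨z, hz⟩
  · rintro ⟨z, hz⟩
    exact ⟨z, trivial, hz⟩

/-- From `0 → X → X → X/yX → 0` with first map multiplication by `y`: it is injective on `Ext^i(L,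
X)` as soon as `Ext^{i-1}(L, X/yX) = 0`. -/
theorem isCob_of_smul_isCob {X : Type u} [AddCommGroup X] [Module S X] [Module R X]
    [IsScalarTower S R X] {y : R} (hy : IsSMulRegular X y) {i : ℕ}
    (hX : ∀ i', i = i' + 1 → ∀ φ : (P.F i').carrier →ₗ[S] QuotSMulTop y X,
      (∀ x, φ ((P.δ i').1 x) = 0) → P.IsCob i' φ)
    {φ : (P.F i).carrier →ₗ[S] X}
    (h : P.IsCob i (((LinearMap.lsmul R X y).restrictScalars S) ∘ₗ φ)) : P.IsCob i φ := by
  have hinj : ∀ a b : X, y • a = y • b → a = b := fun a b hab => hy hab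
  cases i with
  | zero =>
    refine LinearMap.ext fun x => hinj _ _ ?_
    have h' : ((LinearMap.lsmul R X y).restrictScalars S) ∘ₗ φ = 0 := h
    have := LinearMap.congr_fun h' x
    exact this.trans (smul_zero y).symm
  | succ i =>
    obtain ⟨ψ, hψ⟩ := h
    replace hψ : ∀ x, y • φ x = ψ ((P.δ i).1 x) := hψ
    obtain ⟨π, hπ, hπ0⟩ := exists_quotSMulTop_mk (S := S) (X := X) y
    have hcob := hX i rfl (π ∘ₗ ψ) fun x => by
      rw [LinearMap.comp_apply, ← hψ]
      exact (hπ0 _).2 ⟨_, rfl⟩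
    -- Correct `ψ` by a coboundary so that its values lie in `yX`, without changing its composite
    -- with `δ`; dividing by `y` then gives a primitive of `φ`.
    obtain ⟨ψ₁, hψ₁, hψ₁'⟩ : ∃ ψ₁ : (P.F i).carrier →ₗ[S] X, (∀ x, π (ψ₁ x) = 0) ∧
        ∀ x, ψ₁ ((P.δ i).1 x) = ψ ((P.δ i).1 x) := by
      cases i with
      | zero => exact ⟨ψ, LinearMap.congr_fun (show _ = _ from hcob), fun _ => rfl⟩
      | succ i =>
        obtain ⟨χ, hχ⟩ := hcob
        obtain ⟨χ', hχ'⟩ := exists_linear_lift π χ fun x => hπ _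
        refine ⟨ψ - χ' ∘ₗ (P.δ i).1, fun x => ?_, fun x => ?_⟩
        · rw [LinearMap.sub_apply, LinearMap.comp_apply, map_sub, hχ', ← hχ, LinearMap.comp_apply,
            sub_self]
        · rw [LinearMap.sub_apply, LinearMap.comp_apply, P.δ_δ, map_zero, sub_zero]
    obtain ⟨ψ₂, hψ₂⟩ := exists_linear_lift ((LinearMap.lsmul R X y).restrictScalars S) ψ₁
      fun x => (hπ0 _).1 (hψ₁ x)
    refine ⟨ψ₂, fun x => hinj _ _ ?_⟩
    rw [hψ, ← hψ₁', ← hψ₂]; rfl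

/-- Rees' induction on the sequence: the first element acts injectively on `Ext^i(L, X)`, because
`Ext^{i-1}(L, X/yX)` vanishes, and nilpotently, because a power of it is a multiple of an
annihilator of `L`. The sequence may live in an `S`-algebra `R`, so `L` and its resolution need not
be localized. -/
theorem isCob_of_isWeaklyRegular (rs : List R)
    (hrs : ∀ y ∈ rs, ∃ (t : ℕ) (c : S) (w : R),
      (∀ z : L.carrier, c • z = 0) ∧ y ^ t = w * algebraMap S R c) :
    ∀ (X : Type u) [AddCommGroup X] [Module S X] [Module R X] [IsScalarTower S R X],
      RingTheory.Sequence.IsWeaklyRegular X rs → ∀ i < rs.length,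
      ∀ φ : (P.F i).carrier →ₗ[S] X, (∀ x, φ ((P.δ i).1 x) = 0) → P.IsCob i φ := by
  induction rs with
  | nil => intro X _ _ _ _ _ i hi; exact absurd hi (Nat.not_lt_zero i)
  | cons y rs ih =>
    intro X _ _ _ _ hreg i hi φ hφ
    rw [RingTheory.Sequence.isWeaklyRegular_cons_iff] at hreg
    obtain ⟨t, c, w, hc, hyt⟩ := hrs y List.mem_cons_self
    have key : ∀ t : ℕ, P.IsCob i (((LinearMap.lsmul R X (y ^ t)).restrictScalars S) ∘ₗ φ) →
        P.IsCob i φ := by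
      intro t
      induction t with
      | zero =>
        intro h
        have : ((LinearMap.lsmul R X (y ^ 0)).restrictScalars S) ∘ₗ φ = φ :=
          LinearMap.ext fun x => by
            change y ^ 0 • φ x = φ x
            rw [pow_zero, one_smul]
        rwa [this] at h
      | succ t iht =>
        intro h
        apply iht
        refine P.isCob_of_smul_isCob hreg.1 (fun i' hi' φ' hφ' =>
          ih (fun z hz => hrs z (List.mem_cons_of_mem _ hz)) _ hreg.2 i'
            (by subst hi'; simpa using hi) φ' hφ') ?_
        have : ((LinearMap.lsmul R X y).restrictScalars S) ∘ₗ
            ((LinearMap.lsmul R X (y ^ t)).restrictScalars S) ∘ₗ φ =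
            ((LinearMap.lsmul R X (y ^ (t + 1))).restrictScalars S) ∘ₗ φ :=
          LinearMap.ext fun x => by
            change y • y ^ t • φ x = y ^ (t + 1) • φ x
            rw [smul_smul, pow_succ']
        rwa [this]
    refine key t ?_
    have h1 := P.isCob_smul w (P.isCob_smul_of_annihilates hc φ hφ)
    have : ((LinearMap.lsmul R X w).restrictScalars S) ∘ₗ (c • φ) =
        ((LinearMap.lsmul R X (y ^ t)).restrictScalars S) ∘ₗ φ :=
      LinearMap.ext fun x => by
        change w • c • φ x = y ^ t • φ x
        rw [hyt, mul_smul, algebraMap_smul]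
    rwa [this] at h1

end Rees

/-- Rees' vanishing holds for maps into the localization. It descends to `S` because a module killed
by a power of the maximal ideal `I` has Ext groups on which elements outside `I` act invertibly. -/
theorem isCob_of_localization {I : Ideal S} [I.IsMaximal] {t : ℕ}
    (hI : ∀ c ∈ I ^ t, ∀ z : L.carrier, c • z = 0)
    (hreg : ∀ s, s ∉ I → ∀ x : S, s * x = 0 → x = 0)
    (rs : List (Localization.AtPrime I))
    (hrs : ∀ y ∈ rs, y ∈ IsLocalRing.maximalIdeal (Localization.AtPrime I))
    (hrs' : RingTheory.Sequence.IsWeaklyRegular (Localization.AtPrime I) rs)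
    {i : ℕ} (hi : i < rs.length) (φ : (P.F i).carrier →ₗ[S] S)
    (hφ : ∀ x, φ ((P.δ i).1 x) = 0) : P.IsCob i φ := by
  let R := Localization.AtPrime I
  have hinj : Function.Injective (algebraMap S R) := by
    refine IsLocalization.injective R (M := I.primeCompl) fun s hs => ?_
    rw [mem_nonZeroDivisors_iff]
    exact ⟨hreg s hs, fun x hx => hreg s hs x (by rwa [mul_comm])⟩
  have hcob : P.IsCob i ((Algebra.linearMap S R) ∘ₗ φ) := by
    refine P.isCob_of_isWeaklyRegular rs (fun y hy => ?_) R hrs' i hi _ fun x => by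
      rw [LinearMap.comp_apply, hφ, map_zero]
    have hy' := hrs y hy
    rw [← Localization.AtPrime.map_eq_maximalIdeal,
      IsLocalization.mem_map_algebraMap_iff I.primeCompl] at hy'
    obtain ⟨⟨⟨c, hc⟩, ⟨s, hs⟩⟩, hcs⟩ := hy'
    have hu : IsUnit (algebraMap S R s) := IsLocalization.map_units R (⟨s, hs⟩ : I.primeCompl)
    obtain ⟨w, hw⟩ := hu.exists_left_inv
    refine ⟨t, c ^ t, w ^ t, hI _ (Ideal.pow_mem_pow hc t), ?_⟩
    rw [map_pow, ← mul_pow]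
    congr 1
    change y * algebraMap S R s = algebraMap S R c at hcs
    rw [← hcs, mul_comm y, ← mul_assoc, hw, one_mul]
  cases i with
  | zero =>
    refine LinearMap.ext fun x => hinj ?_
    have := LinearMap.congr_fun (show _ = _ from hcob) x
    exact this.trans (map_zero _).symm
  | succ i =>
    obtain ⟨ψ, hψ⟩ := hcob
    -- The term of the resolution is free of finite rank, so a single `s` outside `I` clears the
    -- denominators of `ψ`.
    obtain ⟨s, hs⟩ := IsLocalization.exist_integer_multiples_of_finite I.primeCompl
      (fun q : Fin (P.rank i) => ψ (Pi.single q (1 : S) : Fin (P.rank i) → S))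
    choose g hg using hs
    let ψ₀ : (P.F i).carrier →ₗ[S] S := Fintype.linearCombination S g
    have hψ₀ : ∀ x, algebraMap S R (ψ₀ x) = (s : S) • ψ x := by
      intro x
      have h1 : (Algebra.linearMap S R) ∘ₗ (Fintype.linearCombination S g) =
          (s : S) • (show (Fin (P.rank i) → S) →ₗ[S] R from ψ) := by
        refine LinearMap.pi_ext fun q c => ?_
        have h2 : (Pi.single q c : Fin (P.rank i) → S) = c • Pi.single q (1 : S) := by
          rw [← Pi.single_smul, smul_eq_mul, mul_one]
        rw [h2, map_smul, map_smul]
        congr 1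
        rw [LinearMap.comp_apply, Fintype.linearCombination_apply_single, one_smul]
        exact hg q
      exact LinearMap.congr_fun h1 x
    -- The ideal of those `c` for which `c • φ` is a coboundary contains `s ∉ I` and `I ^ t`, so it
    -- is the unit ideal.
    let J : Ideal S :=
      { carrier := {c | P.IsCob (i + 1) (c • φ)}
        zero_mem' := ⟨0, fun x => by rw [zero_smul]; rfl⟩
        add_mem' := by
          rintro a b ⟨ψa, ha⟩ ⟨ψb, hb⟩
          exact ⟨ψa + ψb, fun x => by
            rw [add_smul, LinearMap.add_apply, ha, hb, LinearMap.add_apply]⟩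
        smul_mem' := by
          rintro c a ⟨ψa, ha⟩
          exact ⟨c • ψa, fun x => by
            rw [smul_eq_mul, mul_smul, LinearMap.smul_apply, ha, LinearMap.smul_apply]⟩ }
    have hJs : (s : S) ∈ J := ⟨ψ₀, fun x => hinj (by
      rw [hψ₀, ← hψ, LinearMap.smul_apply, smul_eq_mul, map_mul, Algebra.smul_def]; rfl)⟩
    have hJI : I ^ t ≤ J := fun c hc => P.isCob_smul_of_annihilates (hI c hc) φ hφ
    have hJ : J = ⊤ := by
      have h1 : I ⊔ J = ⊤ := (Ideal.isMaximal_def.1 inferInstance).2 _ (lt_of_le_of_ne le_sup_left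
        fun h => s.2 (h.symm.le (Ideal.mem_sup_right hJs)))
      rw [← sup_eq_right.2 hJI]
      exact Ideal.pow_sup_eq_top h1
    have h1 : (1 : S) ∈ J := hJ ▸ trivial
    obtain ⟨ψ', hψ'⟩ : P.IsCob (i + 1) ((1 : S) • φ) := h1
    exact ⟨ψ', fun x => by rw [← hψ', one_smul]⟩

end FreeRes

end FreeRes

end GrMod

/-! ### The homogeneous maximal ideal, cosyzygies, and vanishing below the depth. -/

namespace GrMod

open InjRes

variable {r : ℕ} {S : Type u} [CommRing S] {𝒜 : (Fin r → ℤ) → AddSubgroup S}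

section CosyzygyDefinition

variable {N : GrMod 𝒜} (R : InjRes N)

/-- The cosyzygies of an injective resolution. -/
noncomputable def InjRes.cosyz : ℕ → GrMod 𝒜
  | 0 => N
  | p + 1 => sub _ (isGrSub_ker (R.δh (p + 1)))

/-- The inclusion of the cosyzygies. -/
noncomputable def InjRes.cosyzι : ∀ p, Hom (R.cosyz p) (R.I p)
  | 0 => R.εh
  | p + 1 => subι _ (isGrSub_ker (R.δh (p + 1)))

/-- The differentials as maps to the cosyzygies. -/
noncomputable def InjRes.cosyzπ (p : ℕ) : Hom (R.I p) (R.cosyz (p + 1)) :=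
  subLift _ (isGrSub_ker (R.δh (p + 1))) (R.δh p) (R.δ_δ p)

theorem InjRes.isShortExact_cosyz (p : ℕ) : IsShortExact (R.cosyzι p) (R.cosyzπ p) where
  injective := by
    cases p with
    | zero => exact R.ε_injective
    | succ p => exact subι_injective _ (isGrSub_ker (R.δh (p + 1)))
  surjective y := by
    obtain ⟨x, hx⟩ := (R.exact_succ p _).1 y.2
    exact ⟨x, Subtype.ext hx⟩
  exact x := by
    have h1 : (R.cosyzπ p).1 x = 0 ↔ R.δ p x = 0 :=
      ⟨fun h => congrArg Subtype.val h, fun h => Subtype.ext h⟩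
    rw [h1]
    cases p with
    | zero => exact R.exact_zero x
    | succ p => exact ⟨fun h => ⟨⟨x, h⟩, rfl⟩, by rintro ⟨y, rfl⟩; exact y.2⟩

end CosyzygyDefinition

variable [GradedRing 𝒜]

section MaxIdeal

/-- The elements of a graded module with no component of weight less than `w`. -/
def weightGE (hN : ∀ n : Fin r → ℤ, ¬ 0 ≤ n → 𝒜 n = ⊥) (M : GrMod 𝒜) (w : ℤ) :
    Submodule S M.carrier where
  carrier := {x | ∀ n, weight n < w → M.proj n x = 0}
  zero_mem' n _ := map_zero _
  add_mem' hx hy n hn := by rw [map_add, hx n hn, hy n hn, add_zero]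
  smul_mem' c x hx n hn := by
    induction c using DirectSum.Decomposition.inductionOn 𝒜 with
    | zero => rw [zero_smul, map_zero]
    | @homogeneous m c =>
      by_cases h : 0 ≤ m
      · rw [← add_sub_cancel m n, M.smul_proj c.2, hx, smul_zero]
        have h1 : weight n = weight m + weight (n - m) := by rw [← weight_add, add_sub_cancel]
        have h2 : 0 ≤ weight m := Finset.sum_nonneg fun i _ => h i
        omega
      · have : (c : S) = 0 := (AddSubgroup.mem_bot).1 (hN m h ▸ c.2)
        rw [this, zero_smul, map_zero]
    | add a b ha hb => rw [add_smul, map_add, ha, hb, add_zero]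

variable (hN : ∀ n : Fin r → ℤ, ¬ 0 ≤ n → 𝒜 n = ⊥)

theorem smul_mem_weightGE_succ (M : GrMod 𝒜) {w : ℤ} {a : S} (ha : a ∈ maxIdeal 𝒜)
    {x : M.carrier} (hx : x ∈ weightGE hN M w) : a • x ∈ weightGE hN M (w + 1) := by
  induction ha using Submodule.span_induction with
  | mem a ha =>
    obtain ⟨m, hm, ha⟩ := ha
    intro n hn
    by_cases h : 0 ≤ m
    · rw [← add_sub_cancel m n, M.smul_proj ha, hx, smul_zero]
      have h1 : weight n = weight m + weight (n - m) := by rw [← weight_add, add_sub_cancel]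
      have h2 := weight_pos h hm
      omega
    · have : a = 0 := (AddSubgroup.mem_bot).1 (hN m h ▸ ha)
      rw [this, zero_smul, map_zero]
  | zero => rw [zero_smul]; exact zero_mem _
  | add a b _ _ ha hb => rw [add_smul]; exact add_mem ha hb
  | smul c a _ ha => rw [smul_eq_mul, mul_smul]; exact Submodule.smul_mem _ _ ha

theorem exists_mem_weightGE (M : GrMod 𝒜) (x : M.carrier) : ∃ w, x ∈ weightGE hN M w := by
  obtain ⟨s, -, hs⟩ := M.exists_sum_proj x
  obtain ⟨w, hw⟩ := (s.image weight).bddBelow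
  refine ⟨w, fun n hn => hs n fun h => ?_⟩
  exact absurd (hw (Finset.mem_coe.2 (Finset.mem_image_of_mem weight h))) (not_le.2 hn)

theorem eq_zero_of_forall_mem_weightGE (M : GrMod 𝒜) {x : M.carrier}
    (h : ∀ w, x ∈ weightGE hN M w) : x = 0 :=
  M.ext_proj fun n => by rw [h (weight n + 1) n (by omega), map_zero]

variable {k : Type v} [Field k] [Algebra k S]

theorem exists_algebraMap_sub_mem_maxIdeal
    (h0 : ∀ x : S, x ∈ 𝒜 0 ↔ ∃ c : k, algebraMap k S c = x) (s : S) :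
    ∃ c : k, s - algebraMap k S c ∈ maxIdeal 𝒜 := by
  induction s using DirectSum.Decomposition.inductionOn 𝒜 with
  | zero => exact ⟨0, by rw [map_zero, sub_zero]; exact zero_mem _⟩
  | @homogeneous m a =>
    by_cases h : m = 0
    · subst h
      obtain ⟨c, hc⟩ := (h0 _).1 a.2
      exact ⟨c, by rw [hc, sub_self]; exact zero_mem _⟩
    · exact ⟨0, by rw [map_zero, sub_zero]; exact mem_maxIdeal a.2 h⟩
  | add a b ha hb =>
    obtain ⟨c, hc⟩ := ha
    obtain ⟨c', hc'⟩ := hb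
    exact ⟨c + c', by rw [map_add, add_sub_add_comm]; exact add_mem hc hc'⟩

theorem one_notMem_maxIdeal [Nontrivial S] (hN : ∀ n : Fin r → ℤ, ¬ 0 ≤ n → 𝒜 n = ⊥) :
    (1 : S) ∉ maxIdeal 𝒜 := by
  intro h
  have h1 : (1 : S) ∈ 𝒜 0 := SetLike.GradedOne.one_mem
  have h2 : (1 : S) ∈ weightGE hN (self 𝒜) 0 := fun n hn =>
    (self 𝒜).proj_of_mem_ne h1 fun h => by
      rw [← h] at hn; exact absurd hn (by simp [weight])
  have h3 := smul_mem_weightGE_succ hN (self 𝒜) h h2 0 (by simp [weight])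
  have h4 : (self 𝒜).proj 0 ((1 : S) • (1 : S) : S) = (1 : S) := by
    rw [one_smul]; exact (self 𝒜).proj_of_mem h1
  exact (one_ne_zero : (1 : S) ≠ 0) (h4.symm.trans h3)

theorem isMaximal_maxIdeal [Nontrivial S] (hN : ∀ n : Fin r → ℤ, ¬ 0 ≤ n → 𝒜 n = ⊥)
    (h0 : ∀ x : S, x ∈ 𝒜 0 ↔ ∃ c : k, algebraMap k S c = x) : (maxIdeal 𝒜).IsMaximal := by
  refine Ideal.isMaximal_iff.2 ⟨one_notMem_maxIdeal hN, fun J x hJ hx hxJ => ?_⟩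
  obtain ⟨c, hc⟩ := exists_algebraMap_sub_mem_maxIdeal h0 x
  have hc0 : c ≠ 0 := fun h => hx (by rwa [h, map_zero, sub_zero] at hc)
  have h1 : algebraMap k S c ∈ J := by
    have := J.sub_mem hxJ (hJ hc)
    rwa [sub_sub_cancel] at this
  have h2 := J.mul_mem_left (algebraMap k S c⁻¹) h1
  rwa [← map_mul, inv_mul_cancel₀ hc0, map_one] at h2

/-- A Nakayama argument: `s` is a nonzero constant plus an element of `𝓜`, so `s • x = 0` gives `x ∈
𝓜 x`. Then `x` lies in every step of the weight filtration, which is separated. For `M = S` it shows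
that `S` embeds in its localization at `𝓜`. -/
theorem eq_zero_of_smul_eq_zero_of_notMem (hN : ∀ n : Fin r → ℤ, ¬ 0 ≤ n → 𝒜 n = ⊥)
    (h0 : ∀ x : S, x ∈ 𝒜 0 ↔ ∃ c : k, algebraMap k S c = x) (M : GrMod 𝒜) {s : S}
    (hs : s ∉ maxIdeal 𝒜) {x : M.carrier} (hx : s • x = 0) : x = 0 := by
  obtain ⟨c, hc⟩ := exists_algebraMap_sub_mem_maxIdeal h0 s
  have hc0 : c ≠ 0 := fun h => hs (by rwa [h, map_zero, sub_zero] at hc)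
  have hu : IsUnit (algebraMap k S c) := (IsUnit.mk0 c hc0).map _
  obtain ⟨w, hw⟩ := hu.exists_left_inv
  have hx' : x = (-w * (s - algebraMap k S c)) • x := by
    rw [mul_smul, sub_smul, hx, zero_sub, smul_neg, neg_smul, neg_neg, smul_smul, hw, one_smul]
  have hm : -w * (s - algebraMap k S c) ∈ maxIdeal 𝒜 := Ideal.mul_mem_left _ _ hc
  have step : ∀ w, x ∈ weightGE hN M w → x ∈ weightGE hN M (w + 1) := fun w h => by
    rw [hx']; exact smul_mem_weightGE_succ hN M hm h
  obtain ⟨w₀, hw₀⟩ := exists_mem_weightGE hN M x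
  refine eq_zero_of_forall_mem_weightGE hN M fun w n hn => ?_
  have h1 : ∀ t : ℕ, x ∈ weightGE hN M (w₀ + t) := fun t => by
    induction t with
    | zero => simpa using hw₀
    | succ t ih => rw [Nat.cast_succ, ← add_assoc]; exact step _ ih
  exact h1 (w - w₀).toNat n (by omega)

end MaxIdeal

section Cosyzygy

namespace FreeRes

variable {L : GrMod 𝒜} (P : FreeRes L)

/-- The vanishing of the graded `Ext` group of index `i + 1`, computed by a free resolution. -/
def ExtSuccVanishes (i : ℕ) (N : GrMod 𝒜) : Prop :=
  ∀ φ : Hom (P.F (i + 1)) N, (∀ x, φ.1 ((P.δ (i + 1)).1 x) = 0) →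
    ∃ ψ : Hom (P.F i) N, ∀ x, φ.1 x = ψ.1 ((P.δ i).1 x)

variable {P} {A E B : GrMod 𝒜} {f : Hom A E} {g : Hom E B}

/-- Lift the cocycle to a cochain in `E`; its coboundary is a cocycle in `A`, and a primitive there
corrects the lift. -/
theorem exists_lift_of_extSuccVanishes (h : IsShortExact f g) {i : ℕ}
    (hA : P.ExtSuccVanishes i A) (φ : Hom (P.F i) B) (hφ : ∀ x, φ.1 ((P.δ i).1 x) = 0) :
    ∃ χ : Hom (P.F i) E, (∀ x, g.1 (χ.1 x) = φ.1 x) ∧ ∀ x, χ.1 ((P.δ i).1 x) = 0 := by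
  obtain ⟨φ', hφ'⟩ := exists_hom_lift g φ fun x => h.surjective _
  obtain ⟨χ, hχ⟩ := exists_hom_lift f (φ'.comp (P.δ i)) fun x => (h.exact _).1 (by
    rw [Hom.comp_apply, hφ', hφ])
  obtain ⟨ψ, hψ⟩ := hA χ fun x => h.injective (by
    rw [hχ, Hom.comp_apply, P.δ_δ, map_zero, map_zero])
  refine ⟨φ' - f.comp ψ, fun x => ?_, fun x => ?_⟩
  · rw [Hom.sub_apply, map_sub, hφ', Hom.comp_apply, (h.exact _).2 ⟨_, rfl⟩, sub_zero]
  · rw [Hom.sub_apply, Hom.comp_apply, ← hψ, hχ, Hom.comp_apply, sub_self]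

/-- Dimension shifting: for injective `E` the group `Ext^{i+1}(L, B)` is `Ext^{i+2}(L, A)`. Here the
cocycle lifted to `E` is already a coboundary. -/
theorem ExtSuccVanishes.of_isShortExact (h : IsShortExact f g) (hE : E.IsInjective) {i : ℕ}
    (hA : P.ExtSuccVanishes (i + 1) A) : P.ExtSuccVanishes i B := by
  intro φ hφ
  obtain ⟨χ, hχ, hχ'⟩ := exists_lift_of_extSuccVanishes h hA φ hφ
  obtain ⟨w, hw⟩ := hE.exists_extension (P.δ i) χ fun x hx => by
    obtain ⟨y, rfl⟩ := (P.exact_succ i x).1 hx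
    exact hχ' y
  exact ⟨g.comp w, fun x => by rw [Hom.comp_apply, hw, hχ]⟩

/-- The bottom of the dimension shift: `Ext^1(L, A) = 0` makes `Hom(L, E) → Hom(L, B)` surjective.
-/
theorem ExtSuccVanishes.exists_lift (h : IsShortExact f g) (hE : E.IsInjective)
    (hA : P.ExtSuccVanishes 0 A) (φ : Hom L B) : ∃ w : Hom L E, ∀ x, g.1 (w.1 x) = φ.1 x := by
  obtain ⟨χ, hχ, hχ'⟩ := exists_lift_of_extSuccVanishes h hA (φ.comp P.ε) fun x => by
    rw [Hom.comp_apply, P.ε_δ, map_zero]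
  obtain ⟨w, hw⟩ := hE.exists_extension P.ε χ fun x hx => by
    obtain ⟨y, rfl⟩ := (P.exact_zero x).1 hx
    exact hχ' y
  refine ⟨w, fun x => ?_⟩
  obtain ⟨y, rfl⟩ := P.ε_surjective x
  rw [hw, hχ]; rfl

end FreeRes

variable {N : GrMod 𝒜} (R : InjRes N)

theorem InjRes.extSuccVanishes_cosyz {L : GrMod 𝒜} {P : FreeRes L} {i p : ℕ}
    (h : P.ExtSuccVanishes (i + p) N) : P.ExtSuccVanishes i (R.cosyz p) := by
  induction p generalizing i with
  | zero => exact h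
  | succ p ih =>
    exact (ih (i := i + 1) (by rwa [add_right_comm])).of_isShortExact (R.isShortExact_cosyz p)
      (R.inj p)

/-- Local cohomology vanishes when the graded `Ext` groups of torsion modules do. -/
theorem InjRes.mem_coboundaries_of_extSuccVanishes [IsNoetherianRing S] {i : ℕ}
    (h : ∀ (L : GrMod 𝒜) (P : FreeRes L), (∃ t : ℕ, ∀ c ∈ maxIdeal 𝒜 ^ t, ∀ z : L.carrier,
      c • z = 0) → P.ExtSuccVanishes i N)
    {n : Fin r → ℤ} {z : (R.I (i + 1)).carrier} (hz : z ∈ R.cocycles (i + 1) n) :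
    z ∈ R.coboundaries (i + 1) n := by
  obtain ⟨t, ht⟩ := hz.1.2
  -- The cocycle generates a finite torsion module `L` inside the cosyzygy of index `i + 1`.
  let K : Submodule S (R.I (i + 1)).carrier := Submodule.span S {z}
  have hK : (R.I (i + 1)).IsGrSub K := isGrSub_span hz.1.1
  have : Module.Finite S (sub K hK).carrier := inferInstanceAs (Module.Finite S K)
  obtain ⟨P⟩ := exists_freeRes (sub K hK)
  have hP := h _ P ⟨t, fun c hc y => Subtype.ext <| by
    obtain ⟨b, hb⟩ := Submodule.mem_span_singleton.1 y.2
    change c • y.1 = 0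
    rw [← hb, smul_comm, ht c hc, smul_zero]⟩
  have hKker : ∀ y : (sub K hK).carrier, R.δ (i + 1) y.1 = 0 := fun y => by
    obtain ⟨b, hb⟩ := Submodule.mem_span_singleton.1 y.2
    rw [← hb, map_smul, hz.2, smul_zero]
  -- Lifting the inclusion of `L` to the `i`-th injective provides a preimage of `z`, torsion
  -- because it is the image of an element of the torsion module `L`.
  obtain ⟨w, hw⟩ := (R.extSuccVanishes_cosyz (i := 0) (p := i) (by rwa [zero_add])).exists_lift
    (R.isShortExact_cosyz i) (R.inj i) (subLift _ (isGrSub_ker (R.δh (i + 1))) (subι K hK) hKker)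
  let z' : (sub K hK).carrier := ⟨z, Submodule.mem_span_singleton_self z⟩
  have hz' : z' ∈ (sub K hK).gr n := hz.1.1
  refine ⟨w.1 z', ⟨w.mem hz', w.map_gammaTorsion _ ⟨t, fun c hc => Subtype.ext (ht c hc)⟩⟩, ?_⟩
  exact congrArg Subtype.val (hw z')

variable {k : Type v} [Field k] [Algebra k S]

/-- Local cohomology of the graded ring vanishes below the length of a regular sequence in the
localization at the homogeneous maximal ideal. -/
theorem subsingleton_H_self_of_lt [IsNoetherianRing S]
    (hN : ∀ n : Fin r → ℤ, ¬ 0 ≤ n → 𝒜 n = ⊥)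
    (h0 : ∀ x : S, x ∈ 𝒜 0 ↔ ∃ c : k, algebraMap k S c = x) [(maxIdeal 𝒜).IsMaximal]
    (rs : List (Localization.AtPrime (maxIdeal 𝒜)))
    (hrs : ∀ y ∈ rs, y ∈ IsLocalRing.maximalIdeal (Localization.AtPrime (maxIdeal 𝒜)))
    (hrs' : RingTheory.Sequence.IsWeaklyRegular (Localization.AtPrime (maxIdeal 𝒜)) rs)
    (ρ : ∀ N : GrMod 𝒜, InjRes N) {i : ℕ} (hi : i < rs.length) (n : Fin r → ℤ) :
    Subsingleton (H ρ (self 𝒜) i n) := by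
  have hreg : ∀ s, s ∉ maxIdeal 𝒜 → ∀ x : S, s * x = 0 → x = 0 := fun s hs x hx =>
    eq_zero_of_smul_eq_zero_of_notMem hN h0 (self 𝒜) hs hx
  rw [← not_nontrivial_iff_subsingleton]
  cases i with
  | zero =>
    rw [nontrivial_cohomology_zero_iff]
    rintro ⟨z, hz, hz0, t, ht⟩
    -- A nonzero torsion element would give a nonzero inclusion in `Hom(L, S) = Ext^0(L, S)`, which
    -- vanishes.
    let K : Submodule S (self 𝒜).carrier := Submodule.span S {z}
    have hK : (self 𝒜).IsGrSub K := isGrSub_span hz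
    have : Module.Finite S (sub K hK).carrier := inferInstanceAs (Module.Finite S K)
    obtain ⟨P⟩ := exists_freeRes (sub K hK)
    have h1 : P.IsCob 0 ((subι K hK).comp P.ε).1 :=
      P.isCob_of_localization (t := t) (fun c hc y => Subtype.ext <| by
        obtain ⟨b, hb⟩ := Submodule.mem_span_singleton.1 y.2
        change c • y.1 = 0
        rw [← hb, smul_comm, ht c hc, smul_zero]) hreg rs hrs hrs' hi _ fun x =>
          congrArg Subtype.val (P.ε_δ x)
    obtain ⟨y, hy⟩ := P.ε_surjective ⟨z, Submodule.mem_span_singleton_self z⟩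
    have h2 : ((subι K hK).comp P.ε).1 = 0 := h1
    have h3 := LinearMap.congr_fun h2 y
    rw [Hom.comp_apply, hy] at h3
    exact hz0 h3
  | succ i =>
    rw [nontrivial_iff_exists]
    rintro ⟨z, hz, hz'⟩
    refine hz' ((ρ (self 𝒜)).mem_coboundaries_of_extSuccVanishes ?_ hz)
    rintro L P ⟨t, ht⟩ φ hφ
    obtain ⟨ψ, hψ⟩ : P.IsCob (i + 1) φ.1 :=
      P.isCob_of_localization ht hreg rs hrs hrs' hi φ.1 hφ
    exact ⟨homogenize ψ, homogenize_comp_eq ψ (P.δ i) φ hψ⟩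

end Cosyzygy

end GrMod

/-! ### The height of the homogeneous maximal ideal. -/

namespace GrMod

section PolynomialHeight

attribute [local instance] Polynomial.algebra Polynomial.isLocalization in
-- Localize at the contraction `p`: the height of `Q` is at most `dim R_p[X] = dim R_p + 1`.
theorem height_le_height_comap_C_add_one {R : Type*} [CommRing R] [IsNoetherianRing R]
    (Q : Ideal (Polynomial R)) [Q.IsPrime] : Q.height ≤ (Q.comap Polynomial.C).height + 1 := by
  let p : Ideal R := Q.comap Polynomial.C
  have hp : p.IsPrime := Ideal.comap_isPrime _ _
  let Rp := Localization.AtPrime p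
  have disj : Disjoint (p.primeCompl.map Polynomial.C : Set (Polynomial R)) Q := by
    refine Set.disjoint_left.mpr ?_
    rintro _ ⟨b, hb, rfl⟩ ha
    exact hb ha
  have h1 : (Q.map (algebraMap (Polynomial R) (Polynomial Rp))).height = Q.height :=
    IsLocalization.height_map_of_disjoint (Submonoid.map Polynomial.C p.primeCompl) Q disj
  have h2 : (Q.map (algebraMap (Polynomial R) (Polynomial Rp))).IsPrime :=
    IsLocalization.isPrime_of_isPrime_disjoint (Submonoid.map Polynomial.C p.primeCompl) _ Q
      inferInstance disj
  have h3 := Ideal.height_le_ringKrullDim_of_isPrime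
    (I := Q.map (algebraMap (Polynomial R) (Polynomial Rp)))
  rw [h1, Polynomial.ringKrullDim_of_isNoetherianRing,
    IsLocalization.AtPrime.ringKrullDim_eq_height p Rp] at h3
  exact_mod_cast h3

end PolynomialHeight

variable {r : ℕ} {S : Type u} [CommRing S] (𝒜 : (Fin r → ℤ) → AddSubgroup S) [GradedRing 𝒜]

/-- The coaction of the weight grading, which sends `a` in `𝒜 n` to `a T^{-|n|}`. -/
noncomputable def coaction : S →+* AddMonoidAlgebra S ℤ :=
  (DirectSum.toSemiring (A := fun n => 𝒜 n)
    (fun n => (AddMonoidAlgebra.singleAddHom (-weight n)).comp (𝒜 n).subtype)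
    (by
      change AddMonoidAlgebra.single (-weight 0) (1 : S) = 1
      rw [AddMonoidAlgebra.one_def]
      simp [weight])
    (fun {m n} a b => by
      change AddMonoidAlgebra.single (-weight (m + n)) ((a : S) * b) =
        AddMonoidAlgebra.single (-weight m) (a : S) * AddMonoidAlgebra.single (-weight n) (b : S)
      rw [AddMonoidAlgebra.single_mul_single, weight_add, neg_add])).comp
    (DirectSum.decomposeRingEquiv 𝒜).toRingHom

theorem coaction_of_mem {n : Fin r → ℤ} {a : S} (ha : a ∈ 𝒜 n) :
    coaction 𝒜 a = AddMonoidAlgebra.single (-weight n) a := by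
  have h1 : DirectSum.decomposeRingEquiv 𝒜 a = DirectSum.of (fun n => 𝒜 n) n ⟨a, ha⟩ :=
    DirectSum.decompose_of_mem 𝒜 ha
  rw [coaction, RingHom.comp_apply]
  refine (congrArg _ h1).trans ?_
  rw [DirectSum.toSemiring_of]
  rfl

/-- The map from the polynomial ring to Laurent polynomials that extends the coaction. -/
noncomputable def polyCoaction : Polynomial S →+* AddMonoidAlgebra S ℤ :=
  Polynomial.eval₂RingHom (coaction 𝒜) (AddMonoidAlgebra.single 1 1)

/-- The prime ideal of the polynomial ring attached to a prime ideal by the coaction. -/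
noncomputable def coactionPrime (p : PrimeSpectrum S) : PrimeSpectrum (Polynomial S) :=
  ⟨RingHom.ker ((AddMonoidAlgebra.mapRingHom ℤ (Ideal.Quotient.mk p.asIdeal)).comp
    (polyCoaction 𝒜)), RingHom.ker_isPrime _⟩

variable {𝒜}

theorem mem_coactionPrime {p : PrimeSpectrum S} {f : Polynomial S} :
    f ∈ (coactionPrime 𝒜 p).asIdeal ↔ ∀ i, (polyCoaction 𝒜 f).coeff i ∈ p.asIdeal := by
  change AddMonoidAlgebra.mapRingHom ℤ (Ideal.Quotient.mk p.asIdeal) (polyCoaction 𝒜 f) = 0 ↔ _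
  constructor
  · intro h i
    rw [← Ideal.Quotient.eq_zero_iff_mem, ← AddMonoidAlgebra.coeff_mapRingHom, h]
    rfl
  · intro h
    ext i
    rw [AddMonoidAlgebra.coeff_mapRingHom, Ideal.Quotient.eq_zero_iff_mem.2 (h i)]
    rfl

theorem C_mem_coactionPrime {p : PrimeSpectrum S} {s : S} :
    Polynomial.C s ∈ (coactionPrime 𝒜 p).asIdeal ↔ ∀ i, (coaction 𝒜 s).coeff i ∈ p.asIdeal := by
  rw [mem_coactionPrime, polyCoaction, Polynomial.coe_eval₂RingHom, Polynomial.eval₂_C]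

/-- For `a` of degree `n` take `a X^{|n|}`, a polynomial because `|n| ≥ 0`. The negative exponent in
the coaction is chosen for this purpose. -/
theorem exists_polyCoaction_eq (hN : ∀ n : Fin r → ℤ, ¬ 0 ≤ n → 𝒜 n = ⊥) (a : S) :
    ∃ f, polyCoaction 𝒜 f = AddMonoidAlgebra.single 0 a := by
  induction a using DirectSum.Decomposition.inductionOn 𝒜 with
  | zero => exact ⟨0, by rw [map_zero, AddMonoidAlgebra.single_zero]⟩
  | @homogeneous n a =>
    by_cases h : 0 ≤ n
    · refine ⟨Polynomial.C (a : S) * Polynomial.X ^ (weight n).toNat, ?_⟩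
      have h1 : 0 ≤ weight n := Finset.sum_nonneg fun i _ => h i
      rw [polyCoaction, Polynomial.coe_eval₂RingHom, Polynomial.eval₂_mul, Polynomial.eval₂_C,
        Polynomial.eval₂_pow, Polynomial.eval₂_X, coaction_of_mem 𝒜 a.2,
        AddMonoidAlgebra.single_pow, AddMonoidAlgebra.single_mul_single, one_pow, mul_one]
      congr 1
      simp [h1]
    · have : (a : S) = 0 := (AddSubgroup.mem_bot).1 (hN n h ▸ a.2)
      exact ⟨0, by rw [map_zero, this, AddMonoidAlgebra.single_zero]⟩
  | add a b ha hb =>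
    obtain ⟨f, hf⟩ := ha
    obtain ⟨g, hg⟩ := hb
    exact ⟨f + g, by rw [map_add, hf, hg, AddMonoidAlgebra.single_add]⟩

/-- All constants are in the image of `polyCoaction`, so the prime `p` can be recovered from the
prime attached to it. Chains of primes of `S` therefore give chains of the same length in `S[X]`. -/
theorem strictMono_coactionPrime (hN : ∀ n : Fin r → ℤ, ¬ 0 ≤ n → 𝒜 n = ⊥) :
    StrictMono (coactionPrime 𝒜) := by
  refine Monotone.strictMono_of_injective (fun p q h f hf => ?_) fun p q h => ?_
  · exact mem_coactionPrime.2 fun i => h (mem_coactionPrime.1 hf i)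
  · have key : ∀ (p : PrimeSpectrum S) (a : S) (f : Polynomial S),
        polyCoaction 𝒜 f = AddMonoidAlgebra.single 0 a →
        (f ∈ (coactionPrime 𝒜 p).asIdeal ↔ a ∈ p.asIdeal) := by
      intro p a f hf
      rw [mem_coactionPrime, hf]
      constructor
      · intro h
        simpa using h 0
      · intro h i
        by_cases hi : i = 0
        · subst hi; simpa using h
        · rw [AddMonoidAlgebra.coeff_single, Finsupp.single_eq_of_ne hi]
          exact zero_mem _
    refine PrimeSpectrum.ext (Ideal.ext fun a => ?_)
    obtain ⟨f, hf⟩ := exists_polyCoaction_eq hN a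
    rw [← key p a f hf, ← key q a f hf, h]

variable {k : Type v} [Field k] [Algebra k S]

/-- The weight zero part of `s` lies in `p` and in `S_0 = k`, so it is zero. -/
theorem mem_maxIdeal_of_C_mem_coactionPrime (hN : ∀ n : Fin r → ℤ, ¬ 0 ≤ n → 𝒜 n = ⊥)
    (h0 : ∀ x : S, x ∈ 𝒜 0 ↔ ∃ c : k, algebraMap k S c = x) {p : PrimeSpectrum S} {s : S}
    (hs : Polynomial.C s ∈ (coactionPrime 𝒜 p).asIdeal) : s ∈ maxIdeal 𝒜 := by
  have key : ∀ s : S, (coaction 𝒜 s).coeff 0 ∈ 𝒜 0 ∧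
      s - (coaction 𝒜 s).coeff 0 ∈ maxIdeal 𝒜 := by
    intro s
    induction s using DirectSum.Decomposition.inductionOn 𝒜 with
    | zero => simp
    | @homogeneous n a =>
      rw [coaction_of_mem 𝒜 a.2, AddMonoidAlgebra.coeff_single]
      by_cases hn : n = 0
      · subst hn
        have h1 : -weight (0 : Fin r → ℤ) = 0 := by simp [weight]
        rw [h1, Finsupp.single_eq_same, sub_self]
        exact ⟨a.2, zero_mem _⟩
      · by_cases h : 0 ≤ n
        · rw [Finsupp.single_eq_of_ne (by have := weight_pos h hn; omega), sub_zero]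
          exact ⟨zero_mem _, mem_maxIdeal a.2 hn⟩
        · have : (a : S) = 0 := (AddSubgroup.mem_bot).1 (hN n h ▸ a.2)
          simp [this]
    | add a b ha hb =>
      rw [map_add, AddMonoidAlgebra.coeff_add, Finsupp.add_apply, add_sub_add_comm]
      exact ⟨add_mem ha.1 hb.1, add_mem ha.2 hb.2⟩
  obtain ⟨h1, h2⟩ := key s
  obtain ⟨c, hc⟩ := (h0 _).1 h1
  have hc0 : c = 0 := by
    by_contra hc0
    refine p.2.ne_top (Ideal.eq_top_of_isUnit_mem _ (C_mem_coactionPrime.1 hs 0) ?_)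
    rw [← hc]
    exact (IsUnit.mk0 c hc0).map _
  rwa [← hc, hc0, map_zero, sub_zero] at h2

theorem maxIdeal_le_of_C_mem_coactionPrime {p : PrimeSpectrum S}
    (h : ∀ s ∈ maxIdeal 𝒜, Polynomial.C s ∈ (coactionPrime 𝒜 p).asIdeal) :
    maxIdeal 𝒜 ≤ p.asIdeal := by
  refine Ideal.span_le.2 ?_
  rintro a ⟨n, hn, ha⟩
  have h1 := C_mem_coactionPrime.1 (h a (mem_maxIdeal ha hn)) (-weight n)
  rw [coaction_of_mem 𝒜 ha, AddMonoidAlgebra.coeff_single, Finsupp.single_eq_same] at h1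
  exact h1

/-- The height of the homogeneous maximal ideal is the Krull dimension. -/
theorem height_maxIdeal [IsNoetherianRing S] [Nontrivial S]
    (hN : ∀ n : Fin r → ℤ, ¬ 0 ≤ n → 𝒜 n = ⊥)
    (h0 : ∀ x : S, x ∈ 𝒜 0 ↔ ∃ c : k, algebraMap k S c = x) :
    ((maxIdeal 𝒜).height : WithBot ℕ∞) = ringKrullDim S := by
  have hmax : (maxIdeal 𝒜).IsMaximal := isMaximal_maxIdeal hN h0
  refine le_antisymm Ideal.height_le_ringKrullDim_of_isPrime
    ((ringKrullDim_le_iff_height_le _).2 fun P hP => ?_)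
  by_cases hle : maxIdeal 𝒜 ≤ P
  · rw [hmax.eq_of_le hP.ne_top hle]
  let p : PrimeSpectrum S := ⟨P, hP⟩
  have h1 : P.height ≤ (coactionPrime 𝒜 p).asIdeal.height := by
    rw [show P = p.asIdeal from rfl, PrimeSpectrum.height_eq_orderHeight,
      PrimeSpectrum.height_eq_orderHeight]
    exact Order.height_le_height_apply_of_strictMono _ (strictMono_coactionPrime hN) p
  have : (coactionPrime 𝒜 p).asIdeal.IsPrime := (coactionPrime 𝒜 p).2
  -- The contraction consists of the elements whose weight components all lie in `P`. It lies
  -- strictly inside `𝓜` because `P` does not contain `𝓜`; this strictness absorbs the `+ 1` of the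
  -- polynomial variable.
  have hlt : (coactionPrime 𝒜 p).asIdeal.comap Polynomial.C < maxIdeal 𝒜 :=
    lt_of_le_not_ge (fun s hs => mem_maxIdeal_of_C_mem_coactionPrime hN h0 hs)
      fun h => hle (maxIdeal_le_of_C_mem_coactionPrime h)
  have : ((coactionPrime 𝒜 p).asIdeal.comap Polynomial.C).IsPrime := Ideal.comap_isPrime _ _
  exact_mod_cast (h1.trans (height_le_height_comap_C_add_one _)).trans
    (Ideal.height_add_one_le_of_lt_of_isPrime hlt)

end GrMod

/-! ### Syzygies: the local cohomology of a module from that of its free resolution. -/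

namespace GrMod

open InjRes

variable {r : ℕ} {S : Type u} [CommRing S] {𝒜 : (Fin r → ℤ) → AddSubgroup S} [GradedRing 𝒜]

namespace FreeRes

variable {M : GrMod 𝒜} (P : FreeRes M)

/-- The syzygies of a free resolution. -/
noncomputable def syz : ℕ → GrMod 𝒜
  | 0 => M
  | p + 1 => sub _ (isGrSub_range (P.δ p))

/-- The inclusion of the syzygies. -/
noncomputable def syzι (p : ℕ) : Hom (P.syz (p + 1)) (P.F p) := subι _ (isGrSub_range (P.δ p))

/-- The differentials as maps to the syzygies. -/
noncomputable def syzπ : ∀ p, Hom (P.F p) (P.syz p)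
  | 0 => P.ε
  | p + 1 => subLift _ (isGrSub_range (P.δ p)) (P.δ p) fun x => ⟨x, rfl⟩

theorem syzι_comp_syzπ (p : ℕ) : (P.syzι p).comp (P.syzπ (p + 1)) = P.δ p := rfl

theorem isShortExact_syz (p : ℕ) : IsShortExact (P.syzι p) (P.syzπ p) where
  injective := subι_injective _ (isGrSub_range (P.δ p))
  surjective := by
    cases p with
    | zero => exact P.ε_surjective
    | succ p =>
      rintro ⟨_, y, rfl⟩
      exact ⟨y, rfl⟩
  exact x := by
    have h1 : (∃ y, (P.syzι p).1 y = x) ↔ ∃ y, (P.δ p).1 y = x :=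
      ⟨by rintro ⟨⟨_, z, rfl⟩, rfl⟩; exact ⟨z, rfl⟩, by rintro ⟨z, rfl⟩; exact ⟨⟨_, z, rfl⟩, rfl⟩⟩
    refine Iff.trans ?_ h1.symm
    cases p with
    | zero => exact P.exact_zero x
    | succ p =>
      exact Iff.trans ⟨fun h => congrArg Subtype.val h, fun h => Subtype.ext h⟩ (P.exact_succ p x)

theorem finite_syz [IsNoetherianRing S] [Module.Finite S M.carrier] (p : ℕ) :
    Module.Finite S (P.syz p).carrier := by
  cases p with
  | zero => assumption
  | succ p => exact inferInstanceAs (Module.Finite S (LinearMap.range (P.δ p).1))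

variable (ρ : ∀ N : GrMod 𝒜, InjRes N)

/-- `H^i(Z_p) → H^{i+1}(Z_{p+1})` is injective when `H^i(F_p) = 0`. The `q` steps use indices up to
`i + q - 1`, so `i + q = e` is allowed. -/
theorem subsingleton_H_of_syz {e : ℕ}
    (he : ∀ i < e, ∀ n, Subsingleton (H ρ (self 𝒜) i n)) {n : Fin r → ℤ} {i p q : ℕ}
    (hiq : i + q ≤ e) (h : Subsingleton (H ρ (P.syz (p + q)) (i + q) n)) :
    Subsingleton (H ρ (P.syz p) i n) := by
  induction q generalizing i p with
  | zero => exact h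
  | succ q ih =>
    have h1 : Subsingleton (H ρ (P.syz (p + 1)) (i + 1) n) :=
      ih (by omega) (by rwa [add_right_comm p, add_right_comm i])
    exact (P.isShortExact_syz p).subsingleton_right
      ((subsingleton_H_free_iff _ ρ i n).2 fun q => he i (by omega) _) h1

/-- `H^i(Z_p) → H^{i+1}(Z_{p+1})` is surjective when `H^{i+1}(F_p) = 0`. The index `i + q` itself is
used, so it must be strictly below `e`. -/
theorem subsingleton_H_syz {e : ℕ}
    (he : ∀ i < e, ∀ n, Subsingleton (H ρ (self 𝒜) i n)) {n : Fin r → ℤ} {i p q : ℕ}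
    (hiq : i + q < e) (h : Subsingleton (H ρ (P.syz p) i n)) :
    Subsingleton (H ρ (P.syz (p + q)) (i + q) n) := by
  induction q with
  | zero => exact h
  | succ q ih =>
    exact (P.isShortExact_syz (p + q)).subsingleton_left (ih (by omega))
      ((subsingleton_H_free_iff _ ρ _ n).2 fun q => he _ (by omega) _)

variable {d : ℕ}

/-- `H^{d-p}(M)` embeds in `H^d(Z_p)`, which is a quotient of `H^d(F_p)` because `H^{d+1}(Z_{p+1}) =
0`. -/
theorem nontrivial_H_term_of_nontrivial [IsNoetherianRing S] [Module.Finite S M.carrier]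
    (hlow : ∀ i < d, ∀ n, Subsingleton (H ρ (self 𝒜) i n))
    (hhigh : ∀ (X : GrMod 𝒜) [Module.Finite S X.carrier] (i : ℕ) n, d < i →
      Subsingleton (H ρ X i n))
    {p : ℕ} (hp : p ≤ d) {n : Fin r → ℤ} (h : Nontrivial (H ρ M (d - p) n)) :
    Nontrivial (H ρ (P.F p) d n) := by
  by_contra hF
  rw [not_nontrivial_iff_subsingleton] at hF
  have := P.finite_syz (p + 1)
  have h1 : Subsingleton (H ρ (P.syz p) d n) :=
    (P.isShortExact_syz p).subsingleton_right hF (hhigh _ _ _ (Nat.lt_succ_self d))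
  have h2 : Subsingleton (H ρ (P.syz 0) (d - p) n) :=
    P.subsingleton_H_of_syz ρ hlow (q := p) (by omega)
      (by rwa [zero_add, Nat.sub_add_cancel hp])
  exact not_subsingleton_iff_nontrivial.2 h h2

/-- A degree in which the top local cohomology of the `p`-th term survives the differentials of
a free resolution contributes to the local cohomology of the resolved module. -/
theorem nontrivial_H_of_nontrivial_term [IsNoetherianRing S] [Module.Finite S M.carrier]
    (hlow : ∀ i < d, ∀ n, Subsingleton (H ρ (self 𝒜) i n))
    (hhigh : ∀ (X : GrMod 𝒜) [Module.Finite S X.carrier] (i : ℕ) n, d < i →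
      Subsingleton (H ρ X i n))
    {p : ℕ} {n : Fin r → ℤ} (hsucc : Subsingleton (H ρ (P.F (p + 1)) d n))
    (hp : Nontrivial (H ρ (P.F p) d n)) (hδ : ∀ p', p = p' + 1 → Hmap ρ (P.δ p') d n = 0) :
    p ≤ d ∧ Nontrivial (H ρ M (d - p) n) := by
  have hsurj : ∀ p, Function.Surjective (Hmap ρ (P.syzπ p) d n) := fun p => by
    have := P.finite_syz (p + 1)
    exact (P.isShortExact_syz p).surjective_Hmap (hhigh _ _ _ (Nat.lt_succ_self d))
  have h1 : Subsingleton (H ρ (P.syz (p + 1)) d n) := (hsurj (p + 1)).subsingleton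
  -- As `H^d(Z_{p+1})_n = 0`, the nonzero group `H^d(F_p)_n` embeds in `H^d(Z_p)_n`.
  have h2 : Nontrivial (H ρ (P.syz p) d n) :=
    ((P.isShortExact_syz p).injective_Hmap h1).nontrivial
  cases p with
  | zero => exact ⟨Nat.zero_le d, h2⟩
  | succ p =>
    -- The vanishing of `δ` passes to the inclusion of the syzygy, since `F_{p+1} → Z_{p+1}` is
    -- surjective on `H^d`. Hence `H^d(Z_{p+1})_n ≠ 0` comes from `H^{d-1}(Z_p)_n`.
    have hι : Hmap ρ (P.syzι p) d n = 0 := by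
      refine AddMonoidHom.ext fun c => ?_
      obtain ⟨b, rfl⟩ := hsurj (p + 1) c
      have h3 := hδ p rfl
      rw [← P.syzι_comp_syzπ, Hmap_comp] at h3
      exact DFunLike.congr_fun h3 b
    have hinj : ¬ Function.Injective (Hmap ρ (P.syzι p) d n) := fun h => by
      obtain ⟨x, y, hxy⟩ := h2
      exact hxy (h (by rw [hι]; rfl))
    cases d with
    | zero => exact absurd ((P.isShortExact_syz p).long_exact ρ 0 n).2.2 hinj
    | succ e =>
      have h4 : ¬ Subsingleton (H ρ (P.syz p) e n) := fun h =>
        hinj ((P.isShortExact_syz p).injective_succ h)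
      by_cases hpe : p ≤ e
      · refine ⟨Nat.succ_le_succ hpe, ?_⟩
        rw [Nat.succ_sub_succ]
        by_contra h5
        rw [not_nontrivial_iff_subsingleton] at h5
        have h6 := P.subsingleton_H_syz ρ hlow (i := e - p) (p := 0) (q := p) (n := n) (by omega) h5
        rw [zero_add, Nat.sub_add_cancel hpe] at h6
        exact h4 h6
      -- If the resolution index exceeds `d`, descend instead to `H^0` of a syzygy, a submodule of a
      -- free module without torsion; this contradicts `h4`.
      · obtain ⟨q, rfl⟩ : ∃ q, p = q + 1 + e := ⟨p - e - 1, by omega⟩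
        have h5 : Subsingleton (H ρ (P.syz (q + 1)) 0 n) :=
          (P.isShortExact_syz q).subsingleton_left_zero
            ((subsingleton_H_free_iff _ ρ 0 n).2 fun q => hlow 0 (Nat.succ_pos e) _)
        have h6 := P.subsingleton_H_syz ρ hlow (q := e) (by omega) h5
        rw [zero_add] at h6
        exact absurd h6 h4

end FreeRes

section Self

theorem isGrSub_maxIdeal (hN : ∀ n : Fin r → ℤ, ¬ 0 ≤ n → 𝒜 n = ⊥) :
    (self 𝒜).IsGrSub (maxIdeal 𝒜) := by
  intro n x hx
  by_cases hn : n = 0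
  · subst hn
    have h1 : (1 : S) ∈ weightGE hN (self 𝒜) 0 := fun n hn =>
      (self 𝒜).proj_of_mem_ne (SetLike.GradedOne.one_mem : (1 : S) ∈ 𝒜 0) fun h => by
        rw [← h] at hn; exact absurd hn (by simp [weight])
    have h2 := smul_mem_weightGE_succ hN (self 𝒜) hx h1 0 (by simp [weight])
    have h3 : ∀ y : S, y • (1 : S) = y := fun y => by rw [smul_eq_mul, mul_one]
    have h4 : (self 𝒜).proj 0 x = 0 := (congrArg _ (h3 x)).symm.trans h2
    rw [h4]
    exact zero_mem _
  · exact mem_maxIdeal (S := S) ((self 𝒜).proj_mem n x) hn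

/-- If `H^d(S)` vanished too, shifting along a free resolution of `S/𝓜` would embed `H^0(S/𝓜)` in an
`H^{d+1}`, which is zero; but the class of `1` is a nonzero torsion element. -/
theorem exists_nontrivial_H_self [IsNoetherianRing S] [Nontrivial S]
    (hN : ∀ n : Fin r → ℤ, ¬ 0 ≤ n → 𝒜 n = ⊥) (ρ : ∀ N : GrMod 𝒜, InjRes N) {d : ℕ}
    (hlow : ∀ i < d, ∀ n, Subsingleton (H ρ (self 𝒜) i n))
    (hhigh : ∀ (X : GrMod 𝒜) [Module.Finite S X.carrier] (i : ℕ) n, d < i →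
      Subsingleton (H ρ X i n)) : ∃ n, Nontrivial (H ρ (self 𝒜) d n) := by
  by_contra! hd
  have hall : ∀ i < d + 1, ∀ n, Subsingleton (H ρ (self 𝒜) i n) := fun i hi n => by
    rcases Nat.lt_succ_iff_lt_or_eq.1 hi with h | rfl
    · exact hlow i h n
    · exact hd n
  let K := quot (M := self 𝒜) (maxIdeal 𝒜) (isGrSub_maxIdeal hN)
  have : Module.Finite S K.carrier := inferInstanceAs (Module.Finite S (S ⧸ maxIdeal 𝒜))
  obtain ⟨P⟩ := exists_freeRes K
  have := P.finite_syz (0 + (d + 1))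
  have h1 : Subsingleton (H ρ (P.syz 0) 0 0) :=
    P.subsingleton_H_of_syz ρ hall (q := d + 1) (by omega) (hhigh _ _ _ (by omega))
  refine not_nontrivial_iff_subsingleton.2 h1 ((nontrivial_cohomology_zero_iff (ρ K)).2 ?_)
  let o : (self 𝒜).carrier := (1 : S)
  have ho : o ∈ (self 𝒜).gr 0 := (SetLike.GradedOne.one_mem : (1 : S) ∈ 𝒜 0)
  refine ⟨(quotπ _ (isGrSub_maxIdeal hN)).1 o, (quotπ _ (isGrSub_maxIdeal hN)).mem ho,
    fun h => one_notMem_maxIdeal hN ((quotπ_eq_zero_iff _ (isGrSub_maxIdeal hN) o).1 h),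
    1, fun a ha => ?_⟩
  rw [pow_one] at ha
  have h2 : (quotπ _ (isGrSub_maxIdeal hN)).1 (a • o) = 0 :=
    (quotπ_eq_zero_iff _ (isGrSub_maxIdeal hN) _).2 (by
      have h3 : a • o = a := mul_one a
      rw [h3]; exact ha)
  rwa [map_smul] at h2

end Self

end GrMod

theorem ExtInt.ofInt_mono {a b : ℤ} (h : a ≤ b) : ExtInt.ofInt a ≤ ExtInt.ofInt b :=
  WithBot.coe_le_coe.2 (WithTop.coe_le_coe.2 h)

/-! ### Lexicographic maxima and minimal resolutions. -/

namespace GrMod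

open InjRes

section Lex

/-- Subtracting from the bound turns a maximum into a minimum in `ℕ^r`, where the lexicographic
order is well-founded. -/
theorem exists_toLex_max {r : ℕ} {T : Set (Fin r → ℤ)} (hT : T.Nonempty) (b : Fin r → ℤ)
    (hb : ∀ n ∈ T, n ≤ b) : ∃ m ∈ T, ∀ n ∈ T, toLex n ≤ toLex m := by
  let f : (Fin r → ℤ) → Lex (Fin r → ℕ) := fun n => toLex fun i => (b i - n i).toNat
  obtain ⟨m, hm, hmin⟩ := WellFounded.has_min (wellFounded_lt.onFun (f := f)) T hT
  refine ⟨m, hm, fun n hn => not_lt.1 fun hlt => hmin n hn ?_⟩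
  obtain ⟨i, hi, hi'⟩ := hlt
  refine ⟨i, fun j hj => ?_, ?_⟩
  · change (b j - n j).toNat = (b j - m j).toNat
    rw [show m j = n j from hi j hj]
  · change (b i - n i).toNat < (b i - m i).toNat
    have h1 : m i < n i := hi'
    have h2 : n i ≤ b i := hb n hn i
    have h3 : m i ≤ b i := hb m hm i
    omega

end Lex

variable {r : ℕ} {S : Type u} [CommRing S] {𝒜 : (Fin r → ℤ) → AddSubgroup S} [GradedRing 𝒜]

/-- The free resolution underlying a minimal free resolution. -/
def MinFreeRes.toFreeRes {M : GrMod 𝒜} (D : M.MinFreeRes) : FreeRes M where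
  rank := D.rank
  shift := D.shift
  ε := ⟨D.ε, D.ε_hom⟩
  δ p := ⟨D.δ p, D.δ_hom p⟩
  ε_surjective := D.ε_surjective
  exact_zero := D.exact_zero
  exact_succ := D.exact_succ

namespace MinFreeRes

variable {M : GrMod 𝒜} (D : M.MinFreeRes)

theorem ofInt_le_t (p : ℕ) (q : Fin (D.rank p)) (j : Fin r) :
    ExtInt.ofInt (-D.shift p q j) ≤ D.t p j :=
  Finset.le_sup (f := fun q => ExtInt.ofInt (-D.shift p q j)) (Finset.mem_univ q)

theorem t_le_tStar (p : ℕ) (j : Fin r) : D.t p j ≤ D.tStar j := by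
  by_cases h : p ≤ D.l
  · exact Finset.le_sup (f := fun p => D.t p j) (Finset.mem_range.2 (Nat.lt_succ_of_le h))
  · refine Finset.sup_le fun q _ => ?_
    have := D.finite p (not_le.1 h)
    exact absurd q.2 (by omega)

theorem le_lexMax (σ : Equiv.Perm (Fin r)) (p : ℕ) (q : Fin (D.rank p)) :
    ((toLex fun i => -D.shift p q (σ i) : Lex (Fin r → ℤ)) : WithBot (Lex (Fin r → ℤ))) ≤
      D.lexMax σ p :=
  Finset.le_sup (f := fun q => ((toLex fun i => -D.shift p q (σ i) : Lex (Fin r → ℤ)) :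
    WithBot (Lex (Fin r → ℤ)))) (Finset.mem_univ q)

theorem exists_lexMax_eq (σ : Equiv.Perm (Fin r)) {p : ℕ} (h : D.lexMax σ p ≠ ⊥) :
    ∃ q, D.lexMax σ p =
      ((toLex fun i => -D.shift p q (σ i) : Lex (Fin r → ℤ)) : WithBot (Lex (Fin r → ℤ))) := by
  have hne : (Finset.univ : Finset (Fin (D.rank p))).Nonempty := by
    by_contra hne
    rw [Finset.not_nonempty_iff_eq_empty] at hne
    exact h (by rw [lexMax, hne, Finset.sup_empty])
  obtain ⟨q, -, hq⟩ := Finset.exists_mem_eq_sup _ hne fun q : Fin (D.rank p) =>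
    ((toLex fun i => -D.shift p q (σ i) : Lex (Fin r → ℤ)) : WithBot (Lex (Fin r → ℤ)))
  exact ⟨q, hq⟩

/-- As `σ(1) = j`, the `j`-th coordinate is compared first. -/
theorem t_le_ofInt_of_lexMax_le {σ : Equiv.Perm (Fin r)} {j : Fin r} (hσ : σ ⟨0, Fin.pos j⟩ = j)
    {p p' : ℕ} {q : Fin (D.rank p)}
    (h : D.lexMax σ p' ≤
      ((toLex fun i => -D.shift p q (σ i) : Lex (Fin r → ℤ)) : WithBot (Lex (Fin r → ℤ)))) :
    D.t p' j ≤ ExtInt.ofInt (-D.shift p q j) := by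
  refine Finset.sup_le fun q' _ => ?_
  have h1 := WithBot.coe_le_coe.1 ((D.le_lexMax σ p' q').trans h)
  have h2 := Pi.apply_le_of_toLex (i := ⟨0, Fin.pos j⟩) h1 fun i hi =>
    absurd (Fin.lt_def.1 hi) (Nat.not_lt_zero _)
  simp only [hσ] at h2
  exact ExtInt.ofInt_mono h2

/-- Take the largest index at which the overall maximum is attained; it exists because the terms
beyond `l` are zero. -/
theorem exists_lexMax_last (σ : Equiv.Perm (Fin r)) :
    (∀ p, D.lexMax σ p = ⊥) ∨
      ∃ p, D.lexMax σ (p + 1) < D.lexMax σ p ∧ ∀ p', D.lexMax σ p' ≤ D.lexMax σ p := by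
  have hbot : ∀ p, D.l < p → D.lexMax σ p = ⊥ := fun p hp => by
    refine (Finset.sup_eq_bot_iff _ _).2 fun q _ => ?_
    have := D.finite p hp
    exact absurd q.2 (by omega)
  obtain ⟨p₀, -, hp₀⟩ := Finset.exists_max_image (Finset.range (D.l + 1)) (D.lexMax σ)
    ⟨0, Finset.mem_range.2 (Nat.succ_pos _)⟩
  have hmax : ∀ p, D.lexMax σ p ≤ D.lexMax σ p₀ := fun p => by
    by_cases hp : p ≤ D.l
    · exact hp₀ p (Finset.mem_range.2 (Nat.lt_succ_of_le hp))
    · rw [hbot p (not_le.1 hp)]; exact bot_le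
  by_cases h : D.lexMax σ p₀ = ⊥
  · exact Or.inl fun p => le_bot_iff.1 (h ▸ hmax p)
  · classical
    have hle : p₀ ≤ D.l := not_lt.1 fun h' => h (hbot p₀ h')
    let p := Nat.findGreatest (fun p => D.lexMax σ p = D.lexMax σ p₀) D.l
    have hp : D.lexMax σ p = D.lexMax σ p₀ :=
      Nat.findGreatest_spec (P := fun p => D.lexMax σ p = D.lexMax σ p₀) hle rfl
    refine Or.inr ⟨p, lt_of_le_of_ne (hp ▸ hmax _) fun h' => ?_, fun p' => hp ▸ hmax p'⟩
    by_cases hpl : p + 1 ≤ D.l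
    · exact Nat.findGreatest_is_greatest (P := fun p => D.lexMax σ p = D.lexMax σ p₀)
        (Nat.lt_succ_self p) hpl (h'.trans hp)
    · exact h (hp ▸ h' ▸ hbot _ (not_le.1 hpl))

variable {k : Type v} [Field k] [Algebra k S]

/-- The nonzero entries of the differentials of a minimal resolution have positive degree. -/
theorem shift_lt_of_entry_ne_zero [Nontrivial S] (hN : ∀ n : Fin r → ℤ, ¬ 0 ≤ n → 𝒜 n = ⊥)
    (h0 : ∀ x : S, x ∈ 𝒜 0 ↔ ∃ c : k, algebraMap k S c = x) (p : ℕ) (q : Fin (D.rank (p + 1)))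
    (q' : Fin (D.rank p))
    (h : (freeProj (D.shift p) q').comp
      ((D.toFreeRes.δ p).comp (freeIncl (D.shift (p + 1)) q)) ≠ 0) :
    D.shift (p + 1) q < D.shift p q' := by
  let e : (free 𝒜 (D.shift (p + 1))).carrier := (Pi.single q (1 : S) : Fin (D.rank (p + 1)) → S)
  let x : S := (D.δ p e : Fin (D.rank p) → S) q'
  have hx : x ∈ 𝒜 (D.shift p q' + -D.shift (p + 1) q) := by
    refine D.δ_hom p _ e (single_mem_freeGr (D.shift (p + 1)) q ?_) q'
    rw [add_neg_cancel]
    exact SetLike.GradedOne.one_mem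
  have hxM : x ∈ maxIdeal 𝒜 := by
    have h1 : maxIdeal 𝒜 • (⊤ : Submodule S (Fin (D.rank p) → S)) ≤
        Submodule.comap (LinearMap.proj (R := S) (φ := fun _ : Fin (D.rank p) => S) q')
          (maxIdeal 𝒜) :=
      Submodule.smul_le.2 fun c hc y _ => Ideal.mul_mem_right (y q') _ hc
    exact h1 (D.minimal p ⟨e, rfl⟩)
  have hx0 : x ≠ 0 := fun hx0 => h (Hom.ext fun (s : S) => by
    have h1 : (freeIncl (𝒜 := 𝒜) (D.shift (p + 1)) q).1 s = s • e := by
      change (Pi.single q s : Fin (D.rank (p + 1)) → S) =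
        s • (Pi.single q (1 : S) : Fin (D.rank (p + 1)) → S)
      rw [← Pi.single_smul, smul_eq_mul, mul_one]
    have h2 : D.δ p ((freeIncl (𝒜 := 𝒜) (D.shift (p + 1)) q).1 s) = s • D.δ p e := by
      rw [h1, map_smul]
    exact (congrFun h2 q').trans ((congrArg (fun y : S => s * y) hx0).trans (mul_zero s)))
  have hge : 0 ≤ D.shift p q' + -D.shift (p + 1) q := by
    by_contra hge
    rw [hN _ hge] at hx
    exact hx0 hx
  refine lt_of_le_of_ne (by simpa [← sub_eq_add_neg] using hge) fun heq => ?_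
  -- An entry of degree zero would be a nonzero constant, that is, a unit in `𝓜`.
  rw [heq, add_neg_cancel, h0] at hx
  obtain ⟨c, hc⟩ := hx
  have hc0 : c ≠ 0 := fun h => hx0 (by rw [← hc, h, map_zero])
  refine one_notMem_maxIdeal hN ?_
  have h2 := Ideal.mul_mem_left (maxIdeal 𝒜) (algebraMap k S c⁻¹) hxM
  rwa [← hc, ← map_mul, inv_mul_cancel₀ hc0, map_one] at h2

/-- In the degree `m - a_{pq₀}` the summand `q₀` of `H^d(D_p)` is `H^d(S)_m ≠ 0`, while the incoming
group and the outgoing map vanish. -/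
theorem nontrivial_H_of_lexMax_lt [IsNoetherianRing S] [Nontrivial S] [Module.Finite S M.carrier]
    (hN : ∀ n : Fin r → ℤ, ¬ 0 ≤ n → 𝒜 n = ⊥)
    (h0 : ∀ x : S, x ∈ 𝒜 0 ↔ ∃ c : k, algebraMap k S c = x)
    (ρ : ∀ N : GrMod 𝒜, InjRes N) {d : ℕ}
    (hlow : ∀ i < d, ∀ n, Subsingleton (H ρ (self 𝒜) i n))
    (hhigh : ∀ (X : GrMod 𝒜) [Module.Finite S X.carrier] (i : ℕ) n, d < i →
      Subsingleton (H ρ X i n))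
    {σ : Equiv.Perm (Fin r)} {m : Fin r → ℤ} (hm : Nontrivial (H ρ (self 𝒜) d m))
    (hmax : ∀ n, Nontrivial (H ρ (self 𝒜) d n) → toLex (n ∘ σ) ≤ toLex (m ∘ σ))
    {p : ℕ} (hp : D.lexMax σ (p + 1) < D.lexMax σ p) {q₀ : Fin (D.rank p)}
    (hq₀ : D.lexMax σ p = ((toLex fun i => -D.shift p q₀ (σ i) : Lex (Fin r → ℤ)) :
      WithBot (Lex (Fin r → ℤ)))) :
    p ≤ d ∧ Nontrivial (H ρ M (d - p) (m - D.shift p q₀)) := by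
  -- For `a` beyond `a_{pq₀}` the degree lies beyond `m`, the last one in which `H^d(S)` is nonzero.
  have hvan : ∀ a : Fin r → ℤ, toLex (D.shift p q₀ ∘ σ) < toLex (a ∘ σ) →
      Subsingleton (H ρ (self 𝒜) d (a + (m - D.shift p q₀))) := by
    intro a ha
    rw [← not_nontrivial_iff_subsingleton]
    intro h
    refine absurd (hmax _ h) (not_le.2 ?_)
    have h1 : toLex ((a + (m - D.shift p q₀)) ∘ σ) =
        toLex (a ∘ σ) + (toLex (m ∘ σ) - toLex (D.shift p q₀ ∘ σ)) := rfl
    rw [h1]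
    calc toLex (m ∘ σ) = toLex (D.shift p q₀ ∘ σ) + (toLex (m ∘ σ) - toLex (D.shift p q₀ ∘ σ)) := by
          abel
      _ < _ := add_lt_add_left ha _
  refine D.toFreeRes.nontrivial_H_of_nontrivial_term ρ hlow hhigh ?_ ?_ ?_
  · refine (subsingleton_H_free_iff _ ρ d _).2 fun q => hvan _ ?_
    have h1 := WithBot.coe_lt_coe.1 ((D.le_lexMax σ (p + 1) q).trans_lt (hp.trans_eq hq₀))
    exact neg_lt_neg_iff.1 h1
  · by_contra h
    rw [not_nontrivial_iff_subsingleton] at h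
    have h1 := (subsingleton_H_free_iff _ ρ d _).1 h q₀
    rw [show D.toFreeRes.shift p q₀ = D.shift p q₀ from rfl, add_sub_cancel] at h1
    exact not_subsingleton_iff_nontrivial.2 hm h1
  -- A nonzero entry gives `a_{p'q'} > a_{p'+1,q}` componentwise, hence in every `≤_σ`, and
  -- `a_{p'+1,q} ≥_σ a_{p'+1,q₀}` by the choice of `q₀`; so the target summand has no cohomology.
  · rintro p' rfl
    refine Hmap_free_eq_zero _ ρ _ _ d _ fun q q' => Or.inr ?_
    by_cases h : (freeProj (D.shift p') q').comp
      ((D.toFreeRes.δ p').comp (freeIncl (D.shift (p' + 1)) q)) = 0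
    · exact Or.inr h
    · refine Or.inl (hvan _ ?_)
      have h1 := D.shift_lt_of_entry_ne_zero hN h0 p' q q' h
      have h2 := WithBot.coe_le_coe.1 ((D.le_lexMax σ (p' + 1) q).trans_eq hq₀)
      have h3 : toLex (D.shift (p' + 1) q₀ ∘ σ) ≤ toLex (D.shift (p' + 1) q ∘ σ) :=
        neg_le_neg_iff.1 h2
      refine h3.trans_lt (Pi.toLex_strictMono ?_)
      refine lt_of_le_of_ne (fun i => h1.le (σ i)) fun heq => h1.ne (funext fun i => ?_)
      have h4 := congrFun heq (σ.symm i)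
      simp only [Function.comp_apply, Equiv.apply_symm_apply] at h4
      exact h4

end MinFreeRes

end GrMod

theorem theorem1p3p4 {k : Type v} [Field k] {S : Type u} [CommRing S] [Algebra k S] {r : ℕ}
    (𝒜 : (Fin r → ℤ) → AddSubgroup S) [GradedRing 𝒜]
    (hN : ∀ n : Fin r → ℤ, ¬ 0 ≤ n → 𝒜 n = ⊥)
    (h0 : ∀ x : S, x ∈ 𝒜 0 ↔ ∃ c : k, algebraMap k S c = x)
    (hCM : IsCohenMacaulay S)
    (d : ℕ) (hd : ringKrullDim S = d)
    (M : GrMod 𝒜) [Module.Finite S M.carrier] (D : M.MinFreeRes) (j : Fin r) :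
    -- the maxima that define the invariants exist, and `a^j(S)` is an integer
    (∃ α : ℤ, (GrMod.self 𝒜).aInv d j = ExtInt.ofInt α) ∧ (∀ i, M.aInv i j ≠ ⊤) ∧
    (∀ p : ℕ, (d : WithBot ℕ∞) ≤ Module.supportDim S M.carrier + p →
      (p : ℕ∞) + M.depth ≤ d →
      M.aInv (d - p) j ≤ D.t p j + (GrMod.self 𝒜).aInv d j) ∧
    (∀ (p : ℕ) (σ : Equiv.Perm (Fin r)), σ ⟨0, Fin.pos j⟩ = j →
      D.lexMax σ (p + 1) < D.lexMax σ p →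
      p ≤ d ∧ M.aInv (d - p) j = D.t p j + (GrMod.self 𝒜).aInv d j) ∧
    M.aStar j = D.tStar j + (GrMod.self 𝒜).aInv d j := by
  have hNoeth : IsNoetherianRing S := hCM.1
  have hnt : Nontrivial S := by
    by_contra h
    rw [not_nontrivial_iff_subsingleton] at h
    rw [ringKrullDim_eq_bot_of_subsingleton] at hd
    exact WithBot.bot_ne_coe hd
  have hk : ∀ c : k, algebraMap k S c ∈ 𝒜 0 := fun c => (h0 _).2 ⟨c, rfl⟩
  have hmaxl : (GrMod.maxIdeal 𝒜).IsMaximal := GrMod.isMaximal_maxIdeal hN h0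
  choose ρ _ using GrMod.exists_injRes (k := k) hN hk
  have hhigh : ∀ (X : GrMod 𝒜) [Module.Finite S X.carrier] (i : ℕ) n, d < i →
      Subsingleton (GrMod.H ρ X i n) := fun X _ i n hi =>
    (GrMod.isTame_of_finite hN hk ρ j X).1 i n (lt_of_le_of_lt
      ((Module.supportDim_le_ringKrullDim S X.carrier).trans_eq hd) (by exact_mod_cast hi))
  have hlow : ∀ i < d, ∀ n, Subsingleton (GrMod.H ρ (GrMod.self 𝒜) i n) := by
    -- The Cohen–Macaulay property is used at `𝓜`, whose height is `d`.
    obtain ⟨rs, hrs, hreg, hlen⟩ := hCM.2 (GrMod.maxIdeal 𝒜)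
    rw [IsLocalization.AtPrime.ringKrullDim_eq_height (GrMod.maxIdeal 𝒜),
      GrMod.height_maxIdeal hN h0, hd] at hlen
    have hlen' : rs.length = d := by exact_mod_cast hlen
    exact fun i hi n => GrMod.subsingleton_H_self_of_lt hN h0 rs hrs hreg.1 ρ (hlen' ▸ hi) n
  have hfin : Module.Finite S (GrMod.self 𝒜).carrier := inferInstanceAs (Module.Finite S S)
  choose b hb using fun i : Fin r =>
    (GrMod.isTame_of_finite hN hk ρ i (GrMod.self 𝒜)).2
  have hbound : ∀ n, Nontrivial (GrMod.H ρ (GrMod.self 𝒜) d n) → n ≤ b := fun n hn i =>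
    not_lt.1 fun h => not_subsingleton_iff_nontrivial.2 hn (hb i d n h)
  have hlex : ∀ σ : Equiv.Perm (Fin r), ∃ m, Nontrivial (GrMod.H ρ (GrMod.self 𝒜) d m) ∧
      ∀ n, Nontrivial (GrMod.H ρ (GrMod.self 𝒜) d n) → toLex (n ∘ σ) ≤ toLex (m ∘ σ) := by
    intro σ
    obtain ⟨n₀, hn₀⟩ := GrMod.exists_nontrivial_H_self hN ρ hlow hhigh
    obtain ⟨_, ⟨m, hm, rfl⟩, hmax⟩ := GrMod.exists_toLex_max
      (T := (fun n => n ∘ σ) '' {n | Nontrivial (GrMod.H ρ (GrMod.self 𝒜) d n)})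
      ⟨_, n₀, hn₀, rfl⟩ (b ∘ σ) (by rintro _ ⟨n, hn, rfl⟩ i; exact hbound n hn (σ i))
    exact ⟨m, hm, fun n hn => hmax _ ⟨n, hn, rfl⟩⟩
  have hα : ∀ σ : Equiv.Perm (Fin r), σ ⟨0, Fin.pos j⟩ = j → ∀ m,
      Nontrivial (GrMod.H ρ (GrMod.self 𝒜) d m) →
      (∀ n, Nontrivial (GrMod.H ρ (GrMod.self 𝒜) d n) → toLex (n ∘ σ) ≤ toLex (m ∘ σ)) →
      (GrMod.self 𝒜).aInv d j = ExtInt.ofInt (m j) := by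
    intro σ hσ m hm hmax
    refine le_antisymm (iSup₂_le fun n hn => ?_)
      (le_iSup₂_of_le m ((GrMod.mem_localCohomologySupport_iff ρ).2 hm) le_rfl)
    have h1 := Pi.apply_le_of_toLex (i := ⟨0, Fin.pos j⟩)
      (hmax n ((GrMod.mem_localCohomologySupport_iff ρ).1 hn)) fun i hi =>
        absurd (Fin.lt_def.1 hi) (Nat.not_lt_zero _)
    simp only [Function.comp_apply, hσ] at h1
    exact ExtInt.ofInt_mono h1
  -- The whole range `p ≤ d` is covered, so that the third claim can apply it with `p = d - i` for
  -- any `i ≤ dim M`.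
  have hupper : ∀ p ≤ d, M.aInv (d - p) j ≤ D.t p j + (GrMod.self 𝒜).aInv d j := by
    intro p hp
    refine iSup₂_le fun n hn => ?_
    have h1 := D.toFreeRes.nontrivial_H_term_of_nontrivial ρ hlow hhigh hp
      ((GrMod.mem_localCohomologySupport_iff ρ).1 hn)
    obtain ⟨q, hq⟩ : ∃ q, Nontrivial (GrMod.H ρ (GrMod.self 𝒜) d (D.shift p q + n)) := by
      by_contra! h
      exact not_subsingleton_iff_nontrivial.2 h1 ((GrMod.subsingleton_H_free_iff _ ρ d n).2 h)
    have h2 : ExtInt.ofInt (D.shift p q j + n j) ≤ (GrMod.self 𝒜).aInv d j :=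
      le_iSup₂_of_le (D.shift p q + n) ((GrMod.mem_localCohomologySupport_iff ρ).2 hq) le_rfl
    calc ExtInt.ofInt (n j)
        = ExtInt.ofInt (-D.shift p q j) + ExtInt.ofInt (D.shift p q j + n j) := by
          rw [show ExtInt.ofInt (-D.shift p q j) + ExtInt.ofInt (D.shift p q j + n j) =
            ExtInt.ofInt (-D.shift p q j + (D.shift p q j + n j)) from rfl, neg_add_cancel_left]
      _ ≤ _ := add_le_add (D.ofInt_le_t p q j) h2
  have hlexlt : ∀ (p : ℕ) (σ : Equiv.Perm (Fin r)), σ ⟨0, Fin.pos j⟩ = j →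
      D.lexMax σ (p + 1) < D.lexMax σ p →
      p ≤ d ∧ M.aInv (d - p) j = D.t p j + (GrMod.self 𝒜).aInv d j ∧
        ((d - p : ℕ) : WithBot ℕ∞) ≤ Module.supportDim S M.carrier := by
    intro p σ hσ hp
    obtain ⟨m, hm, hmax⟩ := hlex σ
    obtain ⟨q₀, hq₀⟩ := D.exists_lexMax_eq σ (ne_bot_of_gt hp)
    obtain ⟨hpd, hM⟩ := D.nontrivial_H_of_lexMax_lt hN h0 ρ hlow hhigh hm hmax hp hq₀
    refine ⟨hpd, le_antisymm (hupper p hpd) ?_, not_lt.1 fun h =>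
      not_subsingleton_iff_nontrivial.2 hM ((GrMod.isTame_of_finite hN hk ρ j M).1 _ _ h)⟩
    rw [hα σ hσ m hm hmax]
    calc D.t p j + ExtInt.ofInt (m j)
        ≤ ExtInt.ofInt (-D.shift p q₀ j) + ExtInt.ofInt (m j) := by
          gcongr
          exact D.t_le_ofInt_of_lexMax_le hσ hq₀.le
      _ = ExtInt.ofInt ((m - D.shift p q₀) j) := by
          rw [show ExtInt.ofInt (-D.shift p q₀ j) + ExtInt.ofInt (m j) =
            ExtInt.ofInt (-D.shift p q₀ j + m j) from rfl, Pi.sub_apply, neg_add_eq_sub]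
      _ ≤ _ := le_iSup₂_of_le (m - D.shift p q₀)
        ((GrMod.mem_localCohomologySupport_iff ρ).2 hM) le_rfl
  refine ⟨?_, fun i => ?_, fun p _ hp => hupper p ?_, fun p σ hσ hp =>
    ⟨(hlexlt p σ hσ hp).1, (hlexlt p σ hσ hp).2.1⟩, le_antisymm ?_ ?_⟩
  -- The transposition of the first index with `j` is a permutation with `σ(1) = j`.
  · obtain ⟨m, hm, hmax⟩ := hlex (Equiv.swap ⟨0, Fin.pos j⟩ j)
    exact ⟨m j, hα _ (Equiv.swap_apply_left _ _) m hm hmax⟩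
  · obtain ⟨c, hc⟩ := (GrMod.isTame_of_finite hN hk ρ j M).2
    have h1 : M.aInv i j ≤ ExtInt.ofInt c := iSup₂_le fun n hn => by
      have h2 : n j ≤ c := not_lt.1 fun h => not_subsingleton_iff_nontrivial.2
        ((GrMod.mem_localCohomologySupport_iff ρ).1 hn) (hc i n h)
      exact ExtInt.ofInt_mono h2
    refine ne_top_of_le_ne_top ?_ h1
    intro h
    exact WithTop.coe_ne_top (WithBot.coe_injective h)
  · exact_mod_cast le_self_add.trans hp
  · refine iSup₂_le fun i hi => ?_
    have hid : i ≤ d := by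
      have h1 := (le_trans hi (Module.supportDim_le_ringKrullDim S M.carrier)).trans_eq hd
      exact_mod_cast h1
    have h2 := hupper (d - i) (Nat.sub_le d i)
    rw [Nat.sub_sub_self hid] at h2
    exact h2.trans (by gcongr; exact D.t_le_tStar _ j)
  · have hσ : Equiv.swap (⟨0, Fin.pos j⟩ : Fin r) j ⟨0, Fin.pos j⟩ = j := Equiv.swap_apply_left _ _
    rcases D.exists_lexMax_last (Equiv.swap ⟨0, Fin.pos j⟩ j) with h | ⟨p, hp, hmax⟩
    -- All terms of the resolution are zero, and `-∞` absorbs addition.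
    · have h1 : D.tStar j = ⊥ := (Finset.sup_eq_bot_iff _ _).2 fun p _ =>
        (Finset.sup_eq_bot_iff _ _).2 fun q _ =>
          absurd (h p ▸ D.le_lexMax _ p q) (not_le.2 (WithBot.bot_lt_coe _))
      rw [h1, WithBot.bot_add]
      exact bot_le
    · obtain ⟨hpd, heq, hdim⟩ := hlexlt p _ hσ hp
      obtain ⟨q₀, hq₀⟩ := D.exists_lexMax_eq _ (ne_bot_of_gt hp)
      -- At the last global maximum `t_p^j` equals `t_*^j`, and the index `d - p` counts in
      -- `a_*^j(M)` because nonvanishing forces `d - p ≤ dim M`.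
      calc D.tStar j + (GrMod.self 𝒜).aInv d j ≤ D.t p j + (GrMod.self 𝒜).aInv d j := by
            gcongr
            exact Finset.sup_le fun p' _ =>
              (D.t_le_ofInt_of_lexMax_le hσ ((hmax p').trans_eq hq₀)).trans (D.ofInt_le_t p q₀ j)
        _ = M.aInv (d - p) j := heq.symm
        _ ≤ M.aStar j := le_iSup₂_of_le (d - p) hdim le_rfl
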